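/- \textbf{Theorem (Stability of the Discrete Velocity Field).} Let $d\in\{2,3\}$, $m\in\mathbb N$ and $\rho>0$. There is $\eta_0=\eta_0(d,m,\rho)$ such that for every $\eta>\eta_0$ there is a constant $C_{III}=C_{III}(d,m,\rho,\eta)>0$, independent of the mesh size $h$, with the following property. Let $\Omega\subset\mathbb R^d$ be a bounded polyhedral domain that is the interior of its closure, and let $\mathcal T_h$ be a mesh of $\Omega$ without hanging nodes, made of convex polytopes (for instance simplices or parallelepipeds), each element $K$ of which contains a ball of radius $\rho\,\mathrm{diam}\,K$. Let $\mathcal F_h$ be the set of faces, $\mathcal F_h^i$ the set of interior faces, $h_F=\mathrm{diam}\,F$, and $n_F$ a unit normal of $F$, pointing from the side $+$ to the side $-$ (outward on boundary faces); put $[\![v]\!]=v_+-v_-$, $\{\!\{v\}\!\}=\frac12(v_++v_-)$ on interior faces and $[\![v]\!]=\{\!\{v\}\!\}=v$ on boundary faces. Write $(\cdot,\cdot)=\sum_K\int_K$, $\langle\cdot,\cdot\rangle_{\mathcal F}=\sum_{F\in\mathcal F}\int_F$, $\nabla_h$ and $\nabla\cdot$ for the elementwise gradient and divergence, and $\sigma(v)=\nabla_h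 v+\nabla_h v^T-\frac23(\nabla\cdot v)\mathbb I$. Let $W_h\subset H_0(\mathrm{div};\Omega)$, $R_h\subset H_0^1(\Omega)$, $Q_h\subset L^2_*(\Omega)$ (zero mean) be linear spaces of piecewise polynomial functions, the degree in $W_h$ being at most $m$ and the degrees in $R_h$ and $Q_h$ being bounded. Set \begin{align*} b_h(v,q)&=(\nabla\cdot v,q),\\ c_h(\xi;v,w)&=(\xi\cdot\nabla_h v,w)+\tfrac12((\nabla\cdot\xi)v,w)-\langle(\xi\cdot n_F)[\![v]\!],\{\!\{w\}\!\}\rangle_{\mathcal F_h^i}+\zeta\langle|\xi\cdot n_F|[\![v]\!],[\![w]\!]\rangle_{\mathcal F_h^i},\\ a_h(v,w)&=(\sigma(v),\nabla_h w)-\langle[\![v]\!],\{\!\{\sigma(w)\}\!\}n_F\rangle_{\mathcal F_h}-\langle[\![w]\!],\{\!\{\sigma(v)\}\!\}n_F\rangle_{\mathcal F_h}+\langle\tfrac{\eta}{h_F}[\![v]\!],[\![w]\!]\rangle_{\mathcal F_h},\\ \underline c_h(\xi;\theta,r)&=(\xi\cdot\nabla_h\theta,r)+\tfrac12((\nabla\cdot\xi)\theta,r)-\langle(\xi\cdot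 n_F)[\![\theta]\!],\{\!\{r\}\!\}\rangle_{\mathcal F_h^i}+\delta\langle|\xi\cdot n_F|[\![\theta]\!],[\![r]\!]\rangle_{\mathcal F_h^i},\\ \underline a_h(\theta,r)&=(\nabla_h\theta,\nabla_h r)-\langle[\![\theta]\!],\{\!\{\nabla_h r\}\!\}\cdot n_F\rangle_{\mathcal F_h}-\langle[\![r]\!],\{\!\{\nabla_h\theta\}\!\}\cdot n_F\rangle_{\mathcal F_h}+\langle\tfrac{\varepsilon}{h_F}[\![\theta]\!],[\![r]\!]\rangle_{\mathcal F_h}. \end{align*} Let $\nu_h\ge0$, $C_v>0$, $\zeta\ge0$, let $\beta_h,g,\alpha_h,\gamma_h,\delta,\varepsilon\in\mathbb R$, let $\mathbf g$ be the vector with components $-g\,\delta_{id}$, let $t_0\le t_n$, $f_u\in L^1(t_0,t_n;L^2(\Omega)^d)$ and $f_T(t)\in L^2(\Omega)$. Let $u_h(t)\in W_h$, $T_h(t)\in R_h$, $\widetilde p_h(t)\in Q_h$ for $t\in[t_0,t_n]$, with $u_h$ and $T_h$ absolutely continuous in time, satisfy for almost every $t\in(t_0,t_n)$ and all $q\in Q_h$,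 $w\in W_h$, $r\in R_h$ \begin{align*} &b_h(u_h,q)=0,\\ &(\partial_t u_h,w)+c_h(u_h;u_h,w)+\nu_h a_h(u_h,w)-b_h(w,\widetilde p_h)=-(\beta_hT_h\mathbf g,w)+(f_u,w),\\ &(\partial_t T_h,r)+\underline c_h(u_h;T_h,r)+\alpha_h\gamma_h\underline a_h(T_h,r)=\tfrac1{C_v}\big(\nu_h\,\sigma(u_h):\nabla_hu_h-\widetilde p_h\nabla\cdot u_h,\,r\big)+(f_T,r). \end{align*} Then \begin{align*} &\tfrac12\|u_h(t_n)\|_{L^2(\Omega)}^2+\int_{t_0}^{t_n}|u_h(s)|_{u_h(s)}^2\,ds+C_{III}\,\nu_h\int_{t_0}^{t_n}\|u_h(s)\|_{\mathrm{sym},2}^2\,ds\\ &\qquad\le\tfrac12\Big(3\|u_h(t_0)\|_{L^2(\Omega)}^2+5\beta_h^2g^2\Big(\int_{t_0}^{t_n}\|T_h(s)\|_{L^2(\Omega)}ds\Big)^2+5\Big(\int_{t_0}^{t_n}\|f_u(s)\|_{L^2(\Omega)}ds\Big)^2\Big), \end{align*} where all integrals are finite, $|w|_\xi^2=\zeta\langle|\xi\cdot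 n_F|[\![w]\!],[\![w]\!]\rangle_{\mathcal F_h^i}$ and $\|w\|_{\mathrm{sym},2}^2=\|\sigma(w)\|_{L^2(\Omega)}^2+\sum_{F\in\mathcal F_h}h_F^{-1}\|[\![w]\!]\|_{L^2(F)}^2$. -/

import Mathlib

open MeasureTheory Set Filter Topology
open scoped BigOperators ContDiff

noncomputable section

namespace VersatileMixed

/-- Euclidean space `ℝ^d`. -/
abbrev Euc (d : ℕ) : Type := EuclideanSpace ℝ (Fin d)

/-! ### Function spaces on a domain -/

/-- `H_0(div; Ω)`: square-integrable fields with a weak divergence `g ∈ L²(Ω)` and vanishing normal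
trace on the boundary, the trace being understood through Green's formula: the boundary term
vanishes against every smooth test function, also those that do not vanish on the boundary. -/
def MemHdivZero {d : ℕ} (Ω : Set (Euc d)) (w : Euc d → Euc d) : Prop :=
  MemLp w 2 (volume.restrict Ω) ∧
    ∃ g : Euc d → ℝ, MemLp g 2 (volume.restrict Ω) ∧
      ∀ φ : Euc d → ℝ, ContDiff ℝ ∞ φ → HasCompactSupport φ →
        ∫ x in Ω, inner ℝ (w x) (gradient φ x) = -∫ x in Ω, g x * φ x

/-- `H_0^1(Ω)` for scalar functions: square-integrable functions with a weak gradient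
`G ∈ L²(Ω)` and vanishing trace on the boundary, again in the sense of Green's formula. -/
def MemHOneZero {d : ℕ} (Ω : Set (Euc d)) (r : Euc d → ℝ) : Prop :=
  MemLp r 2 (volume.restrict Ω) ∧
    ∃ G : Euc d → Euc d, MemLp G 2 (volume.restrict Ω) ∧
      ∀ φ : Euc d → ℝ, ContDiff ℝ ∞ φ → HasCompactSupport φ →
        ∫ x in Ω, r x • gradient φ x = -∫ x in Ω, φ x • G x

/-- `L²_*(Ω)`: square-integrable functions with zero mean. -/
def MemLTwoMeanZero {d : ℕ} (Ω : Set (Euc d)) (q : Euc d → ℝ) : Prop :=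
  MemLp q 2 (volume.restrict Ω) ∧ ∫ x in Ω, q x = 0

/-- Real polynomial functions on `ℝ^d` of total degree at most `k`. -/
def IsPoly {d : ℕ} (k : ℕ) (f : Euc d → ℝ) : Prop :=
  ∃ P : MvPolynomial (Fin d) ℝ, P.totalDegree ≤ k ∧
    ∀ x : Euc d, f x = MvPolynomial.eval (fun i => x i) P

/-- Vector fields all of whose components are polynomials of degree at most `k`. -/
def IsPolyVec {d : ℕ} (k : ℕ) (f : Euc d → Euc d) : Prop :=
  ∀ i : Fin d, IsPoly k (fun x => f x i)

/-! ### Elements and meshes -/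

/-- A straight-sided element: a `d`-dimensional convex polytope, given by the (irredundant) list of
its `(d-1)`-dimensional faces, each with its outward unit normal. Simplices, parallelepipeds and
convex hexahedra with planar faces are examples. -/
structure Element (d : ℕ) where
  /-- labels of the faces -/
  Face : Type
  [fintypeFace : Fintype Face]
  /-- outward unit normals -/
  normal : Face → Euc d
  /-- the face lies in the hyperplane `{x | ⟪normal, x⟫ = offset}` -/
  offset : Face → ℝ
  norm_normal : ∀ i, ‖normal i‖ = 1
  isBounded : Bornology.IsBounded {x : Euc d | ∀ i, inner ℝ (normal i) x ≤ offset i}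
  solid : ∃ x : Euc d, ∀ i, inner ℝ (normal i) x < offset i
  irredundant : ∀ i, ∃ x : Euc d, inner ℝ (normal i) x = offset i ∧
    ∀ j, j ≠ i → inner ℝ (normal j) x < offset j

attribute [instance] Element.fintypeFace

/-- The closed polytope. -/
def Element.carrier {d : ℕ} (K : Element d) : Set (Euc d) :=
  {x | ∀ i, inner ℝ (K.normal i) x ≤ K.offset i}

/-- The closed face with label `i`. -/
def Element.face {d : ℕ} (K : Element d) (i : K.Face) : Set (Euc d) :=
  {x | x ∈ K.carrier ∧ inner ℝ (K.normal i) x = K.offset i}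

/-- A mesh of `Ω` without hanging nodes: non-overlapping elements that cover `Ω`; every face of an
element is either a boundary face, contained in `∂Ω`, or coincides with exactly one face of another
element, with opposite normals. For each interior face one of the two sides is
called `plus`, the other one `minus`. -/
structure Mesh (d : ℕ) (Ω : Set (Euc d)) where
  Elem : Type
  [fintypeElem : Fintype Elem]
  elem : Elem → Element d
  domain_regular : interior (closure Ω) = Ω
  covers : (⋃ K, (elem K).carrier) = closure Ω
  nonoverlap : ∀ K L, K ≠ L →
    Disjoint (interior (elem K).carrier) (interior (elem L).carrier)
  /-- interior faces -/
  IFace : Type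
  [fintypeIFace : Fintype IFace]
  /-- boundary faces -/
  BFace : Type
  [fintypeBFace : Fintype BFace]
  plus : IFace → (K : Elem) × (elem K).Face
  minus : IFace → (K : Elem) × (elem K).Face
  bdry : BFace → (K : Elem) × (elem K).Face
  faces_bijective : Function.Bijective (Sum.elim plus (Sum.elim minus bdry))
  conforming : ∀ F, (elem (plus F).1).face (plus F).2 = (elem (minus F).1).face (minus F).2
  normal_opposite : ∀ F,
    (elem (minus F).1).normal (minus F).2 = -(elem (plus F).1).normal (plus F).2
  bdry_subset : ∀ F, (elem (bdry F).1).face (bdry F).2 ⊆ frontier Ω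

attribute [instance] Mesh.fintypeElem Mesh.fintypeIFace Mesh.fintypeBFace

namespace Mesh

variable {d : ℕ} {Ω : Set (Euc d)} (M : Mesh d Ω)

/-- Shape regularity: every element `K` contains a ball of radius `ρ · diam K`. -/
def ShapeRegular (ρ : ℝ) : Prop :=
  ∀ K, ∃ c : Euc d,
    Metric.closedBall c (ρ * Metric.diam (M.elem K).carrier) ⊆ (M.elem K).carrier

/-- The function on `Ω` (defined off the mesh skeleton, a null set) given by elementwise data. -/
def glue {V : Type*} [AddCommMonoid V] (w : M.Elem → Euc d → V) : Euc d → V :=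
  fun x => ∑ K, (interior (M.elem K).carrier).indicator (w K) x

/-! Volume terms: `(f, 1)_{𝒯_h} = ∑_K ∫_K f dV`. -/

/-- `∑_K ∫_K f_K dV`. -/
def vol (f : M.Elem → Euc d → ℝ) : ℝ :=
  ∑ K, ∫ x in (M.elem K).carrier, f K x

/-- All faces of the mesh. -/
abbrev Faces : Type := M.IFace ⊕ M.BFace

/-- The element and local face from which the normal `n_F` points outward. -/
def side : M.Faces → (K : M.Elem) × (M.elem K).Face
  | Sum.inl F => M.plus F
  | Sum.inr F => M.bdry F

/-- The point set of a face. -/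
def faceSet (F : M.Faces) : Set (Euc d) := (M.elem (M.side F).1).face (M.side F).2

/-- The unit normal `n_F`. -/
def nF (F : M.Faces) : Euc d := (M.elem (M.side F).1).normal (M.side F).2

/-- The face size `h_F`. -/
def hF (F : M.Faces) : ℝ := Metric.diam (M.faceSet F)

/-- Surface integral over a face (`μHE[d-1]` is the `(d-1)`-dimensional surface measure). -/
def faceInt (F : M.Faces) (f : Euc d → ℝ) : ℝ :=
  ∫ x in M.faceSet F, f x ∂(μHE[d - 1] : Measure (Euc d))

/-- Jump across a face; on boundary faces the trace itself. -/
def jump {V : Type*} [AddCommGroup V] (w : M.Elem → Euc d → V) : M.Faces → Euc d → V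
  | Sum.inl F => fun x => w (M.plus F).1 x - w (M.minus F).1 x
  | Sum.inr F => fun x => w (M.bdry F).1 x

/-- Average on a face; on boundary faces the trace itself. -/
def avg {V : Type*} [AddCommGroup V] [Module ℝ V] (w : M.Elem → Euc d → V) :
    M.Faces → Euc d → V
  | Sum.inl F => fun x => (1 / 2 : ℝ) • (w (M.plus F).1 x + w (M.minus F).1 x)
  | Sum.inr F => fun x => w (M.bdry F).1 x

end Mesh

/-! ### Pointwise differential operators -/

/-- `(∇v)_{ij} = ∂_j v_i`. -/
def gradMat {d : ℕ} (v : Euc d → Euc d) (x : Euc d) : Matrix (Fin d) (Fin d) ℝ :=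
  Matrix.of fun i j => (fderiv ℝ v x (EuclideanSpace.single j 1)) i

/-- `∇ · v`. -/
def divg {d : ℕ} (v : Euc d → Euc d) (x : Euc d) : ℝ := (gradMat v x).trace

/-- `∇v + ∇vᵀ - (2/3) (∇ · v) 𝕀`. -/
def stress {d : ℕ} (v : Euc d → Euc d) (x : Euc d) : Matrix (Fin d) (Fin d) ℝ :=
  gradMat v x + (gradMat v x).transpose - ((2 / 3 : ℝ) * divg v x) • (1 : Matrix (Fin d) (Fin d) ℝ)

/-- `A : B`. -/
def frob {d : ℕ} (A B : Matrix (Fin d) (Fin d) ℝ) : ℝ := ∑ i, ∑ j, A i j * B i j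

/-- `a · (A n)`. -/
def contract {d : ℕ} (a : Euc d) (A : Matrix (Fin d) (Fin d) ℝ) (n : Euc d) : ℝ :=
  ∑ i, ∑ j, a i * A i j * n j

/-! ### Discrete operators -/

namespace Mesh

variable {d : ℕ} {Ω : Set (Euc d)} (M : Mesh d Ω)

/-- `(v, w)_{𝒯_h}` for vector fields. -/
def ipVec (v w : M.Elem → Euc d → Euc d) : ℝ := M.vol fun K x => inner ℝ (v K x) (w K x)

/-- `(r, s)_{𝒯_h}` for scalar functions. -/
def ipSc (r s : M.Elem → Euc d → ℝ) : ℝ := M.vol fun K x => r K x * s K x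

/-- `‖w‖_{L²(Ω)}` for vector fields. -/
def normVec (w : M.Elem → Euc d → Euc d) : ℝ := Real.sqrt (M.ipVec w w)

/-- `‖r‖_{L²(Ω)}` for scalar functions. -/
def normSc (r : M.Elem → Euc d → ℝ) : ℝ := Real.sqrt (M.ipSc r r)

/-- `b_h(v, q)`. -/
def bForm (v : M.Elem → Euc d → Euc d) (q : M.Elem → Euc d → ℝ) : ℝ :=
  M.vol fun K x => divg (v K) x * q K x

/-- The trilinear form `c_h(ξ; v, w)`. The normal component of `ξ` is single-valued on faces for
`ξ` in `H_0(div; Ω)`; it is written as the normal component of the average. -/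
def cForm (ζ : ℝ) (ξ v w : M.Elem → Euc d → Euc d) : ℝ :=
  (M.vol fun K x => inner ℝ (fderiv ℝ (v K) x (ξ K x)) (w K x))
  + (1 / 2) * (M.vol fun K x => divg (ξ K) x * inner ℝ (v K x) (w K x))
  - (∑ F : M.IFace, M.faceInt (Sum.inl F) fun x =>
      inner ℝ (M.avg ξ (Sum.inl F) x) (M.nF (Sum.inl F)) *
        inner ℝ (M.jump v (Sum.inl F) x) (M.avg w (Sum.inl F) x))
  + ζ * (∑ F : M.IFace, M.faceInt (Sum.inl F) fun x =>
      |inner ℝ (M.avg ξ (Sum.inl F) x) (M.nF (Sum.inl F))| *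
        inner ℝ (M.jump v (Sum.inl F) x) (M.jump w (Sum.inl F) x))

/-- The viscous bilinear form `a_h(v, w)`, with the full compressible stress. -/
def aForm (η : ℝ) (v w : M.Elem → Euc d → Euc d) : ℝ :=
  (M.vol fun K x => frob (stress (v K) x) (gradMat (w K) x))
  - (∑ F : M.Faces, M.faceInt F fun x =>
      contract (M.jump v F x) (M.avg (fun K => stress (w K)) F x) (M.nF F))
  - (∑ F : M.Faces, M.faceInt F fun x =>
      contract (M.jump w F x) (M.avg (fun K => stress (v K)) F x) (M.nF F))
  + (∑ F : M.Faces, M.faceInt F fun x =>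
      η / M.hF F * inner ℝ (M.jump v F x) (M.jump w F x))

/-- The trilinear form `c̲_h(ξ; θ, r)` of the temperature equation. -/
def cFormT (δ : ℝ) (ξ : M.Elem → Euc d → Euc d) (θ r : M.Elem → Euc d → ℝ) : ℝ :=
  (M.vol fun K x => fderiv ℝ (θ K) x (ξ K x) * r K x)
  + (1 / 2) * (M.vol fun K x => divg (ξ K) x * θ K x * r K x)
  - (∑ F : M.IFace, M.faceInt (Sum.inl F) fun x =>
      inner ℝ (M.avg ξ (Sum.inl F) x) (M.nF (Sum.inl F)) *
        (M.jump θ (Sum.inl F) x * M.avg r (Sum.inl F) x))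
  + δ * (∑ F : M.IFace, M.faceInt (Sum.inl F) fun x =>
      |inner ℝ (M.avg ξ (Sum.inl F) x) (M.nF (Sum.inl F))| *
        (M.jump θ (Sum.inl F) x * M.jump r (Sum.inl F) x))

/-- The bilinear form `a̲_h(θ, r)` of the temperature equation. -/
def aFormT (ε : ℝ) (θ r : M.Elem → Euc d → ℝ) : ℝ :=
  (M.vol fun K x => inner ℝ (gradient (θ K) x) (gradient (r K) x))
  - (∑ F : M.Faces, M.faceInt F fun x =>
      M.jump θ F x * inner ℝ (M.avg (fun K => gradient (r K)) F x) (M.nF F))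
  - (∑ F : M.Faces, M.faceInt F fun x =>
      M.jump r F x * inner ℝ (M.avg (fun K => gradient (θ K)) F x) (M.nF F))
  + (∑ F : M.Faces, M.faceInt F fun x => ε / M.hF F * (M.jump θ F x * M.jump r F x))

/-- The convective seminorm `|w|_ξ = (ζ ⟨|ξ · n_F| [[w]], [[w]]⟩)^{1/2}` over interior faces. -/
def convSeminorm (ζ : ℝ) (ξ w : M.Elem → Euc d → Euc d) : ℝ :=
  Real.sqrt (ζ * ∑ F : M.IFace, M.faceInt (Sum.inl F) fun x =>
    |inner ℝ (M.avg ξ (Sum.inl F) x) (M.nF (Sum.inl F))| *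
      inner ℝ (M.jump w (Sum.inl F) x) (M.jump w (Sum.inl F) x))

/-- The full symmetric gradient norm `‖w‖_{sym,p}`. -/
def symNorm (p : ℝ) (w : M.Elem → Euc d → Euc d) : ℝ :=
  ((M.vol fun K x => ∑ i, ∑ j, |stress (w K) x i j| ^ p)
    + ∑ F : M.Faces, 1 / (M.hF F) ^ (p - 1) *
        M.faceInt F fun x => ∑ i, |M.jump w F x i| ^ p) ^ (1 / p)

end Mesh

/-! ### The versatile mixed method -/

/-- Discrete spaces `W_h ⊂ H_0(div; Ω)`, `R_h ⊂ H_0^1(Ω)`, `Q_h ⊂ L²_*(Ω)` of piecewise polynomial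
functions. The degree in the velocity space is at most `m`; the other two degrees are arbitrary.
A discrete function is recorded through the polynomials that represent it on the elements. -/
structure Spaces {d : ℕ} {Ω : Set (Euc d)} (M : Mesh d Ω) (m : ℕ) where
  W : Submodule ℝ (M.Elem → Euc d → Euc d)
  R : Submodule ℝ (M.Elem → Euc d → ℝ)
  Q : Submodule ℝ (M.Elem → Euc d → ℝ)
  degR : ℕ
  degQ : ℕ
  polyW : ∀ w ∈ W, ∀ K, IsPolyVec m (w K)
  polyR : ∀ r ∈ R, ∀ K, IsPoly degR (r K)
  polyQ : ∀ q ∈ Q, ∀ K, IsPoly degQ (q K)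
  subW : ∀ w ∈ W, MemHdivZero Ω (M.glue w)
  subR : ∀ r ∈ R, MemHOneZero Ω (M.glue r)
  subQ : ∀ q ∈ Q, MemLTwoMeanZero Ω (M.glue q)

/-- Physical coefficients and numerical flux parameters (other than `η`). -/
structure Params where
  /-- kinematic viscosity `ν_h` -/
  ν : ℝ
  /-- thermal expansion coefficient `β_h` -/
  β : ℝ
  /-- gravitational constant -/
  g : ℝ
  /-- thermal diffusivity `α_h` -/
  α : ℝ
  /-- ratio of specific heats `γ_h` -/
  γ : ℝ
  /-- specific heat at constant volume -/
  Cv : ℝ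
  /-- convective flux parameter for the velocity -/
  ζ : ℝ
  /-- convective flux parameter for the temperature -/
  δ : ℝ
  /-- viscous flux parameter for the temperature -/
  ε : ℝ

/-- The gravity vector, `g_i = -g δ_{id}`. -/
def gravity (d : ℕ) (g : ℝ) : Euc d :=
  WithLp.toLp 2 fun i : Fin d => if (i : ℕ) + 1 = d then -g else 0

/-- `(u, T, p)` solves the semi-discrete versatile mixed method on `[t₀, tₙ]`: the unknowns lie in
the discrete spaces at all times, `u` and `T` are absolutely continuous in time, and the discrete
mass, momentum and energy equations hold for almost every time. -/
structure IsSolution {d m : ℕ} {Ω : Set (Euc d)} (M : Mesh d Ω) (S : Spaces M m)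
    (prm : Params) (η t₀ tₙ : ℝ)
    (fu : ℝ → Lp (Euc d) 2 (volume.restrict Ω)) (fT : ℝ → Lp ℝ 2 (volume.restrict Ω))
    (u : ℝ → M.Elem → Euc d → Euc d) (T p : ℝ → M.Elem → Euc d → ℝ) : Prop where
  memW : ∀ t ∈ Icc t₀ tₙ, u t ∈ S.W
  memR : ∀ t ∈ Icc t₀ tₙ, T t ∈ S.R
  memQ : ∀ t ∈ Icc t₀ tₙ, p t ∈ S.Q
  acU : ∀ K x, AbsolutelyContinuousOnInterval (fun t => u t K x) t₀ tₙ
  acT : ∀ K x, AbsolutelyContinuousOnInterval (fun t => T t K x) t₀ tₙ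
  mass : ∀ᵐ t, t ∈ Ioo t₀ tₙ → ∀ q ∈ S.Q, M.bForm (u t) q = 0
  momentum : ∀ᵐ t, t ∈ Ioo t₀ tₙ → ∀ w ∈ S.W,
    M.ipVec (fun K x => deriv (fun s => u s K x) t) w
      + M.cForm prm.ζ (u t) (u t) w + prm.ν * M.aForm η (u t) w - M.bForm w (p t)
    = -M.ipVec (fun K x => (prm.β * T t K x) • gravity d prm.g) w + M.ipVec (fun _ x => fu t x) w
  energy : ∀ᵐ t, t ∈ Ioo t₀ tₙ → ∀ r ∈ S.R,
    M.ipSc (fun K x => deriv (fun s => T s K x) t) r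
      + M.cFormT prm.δ (u t) (T t) r + prm.α * prm.γ * M.aFormT prm.ε (T t) r
    = M.ipSc (fun K x =>
        prm.ν / prm.Cv * frob (stress (u t K) x) (gradMat (u t K) x)
          - 1 / prm.Cv * (p t K x * divg (u t K) x)) r
      + M.ipSc (fun _ x => fT t x) r

end VersatileMixed

end

/-! The proof is an energy estimate. Testing the momentum equation with `u` itself, and the mass
equation with the pressure, removes the pressure term and leaves `½ d/dt ‖u‖² + c_h(u;u,u) + ν
a_h(u,u)` bounded by `(|β| |g| ‖T‖ + ‖f_u‖) ‖u‖`, where Cauchy–Schwarz is used for the loads. Two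
facts about the forms are needed.

Convection (`Mesh.cForm_self`): `c_h(u;u,u) = |u|_u²`. The volume terms form half the divergence of
`|u|² u`, hence become face integrals; if the normal component of `u` is single-valued on interior
faces and zero on boundary faces, these cancel the central flux exactly and only the upwind term
survives. Membership in `H_0(div; Ω)` is given only through Green's formula, so the vanishing of the
normal jump is proved (`Mesh.ae_normal_jump_eq_zero`): test functions concentrated in ever thinner
layers around the hyperplane of one face lose all volume terms but keep the face term. This rests on
the divergence theorem for convex polytopes, obtained by integrating by parts against smooth cutoffs
that collapse to the indicator of the polytope.

Viscosity (`Mesh.exists_coercivity_constant`): for `d ≤ 3` the stress satisfies `σ(v) : ∇v ≥ ½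
|σ(v)|²`. The consistency terms are absorbed by Young's inequality and a discrete trace inequality
whose constant depends only on `d`, `m` and `ρ`. Equivalence of norms on polynomials, rescaled to
the element, bounds point values; the inscribed ball bounds the total surface area of the element,
however many faces it has.

The resulting inequality `½ y' + D ≤ h √y` for `y = ‖u‖²` is integrated twice (`energy_gronwall`):
without `D` it gives `√y(t) ≤ √y(t₀) + ∫ h`, and inserting this bound gives `½ y(tₙ) + ∫ D ≤ ½
(√y(t₀) + ∫ h)²`. An elementary inequality for three summands yields the constants 3, 5, 5.
Regularity in time is handled through values at finitely many interpolation nodes, which determine a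
discrete function on each element. -/

namespace VersatileMixed

/-! ### Slicing along a unit normal -/

section Slicing

variable {d : ℕ}

/-- The hyperplane through the origin orthogonal to `n`. -/
noncomputable abbrev Perp (n : Euc d) : Submodule ℝ (Euc d) := (ℝ ∙ n)ᗮ

/-- The embedding of `n^⊥` as the hyperplane at signed distance `c`. -/
noncomputable def slice (n : Euc d) (c : ℝ) (y : Perp n) : Euc d := (y : Euc d) + c • n

theorem inner_perp (n : Euc d) (y : Perp n) : inner ℝ n (y : Euc d) = 0 :=
  (Submodule.mem_orthogonal_singleton_iff_inner_right).1 y.2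

theorem inner_slice {n : Euc d} (hn : ‖n‖ = 1) (c : ℝ) (y : Perp n) :
    inner ℝ n (slice n c y) = c := by
  simp [slice, inner_add_right, inner_smul_right, inner_perp, hn]

theorem isometry_slice (n : Euc d) (c : ℝ) : Isometry (slice n c) :=
  (isometry_add_right (c • n)).comp isometry_subtype_coe

theorem continuous_slice (n : Euc d) : Continuous fun p : Perp n × ℝ => slice n p.2 p.1 := by
  unfold slice; fun_prop

theorem range_slice {n : Euc d} (hn : ‖n‖ = 1) (c : ℝ) :
    range (slice n c) = {x | inner ℝ n x = c} := by
  ext x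
  constructor
  · rintro ⟨y, rfl⟩; exact inner_slice hn c y
  · intro hx
    refine ⟨⟨x - c • n, ?_⟩, by simp [slice]⟩
    rw [Submodule.mem_orthogonal_singleton_iff_inner_right, inner_sub_right, inner_smul_right]
    simp only [mem_ofPred_eq] at hx
    simp [hn, hx]

theorem finrank_perp {n : Euc d} (hn : ‖n‖ = 1) : Module.finrank ℝ (Perp n) = d - 1 := by
  have h0 : n ≠ 0 := by rintro rfl; simp at hn
  have h1 := Submodule.finrank_add_finrank_orthogonal (ℝ ∙ n)
  rw [finrank_span_singleton h0, finrank_euclideanSpace_fin] at h1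
  change Module.finrank ℝ (ℝ ∙ n)ᗮ = d - 1
  omega

/-- An isometry transports Euclidean Hausdorff measure to its range, and on the `(d-1)`-dimensional
space `n^⊥` this measure is Lebesgue measure. Surface integrals over faces thereby become ordinary
integrals over `n^⊥`. -/
theorem map_slice_volume {n : Euc d} (hn : ‖n‖ = 1) (c : ℝ) :
    (volume : Measure (Perp n)).map (slice n c) =
      (μHE[d - 1] : Measure (Euc d)).restrict {x | inner ℝ n x = c} := by
  rw [← range_slice hn, ← (isometry_slice n c).map_euclideanHausdorffMeasure, ← finrank_perp hn,
    InnerProductSpace.euclideanHausdorffMeasure_eq_volume]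

theorem measurableEmbedding_slice (n : Euc d) (c : ℝ) : MeasurableEmbedding (slice n c) :=
  (isometry_slice n c).isClosedEmbedding.measurableEmbedding

theorem setIntegral_hyperplane {n : Euc d} (hn : ‖n‖ = 1) (c : ℝ) {A : Set (Euc d)}
    (hA : A ⊆ {x | inner ℝ n x = c}) (hm : MeasurableSet A) (f : Euc d → ℝ) :
    ∫ x in A, f x ∂(μHE[d - 1] : Measure (Euc d)) = ∫ y in slice n c ⁻¹' A, f (slice n c y) := by
  rw [← (measurableEmbedding_slice n c).setIntegral_map, map_slice_volume hn,
    Measure.restrict_restrict hm, inter_eq_left.2 hA]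

theorem surface_measure_eq {n : Euc d} (hn : ‖n‖ = 1) (c : ℝ) {A : Set (Euc d)}
    (hA : A ⊆ {x | inner ℝ n x = c}) (hm : MeasurableSet A) :
    (μHE[d - 1] : Measure (Euc d)) A = volume (slice n c ⁻¹' A) := by
  rw [← (measurableEmbedding_slice n c).map_apply, map_slice_volume hn,
    Measure.restrict_apply hm, inter_eq_left.2 hA]

/-- Fubini in the direction `n`: up to swapping the factors and identifying `ℝ` with `ℝ n`, the map
is the inverse of the orthogonal decomposition of the space into `ℝ n` and `n^⊥`, an isometry. -/
theorem measurePreserving_slice {n : Euc d} (hn : ‖n‖ = 1) :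
    MeasurePreserving (fun p : Perp n × ℝ => slice n p.2 p.1) := by
  have e1 : MeasurePreserving (LinearIsometryEquiv.toSpanUnitSingleton n hn : ℝ → (ℝ ∙ n)) :=
    (LinearIsometryEquiv.toSpanUnitSingleton n hn).measurePreserving
  have e2 : MeasurePreserving (Prod.map (LinearIsometryEquiv.toSpanUnitSingleton n hn : ℝ → (ℝ ∙ n))
      (id : Perp n → Perp n)) := e1.prod (MeasurePreserving.id _)
  have e3 := (ℝ ∙ n).orthogonalDecomposition.symm.measurePreserving.comp
    ((WithLp.volume_preserving_toLp (ℝ ∙ n) (Perp n)).comp (e2.comp Measure.measurePreserving_swap))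
  change MeasurePreserving _ (volume.prod volume) volume
  refine (congrArg (MeasurePreserving · (volume.prod volume) volume) (funext fun p => ?_)).mpr e3
  simp only [slice, Function.comp, Prod.map, Prod.swap, id]
  apply (ℝ ∙ n).orthogonalDecomposition.injective
  rw [LinearIsometryEquiv.apply_symm_apply, Submodule.orthogonalDecomposition_apply]
  congr 1
  have hp : ((LinearIsometryEquiv.toSpanUnitSingleton n hn) p.2 : Euc d) = p.2 • n := by simp
  rw [← hp, add_comm, map_add, map_add, Submodule.orthogonalProjectionOnto_mem_subspace_eq_self,
    Submodule.orthogonalProjectionOnto_mem_subspace_eq_self,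
    Submodule.orthogonalProjectionOnto_eq_zero_iff.2 p.1.2,
    Submodule.orthogonalProjectionOnto_orthogonal_apply_eq_zero (Subtype.coe_prop _)]
  simp

theorem volume_hyperplane_zero {n : Euc d} (hn : n ≠ 0) (c : ℝ) :
    volume {x : Euc d | inner ℝ n x = c} = 0 := by
  have h := Measure.addHaar_affineSubspace (volume : Measure (Euc d))
    (AffineSubspace.mk' ((c / ‖n‖ ^ 2) • n) (ℝ ∙ n)ᗮ) (by
      intro h
      have h2 : (ℝ ∙ n)ᗮ = ⊤ := by
        rw [← AffineSubspace.direction_mk' ((c / ‖n‖ ^ 2) • n) (ℝ ∙ n)ᗮ, h,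
          AffineSubspace.direction_top]
      have h3 : n ∈ (ℝ ∙ n)ᗮ := by rw [h2]; trivial
      rw [Submodule.mem_orthogonal_singleton_iff_inner_right] at h3
      exact hn (inner_self_eq_zero.1 h3))
  refine measure_mono_null (fun x hx => ?_) h
  simp only [mem_ofPred_eq] at hx
  have hn' : ‖n‖ ^ 2 ≠ 0 := by positivity
  simp only [SetLike.mem_coe, AffineSubspace.mem_mk', vsub_eq_sub]
  rw [Submodule.mem_orthogonal_singleton_iff_inner_right, inner_sub_right, inner_smul_right, hx,
    real_inner_self_eq_norm_sq]
  field_simp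
  simp

/-- A hyperplane which does not contain a given hyperplane meets it in a null set. -/
theorem volume_slice_hyperplane_zero {n m : Euc d} {c b : ℝ}
    {z : Perp n} (hz : inner ℝ m (slice n c z) ≠ b) :
    volume {y : Perp n | inner ℝ m (slice n c y) = b} = 0 := by
  classical
  let g : Perp n →ᵃ[ℝ] ℝ :=
    ((innerSL ℝ m).toLinearMap.comp (Perp n).subtype).toAffineMap +
      AffineMap.const ℝ (Perp n) (inner ℝ m (c • n))
  have hg : ∀ y, g y = inner ℝ m (slice n c y) := by
    intro y; simp [g, slice, inner_add_right]
  have h := Measure.addHaar_affineSubspace (volume : Measure (Perp n))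
    ((AffineSubspace.mk' b (⊥ : Submodule ℝ ℝ)).comap g) (by
      intro h
      have : z ∈ (AffineSubspace.mk' b (⊥ : Submodule ℝ ℝ)).comap g := by rw [h]; trivial
      rw [AffineSubspace.mem_comap, AffineSubspace.mem_mk', Submodule.mem_bot, vsub_eq_sub,
        sub_eq_zero, hg] at this
      exact hz this)
  refine measure_mono_null (fun y hy => ?_) h
  simp only [SetLike.mem_coe, AffineSubspace.mem_comap, AffineSubspace.mem_mk', Submodule.mem_bot,
    vsub_eq_sub, sub_eq_zero, hg]
  exact hy

theorem surface_inter_hyperplane_zero {n m : Euc d} (hn : ‖n‖ = 1) {c b : ℝ}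
    {z : Euc d} (hz : inner ℝ n z = c) (hz' : inner ℝ m z ≠ b) :
    (μHE[d - 1] : Measure (Euc d)) ({x | inner ℝ n x = c} ∩ {x | inner ℝ m x = b}) = 0 := by
  rw [surface_measure_eq hn c inter_subset_left]
  · have hz1 : z ∈ range (slice n c) := by rw [range_slice hn]; exact hz
    obtain ⟨y, rfl⟩ := hz1
    exact measure_mono_null (fun y hy => hy.2) (volume_slice_hyperplane_zero hz')
  · exact (measurableSet_eq_fun (by fun_prop) (by fun_prop)).inter
      (measurableSet_eq_fun (by fun_prop) (by fun_prop))

theorem surface_finite {n : Euc d} (hn : ‖n‖ = 1) {c : ℝ} {A : Set (Euc d)}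
    (hA : A ⊆ {x | inner ℝ n x = c}) (hc : IsCompact A) :
    (μHE[d - 1] : Measure (Euc d)) A < ⊤ := by
  rw [surface_measure_eq hn c hA hc.measurableSet]
  exact ((isometry_slice n c).isClosedEmbedding.isCompact_preimage hc).measure_lt_top

end Slicing

/-! ### Smooth cutoffs -/

section Cutoff

theorem continuous_deriv_smoothTransition : Continuous (deriv Real.smoothTransition) :=
  (Real.smoothTransition.contDiff (n := 1)).continuous_deriv le_rfl

theorem deriv_smoothTransition_of_neg {s : ℝ} (hs : s < 0) : deriv Real.smoothTransition s = 0 := by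
  have : Real.smoothTransition =ᶠ[𝓝 s] fun _ => 0 := by
    filter_upwards [gt_mem_nhds hs] with x hx
    exact Real.smoothTransition.zero_of_nonpos hx.le
  rw [this.deriv_eq, deriv_const]

theorem deriv_smoothTransition_of_one_lt {s : ℝ} (hs : 1 < s) :
    deriv Real.smoothTransition s = 0 := by
  have : Real.smoothTransition =ᶠ[𝓝 s] fun _ => 1 := by
    filter_upwards [lt_mem_nhds hs] with x hx
    exact Real.smoothTransition.one_of_one_le hx.le
  rw [this.deriv_eq, deriv_const]

theorem deriv_smoothTransition_eq_zero {s : ℝ} (hs : s ∉ Icc (0 : ℝ) 1) :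
    deriv Real.smoothTransition s = 0 := by
  rw [mem_Icc, not_and_or, not_le, not_le] at hs
  exact hs.elim deriv_smoothTransition_of_neg deriv_smoothTransition_of_one_lt

theorem integrable_deriv_smoothTransition : Integrable (deriv Real.smoothTransition) :=
  continuous_deriv_smoothTransition.integrable_of_hasCompactSupport
    (HasCompactSupport.intro isCompact_Icc fun _ h => deriv_smoothTransition_eq_zero h)

/-- Unit mass: rescaled to width `ε` in the normal direction, the derivative of the transition is an
approximate surface measure. -/
theorem integral_deriv_smoothTransition : ∫ s, deriv Real.smoothTransition s = 1 := by
  rw [← setIntegral_eq_integral_of_forall_compl_eq_zero (s := Icc (0 : ℝ) 1)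
    (fun x hx => deriv_smoothTransition_eq_zero hx), integral_Icc_eq_integral_Ioc,
    ← intervalIntegral.integral_of_le zero_le_one,
    intervalIntegral.integral_deriv_eq_sub
      (fun x _ => ((Real.smoothTransition.contDiff (n := 1)).differentiable (by simp)).differentiableAt)
      (continuous_deriv_smoothTransition.intervalIntegrable _ _)]
  simp

/-- The quotient runs to plus or minus infinity according to the sign of `L`, so the transition is
eventually constant. This makes the cutoffs converge to an indicator away from the face hyperplanes,
where `L` would be zero. -/
theorem tendsto_smoothTransition_div {g : ℝ → ℝ} {L : ℝ} (hg : Tendsto g (𝓝[>] 0) (𝓝 L))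
    (hL : L ≠ 0) :
    Tendsto (fun ε => Real.smoothTransition (g ε / ε)) (𝓝[>] 0) (𝓝 (if 0 < L then 1 else 0)) := by
  have hpos : ∀ᶠ ε : ℝ in 𝓝[>] 0, 0 < ε := self_mem_nhdsWithin
  split_ifs with h
  · have h1 : ∀ᶠ ε in 𝓝[>] (0 : ℝ), L / 2 < g ε := hg.eventually (lt_mem_nhds (by linarith))
    have h2 : ∀ᶠ ε : ℝ in 𝓝[>] 0, ε < L / 2 :=
      mem_nhdsWithin_of_mem_nhds (gt_mem_nhds (by linarith))
    refine tendsto_const_nhds.congr' ?_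
    filter_upwards [h1, h2, hpos] with ε a b c
    exact (Real.smoothTransition.one_of_one_le ((one_le_div c).2 (by linarith))).symm
  · have h1 : ∀ᶠ ε in 𝓝[>] (0 : ℝ), g ε < 0 :=
      hg.eventually (gt_mem_nhds (lt_of_le_of_ne (not_lt.1 h) hL))
    refine tendsto_const_nhds.congr' ?_
    filter_upwards [h1, hpos] with ε a c
    exact (Real.smoothTransition.zero_of_nonpos (div_nonpos_of_nonpos_of_nonneg a.le c.le)).symm

end Cutoff

/-! ### The divergence theorem on an element -/

section Slicing

variable {d : ℕ}

/-- The new normal coordinate is the distance to the hyperplane at offset `b`, measured in units of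
`ε`; the Jacobian accounts for the factor `ε⁻¹`. A layer of width `ε` is stretched to width one. -/
theorem integral_slice_affine {n : Euc d} (hn : ‖n‖ = 1) (b : ℝ) {ε : ℝ} (hε : 0 < ε)
    {G : Euc d → ℝ} (hG : Continuous G) :
    ∫ x, G x * ε⁻¹ = ∫ p : Perp n × ℝ, G (slice n (b - ε * p.2) p.1) := by
  have h1 : (volume : Measure ℝ).map (fun s => b - ε * s) = ENNReal.ofReal ε⁻¹ • volume := by
    have : (fun s : ℝ => b - ε * s) = (fun s => b - s) ∘ (fun s => ε * s) := rfl
    rw [this, ← Measure.map_map (by fun_prop) (by fun_prop), Real.map_volume_mul_left hε.ne',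
      Measure.map_smul, (Measure.measurePreserving_sub_left volume b).map_eq, abs_of_pos (inv_pos.2 hε)]
  have h2 : (volume : Measure (Perp n × ℝ)).map (fun p => (p.1, b - ε * p.2))
      = ENNReal.ofReal ε⁻¹ • volume := by
    have := Measure.map_prod_map (volume : Measure (Perp n)) (volume : Measure ℝ)
      (f := id) (g := fun s => b - ε * s) measurable_id (by fun_prop)
    rw [h1, Measure.map_id, Measure.prod_smul_right] at this
    exact this.symm
  have h3 : (volume : Measure (Perp n × ℝ)).map (fun p => slice n (b - ε * p.2) p.1)
      = ENNReal.ofReal ε⁻¹ • volume := by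
    have : (fun p : Perp n × ℝ => slice n (b - ε * p.2) p.1) =
      (fun p : Perp n × ℝ => slice n p.2 p.1) ∘ (fun p => (p.1, b - ε * p.2)) := rfl
    rw [this, ← Measure.map_map (continuous_slice n).measurable (by fun_prop), h2,
      Measure.map_smul, (measurePreserving_slice hn).map_eq]
  have hm : Continuous fun p : Perp n × ℝ => slice n (b - ε * p.2) p.1 :=
    (continuous_slice n).comp (by fun_prop : Continuous fun p : Perp n × ℝ => (p.1, b - ε * p.2))
  rw [← integral_map (φ := fun p : Perp n × ℝ => slice n (b - ε * p.2) p.1)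
    hm.measurable.aemeasurable hG.aestronglyMeasurable, h3, integral_smul_measure,
    integral_mul_const, ENNReal.toReal_ofReal (inv_pos.2 hε).le, smul_eq_mul, mul_comm]

end Slicing

namespace Element

variable {d : ℕ} (K : Element d)

theorem isClosed_carrier : IsClosed K.carrier := by
  simp only [carrier, ofPred_forall]
  exact isClosed_iInter fun i => isClosed_le (by fun_prop) (by fun_prop)

theorem isCompact_carrier : IsCompact K.carrier :=
  Metric.isCompact_of_isClosed_isBounded K.isClosed_carrier K.isBounded

theorem isCompact_face (i : K.Face) : IsCompact (K.face i) :=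
  K.isCompact_carrier.inter_right (isClosed_eq (by fun_prop) (by fun_prop))

theorem face_subset_hyperplane (i : K.Face) : K.face i ⊆ {x | inner ℝ (K.normal i) x = K.offset i} :=
  fun _ h => h.2

/-- The nonnegative affine function that vanishes on the face `i`. -/
noncomputable def gap (i : K.Face) (x : Euc d) : ℝ := K.offset i - inner ℝ (K.normal i) x

theorem mem_carrier_iff {x : Euc d} : x ∈ K.carrier ↔ ∀ i, 0 ≤ K.gap i x := by
  simp [carrier, gap]

theorem contDiff_gap (i : K.Face) : ContDiff ℝ ∞ (K.gap i) := by
  exact contDiff_const.sub (contDiff_const.inner ℝ contDiff_id)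

theorem continuous_gap (i : K.Face) : Continuous (K.gap i) := (K.contDiff_gap i).continuous

theorem gap_slice_self (i : K.Face) (c : ℝ) (y : Perp (K.normal i)) :
    K.gap i (slice (K.normal i) c y) = K.offset i - c := by
  rw [gap, inner_slice (K.norm_normal i)]

/-- Product of the cutoffs for the faces in `s`. -/
noncomputable def cut (s : Finset K.Face) (ε : ℝ) (x : Euc d) : ℝ :=
  ∏ i ∈ s, Real.smoothTransition (K.gap i x / ε)

theorem contDiff_cut (s : Finset K.Face) (ε : ℝ) : ContDiff ℝ ∞ (K.cut s ε) := by
  unfold cut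
  refine contDiff_prod fun i _ => Real.smoothTransition.contDiff.comp ?_
  exact (K.contDiff_gap i).div_const ε

theorem abs_cut_le_one (s : Finset K.Face) (ε : ℝ) (x : Euc d) : |K.cut s ε x| ≤ 1 := by
  rw [cut, Finset.abs_prod]
  refine Finset.prod_le_one (fun _ _ => abs_nonneg _) fun i _ => ?_
  rw [abs_of_nonneg (Real.smoothTransition.nonneg _)]
  exact Real.smoothTransition.le_one _

theorem gap_pos_of_cut_ne_zero {s : Finset K.Face} {ε : ℝ} (hε : 0 < ε) {x : Euc d}
    (h : K.cut s ε x ≠ 0) {i : K.Face} (hi : i ∈ s) : 0 < K.gap i x := by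
  rw [cut, Finset.prod_ne_zero_iff] at h
  by_contra hneg
  exact h i hi (Real.smoothTransition.zero_of_nonpos
    (div_nonpos_of_nonpos_of_nonneg (not_lt.1 hneg) hε.le))

theorem fderiv_cut [DecidableEq K.Face] (s : Finset K.Face) (ε : ℝ) (x v : Euc d) :
    fderiv ℝ (K.cut s ε) x v = -∑ i ∈ s, inner ℝ (K.normal i) v *
      (K.cut (s.erase i) ε x * (deriv Real.smoothTransition (K.gap i x / ε) * ε⁻¹)) := by
  have hg : ∀ i, HasFDerivAt (fun x => Real.smoothTransition (K.gap i x / ε))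
      ((deriv Real.smoothTransition (K.gap i x / ε)) • (-(ε⁻¹ • innerSL ℝ (K.normal i)))) x := by
    intro i
    have h1 : HasFDerivAt (fun x => K.gap i x / ε) (-(ε⁻¹ • innerSL ℝ (K.normal i))) x := by
      have h2 : HasFDerivAt (K.gap i) (-(innerSL ℝ (K.normal i))) x :=
        (innerSL ℝ (K.normal i)).hasFDerivAt.const_sub (K.offset i)
      simpa [div_eq_mul_inv] using h2.mul_const ε⁻¹
    exact ((Real.smoothTransition.contDiff (n := 1)).differentiable
      (by simp)).differentiableAt.hasDerivAt.comp_hasFDerivAt x h1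
  have h := HasFDerivAt.finsetProd (u := s) fun i _ => hg i
  have h' : HasFDerivAt (K.cut s ε) _ x := h
  rw [h'.fderiv, ← Finset.sum_neg_distrib]
  simp only [sum_apply, smul_apply, neg_apply, innerSL_apply_apply, smul_eq_mul]
  refine Finset.sum_congr rfl fun i _ => ?_
  simp only [cut]
  ring

theorem tendsto_cut {s : Finset K.Face} {X : ℝ → Euc d} {x : Euc d}
    (hX : Tendsto X (𝓝[>] 0) (𝓝 x)) (hx : ∀ i ∈ s, K.gap i x ≠ 0) :
    Tendsto (fun ε => K.cut s ε (X ε)) (𝓝[>] 0)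
      (𝓝 (∏ i ∈ s, if 0 < K.gap i x then 1 else 0)) :=
  tendsto_finsetProd _ fun i hi =>
    tendsto_smoothTransition_div (((K.continuous_gap i).tendsto x).comp hX) (hx i hi)

theorem exists_bound {f : Euc d → ℝ} (hf : Continuous f) :
    ∃ C, 0 ≤ C ∧ ∀ x ∈ K.carrier, |f x| ≤ C := by
  obtain ⟨C, hC⟩ := K.isCompact_carrier.exists_bound_of_continuousOn hf.continuousOn
  exact ⟨max C 0, le_max_right _ _, fun x hx => (hC x hx).trans (le_max_left _ _)⟩

theorem ae_gap_ne_zero : ∀ᵐ x : Euc d, ∀ i, K.gap i x ≠ 0 := by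
  rw [ae_all_iff]
  intro i
  have hn : K.normal i ≠ 0 := by
    intro h; have := K.norm_normal i; rw [h] at this; simp at this
  have := volume_hyperplane_zero hn (K.offset i)
  rw [ae_iff]
  refine measure_mono_null (fun x hx => ?_) this
  simp only [gap, not_not, mem_ofPred_eq] at hx ⊢
  linarith

/-- Dominated convergence: the full cutoff is bounded by one, vanishes off the element, and
converges to the indicator of the element outside finitely many hyperplanes. -/
theorem tendsto_integral_cut {f : Euc d → ℝ} (hf : Continuous f) :
    Tendsto (fun ε => ∫ x, f x * K.cut Finset.univ ε x) (𝓝[>] 0)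
      (𝓝 (∫ x in K.carrier, f x)) := by
  obtain ⟨C, hC0, hC⟩ := K.exists_bound hf
  rw [← integral_indicator K.isClosed_carrier.measurableSet]
  have hpos : ∀ᶠ ε : ℝ in 𝓝[>] 0, 0 < ε := self_mem_nhdsWithin
  refine tendsto_integral_filter_of_dominated_convergence
    (K.carrier.indicator fun _ => C) ?_ ?_ ?_ ?_
  · exact Eventually.of_forall fun ε =>
      (hf.mul (K.contDiff_cut _ ε).continuous).aestronglyMeasurable
  · filter_upwards [hpos] with ε hε
    refine Eventually.of_forall fun x => ?_
    by_cases hx : x ∈ K.carrier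
    · rw [indicator_of_mem hx, Real.norm_eq_abs, abs_mul]
      calc |f x| * |K.cut Finset.univ ε x| ≤ C * 1 := by
            gcongr
            · exact hC x hx
            · exact K.abs_cut_le_one _ _ _
        _ = C := mul_one C
    · rw [indicator_of_notMem hx]
      have : K.cut Finset.univ ε x = 0 := by
        by_contra h
        exact hx (K.mem_carrier_iff.2 fun i =>
          (K.gap_pos_of_cut_ne_zero hε h (Finset.mem_univ i)).le)
      simp [this]
  · exact (integrable_indicator_iff K.isClosed_carrier.measurableSet).2
      (integrableOn_const K.isCompact_carrier.measure_lt_top.ne)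
  · filter_upwards [K.ae_gap_ne_zero] with x hx
    have h1 := (K.tendsto_cut (s := Finset.univ) (X := fun _ => x) tendsto_const_nhds
      fun i _ => hx i).const_mul (f x)
    convert h1 using 2
    by_cases hxK : x ∈ K.carrier
    · rw [indicator_of_mem hxK, Finset.prod_eq_one, mul_one]
      intro i _
      rw [if_pos (lt_of_le_of_ne (K.mem_carrier_iff.1 hxK i) (hx i).symm)]
    · rw [indicator_of_notMem hxK]
      rw [mem_carrier_iff, not_forall] at hxK
      obtain ⟨i, hi⟩ := hxK
      rw [Finset.prod_eq_zero (Finset.mem_univ i), mul_zero]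
      rw [if_neg fun h => hi h.le]

theorem ae_gap_slice_ne_zero (i : K.Face) :
    ∀ᵐ y : Perp (K.normal i), ∀ j, j ≠ i → K.gap j (slice (K.normal i) (K.offset i) y) ≠ 0 := by
  rw [ae_all_iff]
  intro j
  by_cases hj : j = i
  · simp [hj]
  obtain ⟨z, hz, hz'⟩ := K.irredundant i
  have hz1 : z ∈ range (slice (K.normal i) (K.offset i)) := by
    rw [range_slice (K.norm_normal i)]; exact hz
  obtain ⟨y, rfl⟩ := hz1
  have := volume_slice_hyperplane_zero (hz' j hj).ne
  rw [ae_iff]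
  refine measure_mono_null (fun x hx => ?_) this
  simp only [gap, not_not, mem_ofPred_eq, Classical.not_imp] at hx ⊢
  linarith [hx.2]

/-- The second factor is a layer of unit mass along the hyperplane of the face, and the remaining
cutoffs confine it to the face in the limit. After stretching the layer, the integrand converges to
the product of `f` on the face and the derivative of the transition, whose integral is one. -/
theorem tendsto_integral_face [DecidableEq K.Face] (i : K.Face) {f : Euc d → ℝ}
    (hf : Continuous f) :
    Tendsto (fun ε => ∫ x, f x * (K.cut (Finset.univ.erase i) ε x *
        (deriv Real.smoothTransition (K.gap i x / ε) * ε⁻¹))) (𝓝[>] 0)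
      (𝓝 (∫ x in K.face i, f x ∂(μHE[d - 1] : Measure (Euc d)))) := by
  obtain ⟨C, hC0, hC⟩ := K.exists_bound hf
  set n := K.normal i with hn
  set b := K.offset i with hb
  have hn1 : ‖n‖ = 1 := K.norm_normal i
  have hpos : ∀ᶠ ε : ℝ in 𝓝[>] 0, 0 < ε := self_mem_nhdsWithin
  have hsmall : ∀ᶠ ε : ℝ in 𝓝[>] 0, ε < 1 :=
    mem_nhdsWithin_of_mem_nhds (gt_mem_nhds one_pos)
  set Φ : ℝ → Perp n × ℝ → ℝ := fun ε p =>
    f (slice n (b - ε * p.2) p.1) * (K.cut (Finset.univ.erase i) ε (slice n (b - ε * p.2) p.1) *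
      deriv Real.smoothTransition p.2) with hΦ
  have hsl : ∀ ε : ℝ, Continuous fun p : Perp n × ℝ => slice n (b - ε * p.2) p.1 := fun ε =>
    (continuous_slice n).comp (by fun_prop : Continuous fun p : Perp n × ℝ => (p.1, b - ε * p.2))
  have hgs : ∀ (ε : ℝ) (p : Perp n × ℝ), K.gap i (slice n (b - ε * p.2) p.1) = ε * p.2 :=
    fun ε p => (K.gap_slice_self i _ p.1).trans (sub_sub_cancel _ _)
  have e1 : ∀ᶠ ε : ℝ in 𝓝[>] 0, ∫ p, Φ ε p = ∫ x, f x * (K.cut (Finset.univ.erase i) ε x *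
        (deriv Real.smoothTransition (K.gap i x / ε) * ε⁻¹)) := by
    filter_upwards [hpos] with ε hε
    have := integral_slice_affine hn1 b hε (G := fun x => f x * (K.cut (Finset.univ.erase i) ε x *
        deriv Real.smoothTransition (K.gap i x / ε)))
      (hf.mul ((K.contDiff_cut _ ε).continuous.mul
        (continuous_deriv_smoothTransition.comp ((K.continuous_gap i).div_const ε))))
    simp only [mul_assoc] at this
    rw [this]
    refine integral_congr_ae (Eventually.of_forall fun p => ?_)
    simp only [hΦ, hgs, mul_div_cancel_left₀ _ hε.ne']
  refine Tendsto.congr' e1 ?_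
  rw [setIntegral_hyperplane hn1 b (K.face_subset_hyperplane i)
    (K.isCompact_face i).measurableSet, ← integral_indicator
    ((measurableEmbedding_slice n b).measurable (K.isCompact_face i).measurableSet)]
  -- The stretched variable is inserted into the limit as a factor of integral one, so that both
  -- sides live on the same product space.
  have e2 : ∫ p : Perp n × ℝ, (slice n b ⁻¹' K.face i).indicator (fun y => f (slice n b y)) p.1 *
      deriv Real.smoothTransition p.2 =
      ∫ y, (slice n b ⁻¹' K.face i).indicator (fun y => f (slice n b y)) y := by
    rw [Measure.volume_eq_prod, integral_prod_mul, integral_deriv_smoothTransition, mul_one]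
  rw [← e2]
  obtain ⟨R, hR⟩ := K.isBounded.subset_closedBall 0
  -- Where the integrand is nonzero the point lies in the element, hence in the ball of radius `R`.
  -- Removing the normal component, of length at most `|b| + 1` when `ε < 1`, bounds the component
  -- in `n^⊥`.
  refine tendsto_integral_filter_of_dominated_convergence
    (fun p => (Metric.closedBall (0 : Perp n) (R + (|b| + 1))).indicator (fun _ => C) p.1 *
      |deriv Real.smoothTransition p.2|) ?_ ?_ ?_ ?_
  · exact Eventually.of_forall fun ε => ((hf.comp (hsl ε)).mul
      (((K.contDiff_cut _ ε).continuous.comp (hsl ε)).mul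
        (continuous_deriv_smoothTransition.comp continuous_snd))).aestronglyMeasurable
  · filter_upwards [hpos, hsmall] with ε hε hε1
    refine Eventually.of_forall fun p => ?_
    by_cases h0 : Φ ε p = 0
    · rw [h0, norm_zero]
      exact mul_nonneg (indicator_nonneg (fun _ _ => hC0) _) (abs_nonneg _)
    have hd : deriv Real.smoothTransition p.2 ≠ 0 := fun h => h0 (by simp [hΦ, h])
    have hc : K.cut (Finset.univ.erase i) ε (slice n (b - ε * p.2) p.1) ≠ 0 :=
      fun h => h0 (by simp [hΦ, h])
    have hp2 : p.2 ∈ Icc (0 : ℝ) 1 := by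
      by_contra h; exact hd (deriv_smoothTransition_eq_zero h)
    have hK : slice n (b - ε * p.2) p.1 ∈ K.carrier := by
      rw [mem_carrier_iff]
      intro j
      by_cases hj : j = i
      · rw [hj, hgs]
        exact mul_nonneg hε.le hp2.1
      · exact (K.gap_pos_of_cut_ne_zero hε hc (by simp [hj])).le
    have hball : p.1 ∈ Metric.closedBall (0 : Perp n) (R + (|b| + 1)) := by
      rw [mem_closedBall_zero_iff]
      have h1 : ‖slice n (b - ε * p.2) p.1‖ ≤ R := by simpa using hR hK
      have h2 : (p.1 : Euc d) = slice n (b - ε * p.2) p.1 - (b - ε * p.2) • n := by simp [slice]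
      have h3 : |b - ε * p.2| ≤ |b| + 1 := by
        refine (abs_sub _ _).trans (add_le_add le_rfl ?_)
        rw [abs_of_nonneg (mul_nonneg hε.le hp2.1)]
        nlinarith [hp2.1, hp2.2]
      calc ‖p.1‖ = ‖(p.1 : Euc d)‖ := rfl
        _ ≤ ‖slice n (b - ε * p.2) p.1‖ + ‖(b - ε * p.2) • n‖ := by rw [h2]; exact norm_sub_le _ _
        _ ≤ R + (|b| + 1) := by
            rw [norm_smul, hn1, mul_one, Real.norm_eq_abs]; exact add_le_add h1 h3
    rw [indicator_of_mem hball, Real.norm_eq_abs, hΦ]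
    simp only [abs_mul]
    calc _ ≤ C * (1 * |deriv Real.smoothTransition p.2|) := by
          gcongr
          · exact hC _ hK
          · exact K.abs_cut_le_one _ _ _
      _ = _ := by ring
  · rw [Measure.volume_eq_prod]
    refine Integrable.mul_prod ?_ integrable_deriv_smoothTransition.abs
    exact (integrable_indicator_iff measurableSet_closedBall).2
      (integrableOn_const (isCompact_closedBall _ _).measure_lt_top.ne)
  · have hae : ∀ᵐ p : Perp n × ℝ, ∀ j, j ≠ i → K.gap j (slice n b p.1) ≠ 0 :=
      Measure.quasiMeasurePreserving_fst.ae (K.ae_gap_slice_ne_zero i)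
    filter_upwards [hae] with p hp
    have hX : Tendsto (fun ε : ℝ => slice n (b - ε * p.2) p.1) (𝓝[>] 0) (𝓝 (slice n b p.1)) := by
      have : Continuous fun ε : ℝ => slice n (b - ε * p.2) p.1 := by unfold slice; fun_prop
      have h := this.tendsto 0
      simp only [zero_mul, sub_zero] at h
      exact h.mono_left nhdsWithin_le_nhds
    have h1 := ((hf.tendsto _).comp hX).mul ((K.tendsto_cut (s := Finset.univ.erase i) hX
      fun j hj => hp j (Finset.ne_of_mem_erase hj)).mul_const (deriv Real.smoothTransition p.2))
    refine (congrArg (fun L => Tendsto (fun ε => Φ ε p) (𝓝[>] 0) (𝓝 L)) ?_).mpr h1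
    rw [← mul_assoc]
    congr 1
    -- Outside the face some gap is negative. It is not that of `i`, which vanishes on the whole
    -- hyperplane, so one of the remaining cutoffs tends to zero.
    by_cases hxF : slice n b p.1 ∈ K.face i
    · rw [indicator_of_mem (by exact hxF), Finset.prod_eq_one, mul_one]
      intro j hj
      rw [if_pos (lt_of_le_of_ne (K.mem_carrier_iff.1 hxF.1 j)
        (hp j (Finset.ne_of_mem_erase hj)).symm)]
    · rw [indicator_of_notMem (by exact hxF)]
      have hnot : slice n b p.1 ∉ K.carrier := fun h => hxF ⟨h, inner_slice hn1 b p.1⟩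
      rw [mem_carrier_iff, not_forall] at hnot
      obtain ⟨j, hj⟩ := hnot
      have hji : j ≠ i := by
        intro hji
        have := hgs 0 p
        rw [zero_mul, sub_zero, ← hji] at this
        exact hj this.ge
      rw [Finset.prod_eq_zero (Finset.mem_erase.2 ⟨hji, Finset.mem_univ j⟩), mul_zero]
      rw [if_neg fun h => hj h.le]

/-- Integration by parts on the whole space, without boundary terms since the cutoff has compact
support. The minus sign cancels against the one in `fderiv_cut`, which arises because each gap
decreases along its outward normal. -/
theorem integral_fderiv_mul_cut [DecidableEq K.Face] {f : Euc d → ℝ} (hf : ContDiff ℝ 1 f)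
    (v : Euc d) {ε : ℝ} (hε : 0 < ε) :
    ∫ x, fderiv ℝ f x v * K.cut Finset.univ ε x =
      ∑ i, inner ℝ (K.normal i) v * ∫ x, f x * (K.cut (Finset.univ.erase i) ε x *
        (deriv Real.smoothTransition (K.gap i x / ε) * ε⁻¹)) := by
  have hsupp : HasCompactSupport (K.cut Finset.univ ε) :=
    HasCompactSupport.intro K.isCompact_carrier fun x hx => by
      by_contra h
      exact hx (K.mem_carrier_iff.2 fun i =>
        (K.gap_pos_of_cut_ne_zero hε h (Finset.mem_univ i)).le)
  have hc := K.contDiff_cut Finset.univ ε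
  have hcd : Continuous fun x => fderiv ℝ (K.cut Finset.univ ε) x v :=
    (hc.continuous_fderiv (by simp)).clm_apply continuous_const
  have hfd : Continuous fun x => fderiv ℝ f x v :=
    (hf.continuous_fderiv (by simp)).clm_apply continuous_const
  have hsupp' : HasCompactSupport fun x => fderiv ℝ (K.cut Finset.univ ε) x v :=
    (hsupp.fderiv (𝕜 := ℝ)).comp_left (g := fun L : Euc d →L[ℝ] ℝ => L v) (by simp)
  have h := integral_mul_fderiv_eq_neg_fderiv_mul_of_integrable (μ := volume) (v := v)
    (f := f) (g := K.cut Finset.univ ε)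
    ((hfd.mul hc.continuous).integrable_of_hasCompactSupport hsupp.mul_left)
    ((hf.continuous.mul hcd).integrable_of_hasCompactSupport hsupp'.mul_left)
    ((hf.continuous.mul hc.continuous).integrable_of_hasCompactSupport hsupp.mul_left)
    (fun x _ => (hf.differentiable (by simp)).differentiableAt)
    (fun x _ => (hc.differentiable (by simp)).differentiableAt)
  rw [← neg_eq_iff_eq_neg] at h
  rw [← h, ← integral_neg]
  simp_rw [← integral_const_mul]
  rw [← integral_finsetSum]
  · refine integral_congr_ae (Eventually.of_forall fun x => ?_)
    simp only [fderiv_cut, mul_neg, neg_neg, Finset.mul_sum]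
    exact Finset.sum_congr rfl fun i _ => by ring
  · intro i _
    refine Integrable.const_mul ?_ _
    refine (hf.continuous.mul ((K.contDiff_cut _ ε).continuous.mul
        ((continuous_deriv_smoothTransition.comp
          ((K.continuous_gap i).div_const ε)).mul_const ε⁻¹))).integrable_of_hasCompactSupport ?_
    refine HasCompactSupport.intro K.isCompact_carrier fun x hx => ?_
    by_contra h
    have hd : deriv Real.smoothTransition (K.gap i x / ε) ≠ 0 := fun h' => h (by simp [h'])
    have hcut : K.cut (Finset.univ.erase i) ε x ≠ 0 := fun h' => h (by simp [h'])
    refine hx (K.mem_carrier_iff.2 fun j => ?_)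
    by_cases hj : j = i
    · subst hj
      by_contra hneg
      exact hd (deriv_smoothTransition_of_neg (div_neg_of_neg_of_pos (not_le.1 hneg) hε))
    · exact (K.gap_pos_of_cut_ne_zero hε hcut (by simp [hj])).le

/-- Integration of a directional derivative over an element. -/
theorem integral_fderiv_apply {f : Euc d → ℝ} (hf : ContDiff ℝ 1 f) (v : Euc d) :
    ∫ x in K.carrier, fderiv ℝ f x v =
      ∑ i, inner ℝ (K.normal i) v * ∫ x in K.face i, f x ∂(μHE[d - 1] : Measure (Euc d)) := by
  classical
  have h1 := K.tendsto_integral_cut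
    ((hf.continuous_fderiv (by simp)).clm_apply (continuous_const (y := v)))
  have h2 := tendsto_finsetSum (Finset.univ : Finset K.Face) fun i _ =>
    (K.tendsto_integral_face i hf.continuous).const_mul (inner ℝ (K.normal i) v)
  refine tendsto_nhds_unique (h1.congr' ?_) h2
  have hpos : ∀ᶠ ε : ℝ in 𝓝[>] 0, 0 < ε := self_mem_nhdsWithin
  filter_upwards [hpos] with ε hε
  exact K.integral_fderiv_mul_cut hf v hε

theorem integrableOn_face (i : K.Face) {f : Euc d → ℝ} (hf : Continuous f) :
    IntegrableOn f (K.face i) (μHE[d - 1] : Measure (Euc d)) := by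
  have : Fact ((μHE[d - 1] : Measure (Euc d)) (K.face i) < ⊤) :=
    ⟨surface_finite (K.norm_normal i) (K.face_subset_hyperplane i) (K.isCompact_face i)⟩
  obtain ⟨C, hC0, hC⟩ := K.exists_bound hf
  refine Integrable.of_bound hf.aestronglyMeasurable C ?_
  filter_upwards [ae_restrict_mem (K.isCompact_face i).measurableSet] with x hx
  exact hC x hx.1

theorem integrableOn_carrier {f : Euc d → ℝ} (hf : Continuous f) : IntegrableOn f K.carrier :=
  hf.continuousOn.integrableOn_compact K.isCompact_carrier

end Element

theorem divg_eq_sum {d : ℕ} {w : Euc d → Euc d} {x : Euc d} (hw : DifferentiableAt ℝ w x) :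
    divg w x = ∑ j, fderiv ℝ (fun y => w y j) x (EuclideanSpace.single j 1) := by
  simp only [divg, gradMat, Matrix.trace, Matrix.diag, Matrix.of_apply]
  refine Finset.sum_congr rfl fun j _ => ?_
  have : HasFDerivAt (fun y => w y j) ((EuclideanSpace.proj j : Euc d →L[ℝ] ℝ).comp
      (fderiv ℝ w x)) x := (EuclideanSpace.proj j : Euc d →L[ℝ] ℝ).hasFDerivAt.comp x hw.hasFDerivAt
  rw [this.fderiv]
  rfl

/-- The divergence theorem on an element. -/
theorem Element.integral_divg {d : ℕ} (K : Element d) {w : Euc d → Euc d} (hw : ContDiff ℝ 1 w) :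
    ∫ x in K.carrier, divg w x =
      ∑ i, ∫ x in K.face i, inner ℝ (w x) (K.normal i) ∂(μHE[d - 1] : Measure (Euc d)) := by
  have hwj : ∀ j, ContDiff ℝ 1 fun y => w y j := fun j =>
    (EuclideanSpace.proj j : Euc d →L[ℝ] ℝ).contDiff.comp hw
  simp_rw [divg_eq_sum ((hw.differentiable (by simp)).differentiableAt)]
  rw [integral_finsetSum]
  · simp_rw [fun j => K.integral_fderiv_apply (hwj j) (EuclideanSpace.single j 1)]
    rw [Finset.sum_comm]
    refine Finset.sum_congr rfl fun i _ => ?_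
    simp_rw [← integral_const_mul]
    rw [← integral_finsetSum]
    · refine integral_congr_ae (Eventually.of_forall fun x => ?_)
      simp [PiLp.inner_apply]
    · intro j _
      exact (K.integrableOn_face i (hwj j).continuous).const_mul _
  · intro j _
    exact K.integrableOn_carrier
      (((hwj j).continuous_fderiv (by simp)).clm_apply continuous_const)

/-! ### Polynomial functions -/

section Polynomials

variable {d : ℕ} {k : ℕ}

theorem analyticOnNhd_eval (P : MvPolynomial (Fin d) ℝ) :
    AnalyticOnNhd ℝ (fun x : Euc d => MvPolynomial.eval (fun i => x i) P) univ := by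
  have := AnalyticOnNhd.aeval_mvPolynomial (𝕜 := ℝ) (s := (univ : Set (Euc d)))
    (f := fun x i => x i) (fun i => (EuclideanSpace.proj i : Euc d →L[ℝ] ℝ).analyticOnNhd univ) P
  simpa [MvPolynomial.aeval_eq_eval] using this

theorem hasFDerivAt_eval (P : MvPolynomial (Fin d) ℝ) (x : Euc d) :
    HasFDerivAt (fun x : Euc d => MvPolynomial.eval (fun i => x i) P)
      (∑ i, MvPolynomial.eval (fun i => x i) (MvPolynomial.pderiv i P) •
        (EuclideanSpace.proj i : Euc d →L[ℝ] ℝ)) x := by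
  induction P using MvPolynomial.induction_on with
  | C a => simpa using hasFDerivAt_const a x
  | add p q hp hq =>
    simp only [map_add, add_smul, Finset.sum_add_distrib]
    exact hp.add hq
  | mul_X p n hp =>
    have hX : HasFDerivAt (fun x : Euc d => x n) (EuclideanSpace.proj n : Euc d →L[ℝ] ℝ) x :=
      (EuclideanSpace.proj n : Euc d →L[ℝ] ℝ).hasFDerivAt
    have h := hp.mul hX
    simp only [map_mul, MvPolynomial.eval_X]
    refine h.congr_fderiv ?_
    ext v
    simp only [MvPolynomial.pderiv_mul, MvPolynomial.pderiv_X, map_add, map_mul,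
      MvPolynomial.eval_X, add_smul, Finset.sum_add_distrib, add_apply, smul_apply,
      sum_apply, smul_eq_mul, Finset.mul_sum]
    rw [add_comm]
    congr 1
    · refine Finset.sum_congr rfl fun i _ => by ring
    · rw [Finset.sum_eq_single n]
      · simp
      · intro j _ hj
        simp [hj.symm]
      · simp

theorem totalDegree_pderiv_le (P : MvPolynomial (Fin d) ℝ) (i : Fin d) :
    (MvPolynomial.pderiv i P).totalDegree ≤ P.totalDegree := by
  conv_lhs => rw [P.as_sum, map_sum]
  refine MvPolynomial.totalDegree_finsetSum_le fun s hs => ?_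
  rw [MvPolynomial.pderiv_monomial]
  refine (MvPolynomial.totalDegree_monomial_le _ _).trans
    (le_trans ?_ (MvPolynomial.le_totalDegree hs))
  rw [Finsupp.sum_fintype _ _ (by simp), Finsupp.sum_fintype _ _ (by simp)]
  exact Finset.sum_le_sum fun j _ => by simp [Finsupp.tsub_apply]

/-- The space of polynomial functions of degree at most `k`. -/
noncomputable def polySpace (d k : ℕ) : Submodule ℝ (Euc d → ℝ) where
  carrier := {f | IsPoly k f}
  zero_mem' := ⟨0, by simp, by simp⟩
  add_mem' := by
    rintro f g ⟨P, hP, hf⟩ ⟨Q, hQ, hg⟩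
    exact ⟨P + Q, (MvPolynomial.totalDegree_add _ _).trans (max_le hP hQ), fun x => by
      simp [hf x, hg x]⟩
  smul_mem' := by
    rintro c f ⟨P, hP, hf⟩
    exact ⟨c • P, (MvPolynomial.totalDegree_smul_le _ _).trans hP, fun x => by
      simp [hf x]⟩

theorem mem_polySpace {f : Euc d → ℝ} : f ∈ polySpace d k ↔ IsPoly k f := Iff.rfl

instance : FiniteDimensional ℝ (polySpace d k) := by
  let φ : MvPolynomial (Fin d) ℝ →ₗ[ℝ] (Euc d → ℝ) :=
    { toFun := fun P x => MvPolynomial.eval (fun i => x i) P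
      map_add' := fun P Q => by ext x; simp
      map_smul' := fun c P => by ext x; simp }
  have h : polySpace d k = (MvPolynomial.restrictTotalDegree (Fin d) ℝ k).map φ := by
    ext f
    rw [mem_polySpace, Submodule.mem_map]
    constructor
    · rintro ⟨P, hP, hf⟩
      exact ⟨P, (MvPolynomial.mem_restrictTotalDegree _ _ _).2 hP, funext fun x => (hf x).symm⟩
    · rintro ⟨P, hP, rfl⟩
      exact ⟨P, (MvPolynomial.mem_restrictTotalDegree _ _ _).1 hP, fun x => rfl⟩
  rw [h]
  infer_instance

namespace IsPoly

variable {f g : Euc d → ℝ}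

theorem analyticOnNhd (hf : IsPoly k f) : AnalyticOnNhd ℝ f univ := by
  obtain ⟨P, -, hP⟩ := hf
  rw [funext hP]
  exact analyticOnNhd_eval P

theorem contDiff {n : ℕ∞} (hf : IsPoly k f) : ContDiff ℝ n f :=
  contDiff_iff_contDiffAt.2 fun x => (hf.analyticOnNhd x (mem_univ x)).contDiffAt

theorem continuous (hf : IsPoly k f) : Continuous f := (hf.contDiff (n := 0)).continuous

theorem add (hf : IsPoly k f) (hg : IsPoly k g) : IsPoly k fun x => f x + g x :=
  (polySpace d k).add_mem hf hg

theorem const_mul (c : ℝ) (hf : IsPoly k f) : IsPoly k fun x => c * f x :=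
  (polySpace d k).smul_mem c hf

theorem sub (hf : IsPoly k f) (hg : IsPoly k g) : IsPoly k fun x => f x - g x :=
  (polySpace d k).sub_mem hf hg

theorem sum {ι : Type*} (s : Finset ι) {F : ι → Euc d → ℝ} (h : ∀ i ∈ s, IsPoly k (F i)) :
    IsPoly k fun x => ∑ i ∈ s, F i x := by
  have := (polySpace d k).sum_mem h
  rw [mem_polySpace] at this
  convert this using 1
  ext x; simp

theorem fderiv_single (hf : IsPoly k f) (j : Fin d) :
    IsPoly k fun x => fderiv ℝ f x (EuclideanSpace.single j 1) := by
  obtain ⟨P, hP, hfP⟩ := hf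
  refine ⟨MvPolynomial.pderiv j P, (totalDegree_pderiv_le P j).trans hP, fun x => ?_⟩
  rw [funext hfP]
  beta_reduce
  rw [(hasFDerivAt_eval P x).fderiv]
  simp [sum_apply]

theorem comp_affine (hf : IsPoly k f) (c : Euc d) (h : ℝ) : IsPoly k fun x => f (c + h • x) := by
  obtain ⟨P, hP, hfP⟩ := hf
  refine ⟨MvPolynomial.bind₁ (fun i => MvPolynomial.C (c i) + MvPolynomial.C h * MvPolynomial.X i) P,
    ?_, fun x => ?_⟩
  · rw [MvPolynomial.bind₁, MvPolynomial.aeval_def, MvPolynomial.eval₂_eq]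
    refine MvPolynomial.totalDegree_finsetSum_le fun s hs => ?_
    refine (MvPolynomial.totalDegree_mul _ _).trans ?_
    rw [MvPolynomial.algebraMap_eq, MvPolynomial.totalDegree_C, zero_add]
    refine (MvPolynomial.totalDegree_finsetProd _ _).trans ?_
    refine le_trans ?_ ((MvPolynomial.le_totalDegree hs).trans hP)
    refine Finset.sum_le_sum fun i _ => (MvPolynomial.totalDegree_pow _ _).trans ?_
    refine mul_le_of_le_one_right (Nat.zero_le _) ?_
    refine (MvPolynomial.totalDegree_add _ _).trans (max_le (by simp) ?_)
    refine (MvPolynomial.totalDegree_mul _ _).trans ?_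
    rw [MvPolynomial.totalDegree_C, zero_add, MvPolynomial.totalDegree_X]
  · beta_reduce
    rw [hfP, ← MvPolynomial.coe_aeval_eq_eval, ← MvPolynomial.coe_aeval_eq_eval]
    simp only [RingHom.coe_coe, MvPolynomial.aeval_bind₁]
    congr 1
    congr 1
    ext i
    simp

theorem eq_zero_of_eqOn_ball (hf : IsPoly k f) {c : Euc d} {r : ℝ} (hr : 0 < r)
    (h : ∀ x ∈ Metric.ball c r, f x = 0) : f = 0 :=
  hf.analyticOnNhd.eq_of_eventuallyEq analyticOnNhd_const
    (Filter.eventuallyEq_of_mem (Metric.ball_mem_nhds c hr) h)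

end IsPoly

/-- A finite-dimensional space of functions is determined by finitely many point values. -/
theorem exists_interpolation {X : Type*} (V : Submodule ℝ (X → ℝ)) [FiniteDimensional ℝ V] :
    ∃ (t : Finset X) (ℓ : t → X → ℝ), (∀ j, ℓ j ∈ V) ∧
      ∀ f ∈ V, ∀ x, f x = ∑ j : t, f j * ℓ j x := by
  classical
  let res : ∀ t : Finset X, V →ₗ[ℝ] (t → ℝ) := fun t =>
    (LinearMap.funLeft ℝ ℝ (fun j : t => (j : X))).comp V.subtype
  -- Nodes are chosen so that the kernel of restriction to them is minimal, which is possible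
  -- because subspaces of `V` are well-founded. If a nonzero function survived in the kernel, adding
  -- a point where it does not vanish would shrink the kernel strictly.
  obtain ⟨W, ⟨t, rfl⟩, hW⟩ := (wellFounded_lt (α := Submodule ℝ V)).has_min
    (range fun t => LinearMap.ker (res t)) ⟨_, ∅, rfl⟩
  have hker : LinearMap.ker (res t) = ⊥ := by
    rw [eq_bot_iff]
    intro f hf
    by_contra hne
    have : ∃ x, (f : X → ℝ) x ≠ 0 := by
      by_contra! h
      exact hne (by rw [Submodule.mem_bot]; exact Subtype.ext (funext h))
    obtain ⟨x, hx⟩ := this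
    refine hW _ ⟨insert x t, rfl⟩ (lt_of_le_of_ne (fun g hg => ?_) fun heq => ?_)
    · rw [LinearMap.mem_ker] at hg ⊢
      ext j
      exact congrFun hg ⟨j, Finset.mem_insert_of_mem j.2⟩
    · have hf' : f ∈ LinearMap.ker (res (insert x t)) := by
        simp only at heq; rw [heq]; exact hf
      rw [LinearMap.mem_ker] at hf'
      exact hx (congrFun hf' ⟨x, Finset.mem_insert_self x t⟩)
  -- Restriction to the nodes is injective; the functions `ℓ` are the images of the unit vectors
  -- under a left inverse.
  obtain ⟨g, hg⟩ := (res t).exists_leftInverse_of_injective hker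
  refine ⟨t, fun j => g (Pi.single j 1), fun j => (g (Pi.single j 1)).2, fun f hf x => ?_⟩
  have h1 : (⟨f, hf⟩ : V) = g (res t ⟨f, hf⟩) := (LinearMap.congr_fun hg ⟨f, hf⟩).symm
  have h2 : res t ⟨f, hf⟩ = ∑ j : t, f j • (Pi.single j 1 : t → ℝ) := by
    ext i
    simp [res, Finset.sum_apply, Pi.single_apply, LinearMap.funLeft_apply]
  rw [h2, map_sum] at h1
  have h3 := congrFun (congrArg Subtype.val h1) x
  simpa [Finset.sum_apply] using h3

/-- Equivalence of norms in finite dimension. The `L²` norm over a small ball is a norm on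
polynomials, because a polynomial that vanishes on a ball is zero. -/
theorem exists_sq_le_integral_ball (d k : ℕ) {ρ : ℝ} (hρ : 0 < ρ) :
    ∃ C : ℝ, 0 ≤ C ∧ ∀ f : Euc d → ℝ, IsPoly k f → ∀ x ∈ Metric.closedBall (0 : Euc d) 1,
      f x ^ 2 ≤ C * ∫ y in Metric.closedBall (0 : Euc d) ρ, f y ^ 2 := by
  classical
  set B := Metric.closedBall (0 : Euc d) ρ
  have hB : IsCompact B := isCompact_closedBall _ _
  let b := Module.finBasis ℝ (polySpace d k)
  set N := Module.finrank ℝ (polySpace d k)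
  have hbP : ∀ j, IsPoly k (b j : Euc d → ℝ) := fun j => (b j).2
  let F : (Fin N → ℝ) → Euc d → ℝ := fun a x => ∑ j, a j * (b j : Euc d → ℝ) x
  have hF : ∀ a, IsPoly k (F a) := fun a => IsPoly.sum _ fun j _ => (hbP j).const_mul (a j)
  have hFc : Continuous (Function.uncurry fun a x => F a x ^ 2) := by
    refine Continuous.pow ?_ 2
    refine continuous_finsetSum _ fun j _ => ?_
    exact ((continuous_apply j).comp continuous_fst).mul ((hbP j).continuous.comp continuous_snd)
  set φ : (Fin N → ℝ) → ℝ := fun a => ∫ y in B, F a y ^ 2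
  have hφ : Continuous φ := continuous_parametric_integral_of_continuous hFc hB
  have hφ0 : ∀ a, 0 ≤ φ a := fun a => integral_nonneg fun y => sq_nonneg _
  have hpos : ∀ a ≠ 0, 0 < φ a := by
    intro a ha
    refine lt_of_le_of_ne (hφ0 a) fun h0 => ha ?_
    have hcont : Continuous fun y => F a y ^ 2 := (hF a).continuous.pow 2
    have hz : ∀ x ∈ Metric.ball (0 : Euc d) ρ, F a x = 0 := by
      have h1 := (setIntegral_eq_zero_iff_of_nonneg_ae
        (Eventually.of_forall fun y => sq_nonneg (F a y))
        (hcont.continuousOn.integrableOn_compact hB)).1 h0.symm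
      have h2 := ae_restrict_of_ae_restrict_of_subset (Metric.ball_subset_closedBall) h1
      have h3 := Measure.eqOn_open_of_ae_eq h2 Metric.isOpen_ball hcont.continuousOn
        continuousOn_const
      intro x hx
      exact pow_eq_zero_iff (two_ne_zero) |>.1 (h3 hx)
    have hz' := (hF a).eq_zero_of_eqOn_ball hρ hz
    have hsum : ∑ j, a j • b j = 0 := by
      apply Subtype.ext
      refine Eq.trans ?_ hz'
      ext x
      simp [F, Finset.sum_apply]
    funext j
    exact Fintype.linearIndependent_iff.1 b.linearIndependent a hsum j
  -- The quadratic form `φ` is continuous and positive away from zero; its minimum on the unit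
  -- sphere of coefficients extends to all coefficients by homogeneity.
  obtain ⟨c, hc0, hc⟩ : ∃ c > 0, ∀ a, c * ‖a‖ ^ 2 ≤ φ a := by
    have hsc : ∃ c > 0, ∀ a ∈ Metric.sphere (0 : Fin N → ℝ) 1, c ≤ φ a := by
      rcases (Metric.sphere (0 : Fin N → ℝ) 1).eq_empty_or_nonempty with he | hne
      · exact ⟨1, one_pos, by simp [he]⟩
      · obtain ⟨a, ha, hmin⟩ := (isCompact_sphere (0 : Fin N → ℝ) 1).exists_isMinOn hne
          hφ.continuousOn
        exact ⟨φ a, hpos a (ne_zero_of_mem_unit_sphere ⟨a, ha⟩), fun x hx => hmin hx⟩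
    obtain ⟨c, hc, hmin⟩ := hsc
    refine ⟨c, hc, fun a => ?_⟩
    by_cases ha : a = 0
    · simpa [ha] using hφ0 0
    have hna : ‖a‖ ≠ 0 := norm_ne_zero_iff.2 ha
    have hs := hmin (‖a‖⁻¹ • a) (by simp [norm_smul, hna])
    have hscale : φ (‖a‖⁻¹ • a) = (‖a‖⁻¹) ^ 2 * φ a := by
      simp only [φ]
      rw [← integral_const_mul]
      refine integral_congr_ae (Eventually.of_forall fun y => ?_)
      simp only [F, Pi.smul_apply, smul_eq_mul, mul_assoc, ← Finset.mul_sum, mul_pow]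
    rw [hscale] at hs
    have : 0 < ‖a‖ ^ 2 := by positivity
    calc c * ‖a‖ ^ 2 ≤ (‖a‖⁻¹ ^ 2 * φ a) * ‖a‖ ^ 2 := by gcongr
      _ = φ a := by field_simp
  have hbd : ∀ j, ∃ S, ∀ x ∈ Metric.closedBall (0 : Euc d) 1, ‖(b j : Euc d → ℝ) x‖ ≤ S :=
    fun j => (isCompact_closedBall (0 : Euc d) 1).exists_bound_of_continuousOn
      (hbP j).continuous.continuousOn
  choose S hS using hbd
  refine ⟨(∑ j, S j) ^ 2 / c, by positivity, fun f hf x hx => ?_⟩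
  obtain ⟨a, ha⟩ : ∃ a : Fin N → ℝ, ∑ i, a i • b i = ⟨f, hf⟩ := ⟨_, b.sum_repr _⟩
  have hfa : f = F a := by
    refine (congrArg Subtype.val ha).symm.trans ?_
    ext x
    simp [F, Finset.sum_apply]
  have h1 : |f x| ≤ ‖a‖ * ∑ j, S j := by
    rw [hfa, Finset.mul_sum]
    refine (Finset.abs_sum_le_sum_abs _ _).trans (Finset.sum_le_sum fun j _ => ?_)
    rw [abs_mul]
    exact mul_le_mul (norm_le_pi_norm a j) (hS j x hx) (abs_nonneg _) (norm_nonneg _)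
  calc f x ^ 2 = |f x| ^ 2 := (sq_abs _).symm
    _ ≤ (‖a‖ * ∑ j, S j) ^ 2 := by gcongr
    _ = (∑ j, S j) ^ 2 / c * (c * ‖a‖ ^ 2) := by field_simp
    _ ≤ (∑ j, S j) ^ 2 / c * φ a := by gcongr; exact hc a
    _ = _ := by rw [hfa]

end Polynomials

/-! ### The discrete trace inequality -/

namespace Element

variable {d : ℕ} (K : Element d)

theorem face_subset_carrier (i : K.Face) : K.face i ⊆ K.carrier := fun _ h => h.1

/-- Irredundancy gives a point of the face at which all other constraints are strict; for `d ≥ 2` it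
can be moved a little within the hyperplane. Face diameters may thus be divided by. -/
theorem diam_face_pos (hd : 2 ≤ d) (i : K.Face) : 0 < Metric.diam (K.face i) := by
  obtain ⟨z, hz, hz'⟩ := K.irredundant i
  have hrank : 0 < Module.finrank ℝ (Perp (K.normal i)) := by
    rw [finrank_perp (K.norm_normal i)]; omega
  have := Module.finrank_pos_iff.1 hrank
  obtain ⟨y, hy⟩ := exists_ne (0 : Perp (K.normal i))
  have hev : ∀ᶠ t : ℝ in 𝓝[>] 0, ∀ j, j ≠ i → inner ℝ (K.normal j) (z + t • (y : Euc d)) < K.offset j := by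
    rw [eventually_all]
    intro j
    by_cases hj : j = i
    · simp [hj]
    have hc : Continuous fun t : ℝ => inner ℝ (K.normal j) (z + t • (y : Euc d)) := by fun_prop
    have h0 := (hc.tendsto 0).eventually_lt_const (u := K.offset j) (by simpa using hz' j hj)
    exact (h0.filter_mono nhdsWithin_le_nhds).mono fun t ht _ => ht
  obtain ⟨t, ht, ht0⟩ := (hev.and self_mem_nhdsWithin).exists
  have ht0' : (0 : ℝ) < t := ht0
  have hmem : ∀ w, inner ℝ (K.normal i) w = K.offset i →
      (∀ j, j ≠ i → inner ℝ (K.normal j) w < K.offset j) → w ∈ K.face i := by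
    intro w h1 h2
    refine ⟨fun j => ?_, h1⟩
    by_cases hj : j = i
    · rw [hj, h1]
    · exact (h2 j hj).le
  have hzF : z ∈ K.face i := hmem z hz hz'
  have hwF : z + t • (y : Euc d) ∈ K.face i := by
    refine hmem _ ?_ ht
    rw [inner_add_right, inner_smul_right, inner_perp, hz]; simp
  have hdist : 0 < dist (z + t • (y : Euc d)) z := by
    rw [dist_pos]
    intro h
    have : t • (y : Euc d) = 0 := by simpa using h
    rcases smul_eq_zero.1 this with h | h
    · exact ht0'.ne' h
    · exact hy (Subtype.ext h)
  exact hdist.trans_le (Metric.dist_le_diam_of_mem (K.isCompact_face i).isBounded hwF hzF)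

theorem diam_face_le (i : K.Face) : Metric.diam (K.face i) ≤ Metric.diam K.carrier :=
  Metric.diam_mono (K.face_subset_carrier i) K.isCompact_carrier.isBounded

theorem radius_le_gap {c : Euc d} {r : ℝ} (hr : 0 ≤ r) (h : Metric.closedBall c r ⊆ K.carrier)
    (i : K.Face) : r ≤ K.gap i c := by
  have h1 : c + r • K.normal i ∈ K.carrier := h (by
    simp [norm_smul, K.norm_normal i, abs_of_nonneg hr])
  have h2 := h1 i
  rw [inner_add_right, inner_smul_right, real_inner_self_eq_norm_sq, K.norm_normal i] at h2
  rw [gap]; linarith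

/-- The field `x - c` has divergence `d`, and its normal component on each face is the constant gap
of `c`. Geometrically, for interior `c` the polytope is cut into pyramids with apex `c`. -/
theorem sum_gap_mul_area (c : Euc d) :
    ∑ i, K.gap i c * (μHE[d - 1] : Measure (Euc d)).real (K.face i) =
      d * volume.real K.carrier := by
  have h := K.integral_divg (w := fun x => x - c) (by fun_prop)
  have hdiv : ∀ x : Euc d, divg (fun x => x - c) x = d := by
    intro x
    have : fderiv ℝ (fun x : Euc d => x - c) x = ContinuousLinearMap.id ℝ _ := by
      rw [fderiv_sub_const, fderiv_fun_id]
    simp [divg, gradMat, this, Matrix.trace]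
  simp_rw [hdiv] at h
  rw [setIntegral_const, smul_eq_mul, mul_comm] at h
  rw [h]
  refine Finset.sum_congr rfl fun i _ => ?_
  have : ∫ x in K.face i, inner ℝ (x - c) (K.normal i) ∂(μHE[d - 1] : Measure (Euc d)) =
      ∫ x in K.face i, K.gap i c ∂(μHE[d - 1] : Measure (Euc d)) := by
    refine setIntegral_congr_fun (K.isCompact_face i).measurableSet fun x hx => ?_
    simp only [gap]
    rw [real_inner_comm, inner_sub_right, hx.2]
  rw [this, setIntegral_const, smul_eq_mul, mul_comm]

/-- The discrete trace inequality on shape-regular elements. -/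
theorem exists_trace_constant (d k : ℕ) {ρ : ℝ} (hρ : 0 < ρ) :
    ∃ C : ℝ, 0 ≤ C ∧ ∀ (K : Element d) (c : Euc d), 0 < Metric.diam K.carrier →
      Metric.closedBall c (ρ * Metric.diam K.carrier) ⊆ K.carrier →
      ∀ f : Euc d → ℝ, IsPoly k f →
        Metric.diam K.carrier *
          ∑ i, ∫ x in K.face i, f x ^ 2 ∂(μHE[d - 1] : Measure (Euc d)) ≤
            C * ∫ x in K.carrier, f x ^ 2 := by
  obtain ⟨C, hC0, hC⟩ := exists_sq_le_integral_ball d k hρ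
  set β := (volume : Measure (Euc d)).real (Metric.closedBall 0 1) with hβ
  have hβ0 : 0 ≤ β := measureReal_nonneg
  refine ⟨d * β / ρ * C, by positivity, fun K c hh hball f hf => ?_⟩
  set h := Metric.diam K.carrier with hh_def
  set I := ∫ x in K.carrier, f x ^ 2 with hI
  set σ : K.Face → ℝ := fun i => (μHE[d - 1] : Measure (Euc d)).real (K.face i) with hσ
  have hcK : c ∈ K.carrier := hball (Metric.mem_closedBall_self (by positivity))
  have hsub : K.carrier ⊆ Metric.closedBall c h := fun x hx =>
    Metric.mem_closedBall.2 (Metric.dist_le_diam_of_mem K.isCompact_carrier.isBounded hx hcK)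
  have hvol : volume.real K.carrier ≤ h ^ d * β := by
    have h1 := measureReal_mono (μ := (volume : Measure (Euc d))) hsub
      (isCompact_closedBall c h).measure_lt_top.ne
    have h2 : (volume : Measure (Euc d)).real (Metric.closedBall c h) = h ^ d * β := by
      rw [measureReal_def, Measure.addHaar_closedBall' _ _ hh.le, ENNReal.toReal_mul,
        ENNReal.toReal_ofReal (by positivity), finrank_euclideanSpace_fin]
      rfl
    rw [← h2]; exact h1
  -- Each gap of the centre is at least the radius `ρ h` of the inscribed ball, so the total area is
  -- controlled without counting faces.
  have harea : ρ * h * ∑ i, σ i ≤ d * (h ^ d * β) := by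
    calc ρ * h * ∑ i, σ i = ∑ i, ρ * h * σ i := Finset.mul_sum _ _ _
      _ ≤ ∑ i, K.gap i c * σ i := Finset.sum_le_sum fun i _ =>
          mul_le_mul_of_nonneg_right (K.radius_le_gap (by positivity) hball i) measureReal_nonneg
      _ = d * volume.real K.carrier := K.sum_gap_mul_area c
      _ ≤ _ := by gcongr
  -- In the variable `z` with `x = c + h z` the element lies in the unit ball and contains the ball
  -- of radius `ρ`. The degree is preserved, so the reference estimate applies; the Jacobian is
  -- `h⁻ᵈ`.
  have hsup : ∀ x ∈ K.carrier, f x ^ 2 ≤ C * ((h ^ d)⁻¹ * I) := by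
    intro x hx
    have hg : IsPoly k fun z => f (c + h • z) := hf.comp_affine c h
    have h1 := hC _ hg (h⁻¹ • (x - c)) (by
      rw [mem_closedBall_zero_iff, norm_smul, norm_inv, Real.norm_eq_abs, abs_of_pos hh,
        inv_mul_le_iff₀ hh, mul_one, ← dist_eq_norm]
      exact hsub hx)
    rw [smul_inv_smul₀ hh.ne', add_sub_cancel] at h1
    refine h1.trans (mul_le_mul_of_nonneg_left ?_ hC0)
    have h2 := Measure.setIntegral_comp_smul_of_pos (volume : Measure (Euc d))
      (fun z => f (c + z) ^ 2) (Metric.closedBall 0 ρ) hh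
    rw [h2, finrank_euclideanSpace_fin, smul_eq_mul]
    refine mul_le_mul_of_nonneg_left ?_ (by positivity)
    rw [smul_closedBall' hh.ne', smul_zero, Real.norm_eq_abs, abs_of_pos hh, mul_comm h ρ]
    have h3 : ∫ z in Metric.closedBall (0 : Euc d) (ρ * h), f (c + z) ^ 2 =
        ∫ z in Metric.closedBall c (ρ * h), f z ^ 2 := by
      have := (measurePreserving_add_left (volume : Measure (Euc d)) c).setIntegral_preimage_emb
        (measurableEmbedding_addLeft c) (fun z => f z ^ 2) (Metric.closedBall c (ρ * h))
      rw [← this, preimage_add_closedBall, sub_self]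
    rw [h3]
    exact setIntegral_mono_set (K.integrableOn_carrier (hf.continuous.pow 2))
      (Eventually.of_forall fun z => sq_nonneg _) hball.eventuallyLE
  have hI0 : 0 ≤ I := integral_nonneg fun x => sq_nonneg _
  have hface : ∀ i, ∫ x in K.face i, f x ^ 2 ∂(μHE[d - 1] : Measure (Euc d)) ≤
      C * ((h ^ d)⁻¹ * I) * σ i := by
    intro i
    have hfin := surface_finite (K.norm_normal i) (K.face_subset_hyperplane i) (K.isCompact_face i)
    have := setIntegral_mono_on (K.integrableOn_face i (hf.continuous.pow 2))
      (integrableOn_const (C := C * ((h ^ d)⁻¹ * I)) hfin.ne) (K.isCompact_face i).measurableSet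
      fun x hx => hsup x hx.1
    rwa [setIntegral_const, smul_eq_mul, mul_comm] at this
  have hσle : h * ∑ i, σ i ≤ d * (h ^ d * β) / ρ := by
    rw [le_div_iff₀ hρ]; linarith
  calc h * ∑ i, ∫ x in K.face i, f x ^ 2 ∂(μHE[d - 1] : Measure (Euc d))
      ≤ h * ∑ i, C * ((h ^ d)⁻¹ * I) * σ i := by
        gcongr with i; exact hface i
    _ = C * ((h ^ d)⁻¹ * I) * (h * ∑ i, σ i) := by rw [← Finset.mul_sum]; ring
    _ ≤ C * ((h ^ d)⁻¹ * I) * (d * (h ^ d * β) / ρ) := by gcongr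
    _ = d * β / ρ * C * I := by
        have : h ^ d ≠ 0 := by positivity
        field_simp

end Element

/-! ### Normal continuity of discrete velocity fields -/

theorem divg_smul {d : ℕ} {f : Euc d → ℝ} {w : Euc d → Euc d} {x : Euc d}
    (hf : DifferentiableAt ℝ f x) (hw : DifferentiableAt ℝ w x) :
    divg (fun y => f y • w y) x = f x * divg w x + fderiv ℝ f x (w x) := by
  have hj : ∀ j, HasFDerivAt (fun y => w y j) ((EuclideanSpace.proj j : Euc d →L[ℝ] ℝ).comp
      (fderiv ℝ w x)) x := fun j =>
    (EuclideanSpace.proj j : Euc d →L[ℝ] ℝ).hasFDerivAt.comp x hw.hasFDerivAt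
  rw [divg_eq_sum (w := fun y => f y • w y) (hf.fun_smul hw), divg_eq_sum hw]
  have h1 : ∀ j, fderiv ℝ (fun y => (f y • w y) j) x (EuclideanSpace.single j 1) =
      f x * fderiv ℝ (fun y => w y j) x (EuclideanSpace.single j 1) +
        fderiv ℝ f x (w x j • EuclideanSpace.single j 1) := by
    intro j
    have := (hf.hasFDerivAt.mul (hj j)).fderiv
    have e : (fun y => (f y • w y) j) = fun y => f y * w y j := by ext y; simp
    rw [e]
    erw [this]
    rw [(hj j).fderiv]
    simp only [add_apply, smul_apply, map_smul, smul_eq_mul]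
  simp_rw [h1]
  rw [Finset.sum_add_distrib, ← Finset.mul_sum, ← map_sum]
  congr 2
  ext i
  simp [Finset.sum_apply, Pi.single_apply]

theorem continuous_divg {d : ℕ} {w : Euc d → Euc d} (hw : ContDiff ℝ 1 w) : Continuous (divg w) := by
  have : divg w = fun x => ∑ j, fderiv ℝ (fun y => w y j) x (EuclideanSpace.single j 1) :=
    funext fun x => divg_eq_sum ((hw.differentiable (by simp)) x)
  rw [this]
  refine continuous_finsetSum _ fun j _ => ?_
  have hj : ContDiff ℝ 1 fun y => w y j :=
    (EuclideanSpace.proj j : Euc d →L[ℝ] ℝ).contDiff.comp hw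
  exact (hj.continuous_fderiv (by simp)).clm_apply continuous_const

namespace Element

variable {d : ℕ} (K : Element d)

theorem mem_interior_of_gap_pos {x : Euc d} (h : ∀ i, 0 < K.gap i x) : x ∈ interior K.carrier := by
  refine mem_interior.2 ⟨{y | ∀ i, 0 < K.gap i y}, fun y hy => K.mem_carrier_iff.2 fun i => (hy i).le,
    ?_, h⟩
  simp only [ofPred_forall]
  exact isOpen_iInter_of_finite fun i => isOpen_lt continuous_const (K.continuous_gap i)

theorem interior_ae_eq : (interior K.carrier : Set (Euc d)) =ᵐ[volume] K.carrier := by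
  filter_upwards [K.ae_gap_ne_zero] with x hx
  refine propext ⟨fun h => interior_subset h, fun h => ?_⟩
  exact K.mem_interior_of_gap_pos fun i => lt_of_le_of_ne (K.mem_carrier_iff.1 h i) (hx i).symm

end Element

/-- Two hyperplanes with unit normals, one contained in the other. -/
theorem normal_eq_or_neg {d : ℕ} {n m : Euc d} (hn : ‖n‖ = 1) (hm : ‖m‖ = 1) {b c : ℝ}
    (h : ∀ z, inner ℝ n z = b → inner ℝ m z = c) : (m = n ∧ c = b) ∨ (m = -n ∧ c = -b) := by
  have hs : ∀ y, inner ℝ n y = 0 → inner ℝ m y = 0 := by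
    intro y hy
    have h1 := h (b • n) (by simp [inner_smul_right, hn])
    have h2 := h (b • n + y) (by simp [inner_smul_right, inner_add_right, hn, hy])
    rw [inner_add_right, h1] at h2
    linarith
  set l := inner ℝ n m with hl
  have hml : m = l • n := by
    have h0 : inner ℝ n (m - l • n) = 0 := by
      rw [inner_sub_right, inner_smul_right, real_inner_self_eq_norm_sq, hn]; simp [hl]
    have h1 := hs _ h0
    have h2 : inner ℝ (m - l • n) (m - l • n) = 0 := by
      rw [inner_sub_left, h1, inner_smul_left, h0]; simp
    exact sub_eq_zero.1 (inner_self_eq_zero.1 h2)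
  have hc : c = l * b := by
    have := h (b • n) (by simp [inner_smul_right, hn])
    rw [← this, hml, inner_smul_left, inner_smul_right, real_inner_self_eq_norm_sq, hn]
    simp
  have hl1 : |l| = 1 := by
    have := congrArg norm hml
    rwa [norm_smul, hn, hm, mul_one, Real.norm_eq_abs, eq_comm] at this
  rcases (abs_eq zero_le_one).1 hl1 with h1 | h1
  · left; rw [h1] at hml hc; simp at hml hc; exact ⟨hml, hc⟩
  · right; rw [h1] at hml hc; simp at hml hc; exact ⟨hml, hc⟩

/-! ### Element faces and their generic points. -/

namespace Mesh

variable {d : ℕ} {Ω : Set (Euc d)} (M : Mesh d Ω)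

/-- Element faces. -/
abbrev Sides : Type := (K : M.Elem) × (M.elem K).Face

/-- Each element face occurs exactly once, as the plus or minus side of an interior face or as a
boundary face. Sums of elementwise boundary integrals are thereby regrouped by mesh faces. -/
theorem sum_sides (s : M.Sides → ℝ) :
    ∑ K, ∑ i, s ⟨K, i⟩ = ∑ F, (s (M.plus F) + s (M.minus F)) + ∑ F, s (M.bdry F) := by
  rw [← Fintype.sum_sigma', ← Fintype.sum_bijective _ M.faces_bijective
    (fun F => s (Sum.elim M.plus (Sum.elim M.minus M.bdry) F)) (fun a => s ⟨a.1, a.2⟩) fun _ => rfl]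
  simp [Finset.sum_add_distrib, add_assoc]

theorem isOpen_domain {Ω : Set (Euc d)} (M : Mesh d Ω) : IsOpen Ω := by
  rw [← M.domain_regular]; exact isOpen_interior

theorem carrier_subset (K : M.Elem) : (M.elem K).carrier ⊆ closure Ω := by
  rw [← M.covers]; exact subset_iUnion (fun K => (M.elem K).carrier) K

theorem interior_carrier_subset (K : M.Elem) : interior (M.elem K).carrier ⊆ Ω := by
  exact (interior_mono (M.carrier_subset K)).trans M.domain_regular.subset

theorem volume_domain_lt_top {Ω : Set (Euc d)} (M : Mesh d Ω) : volume Ω < ⊤ := by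
  refine (measure_mono subset_closure).trans_lt ?_
  rw [← M.covers]
  exact (isCompact_iUnion fun K => (M.elem K).isCompact_carrier).measure_lt_top

/-- The gap function of an element face. -/
noncomputable def sgap (s : M.Sides) (x : Euc d) : ℝ := (M.elem s.1).gap s.2 x

/-- The unit normal and offset of an element face. -/
noncomputable def snormal (s : M.Sides) : Euc d := (M.elem s.1).normal s.2

theorem norm_snormal (s : M.Sides) : ‖M.snormal s‖ = 1 := (M.elem s.1).norm_normal s.2

/-- The point set of an element face. -/
def sface (s : M.Sides) : Set (Euc d) := (M.elem s.1).face s.2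

theorem isCompact_sface (s : M.Sides) : IsCompact (M.sface s) := (M.elem s.1).isCompact_face s.2

/-- `x` lies on no face hyperplane other than that of the face `s`. -/
def GenericPt (s : M.Sides) (x : Euc d) : Prop :=
  x ∈ M.sface s ∧ ∀ t, M.sgap t x = 0 → ∀ z, M.sgap s z = 0 → M.sgap t z = 0

/-- A hyperplane that does not contain that of `s` meets it in a set of surface measure zero, and
there are only finitely many element faces. -/
theorem ae_genericPt (s : M.Sides) :
    ∀ᵐ x ∂(μHE[d - 1] : Measure (Euc d)).restrict (M.sface s), M.GenericPt s x := by
  have h1 : ∀ᵐ x ∂(μHE[d - 1] : Measure (Euc d)).restrict (M.sface s), x ∈ M.sface s :=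
    ae_restrict_mem (M.isCompact_sface s).measurableSet
  have h2 : ∀ t, ∀ᵐ x ∂(μHE[d - 1] : Measure (Euc d)).restrict (M.sface s),
      M.sgap t x = 0 → ∀ z, M.sgap s z = 0 → M.sgap t z = 0 := by
    intro t
    by_cases h : ∀ z, M.sgap s z = 0 → M.sgap t z = 0
    · exact Eventually.of_forall fun _ _ => h
    push Not at h
    obtain ⟨z, hz, hz'⟩ := h
    have h0 := surface_inter_hyperplane_zero (n := M.snormal s) (m := M.snormal t)
      (M.norm_snormal s) (c := (M.elem s.1).offset s.2) (b := (M.elem t.1).offset t.2) (z := z)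
      (by simp only [sgap, Element.gap] at hz; simp only [snormal]; linarith)
      (by
        intro h; apply hz'
        simp only [snormal] at h
        simp only [sgap, Element.gap]; linarith)
    rw [ae_restrict_iff' (M.isCompact_sface s).measurableSet, ae_iff]
    refine measure_mono_null (fun x hx => ?_) h0
    simp only [mem_ofPred_eq, Classical.not_imp] at hx
    refine ⟨hx.1.2, ?_⟩
    have := hx.2.1
    simp only [sgap, Element.gap] at this
    simp only [snormal, mem_ofPred_eq]; linarith
  filter_upwards [h1, ae_all_iff.2 h2] with x hx1 hx2 using ⟨hx1, hx2⟩

theorem sgap_eq_or_neg {s t : M.Sides} (h : ∀ z, M.sgap s z = 0 → M.sgap t z = 0) :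
    (M.sgap t = M.sgap s ∧ M.snormal t = M.snormal s) ∨ (∀ z, M.sgap t z = -M.sgap s z) := by
  have := normal_eq_or_neg (M.norm_snormal s) (M.norm_snormal t) (b := (M.elem s.1).offset s.2)
    (c := (M.elem t.1).offset t.2) (fun z hz => by
      have := h z (by simp only [sgap, Element.gap]; simp only [snormal] at hz; linarith)
      simp only [sgap, Element.gap] at this; simp only [snormal]; linarith)
  simp only [snormal] at this
  rcases this with ⟨h1, h2⟩ | ⟨h1, h2⟩
  · left
    refine ⟨?_, h1⟩
    ext z; simp only [sgap, Element.gap, h1, h2]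
  · right
    intro z; simp only [sgap, Element.gap, h1, h2, inner_neg_left]; ring

variable {M}

/-- If a second face hyperplane of the same element passed through `x`, genericity would make both
coincide with the hyperplane of `s`, against irredundancy. Near `x` the element is therefore a
half-ball. -/
theorem GenericPt.gap_pos {s t : M.Sides} {x : Euc d} (hx : M.GenericPt s x) (ht : x ∈ M.sface t)
    {j : (M.elem t.1).Face} (hj : j ≠ t.2) : 0 < (M.elem t.1).gap j x := by
  refine lt_of_le_of_ne ((M.elem t.1).mem_carrier_iff.1 ht.1 j) fun h0 => ?_
  have ht0 : M.sgap t x = 0 := by simp only [sgap, Element.gap]; linarith [ht.2]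
  have hst := hx.2 t ht0
  have hsj := hx.2 ⟨t.1, j⟩ h0.symm
  have hts : ∀ z, M.sgap t z = 0 → M.sgap s z = 0 := by
    intro z hz
    rcases M.sgap_eq_or_neg hst with h | h
    · rw [← h.1]; exact hz
    · have := h z; linarith
  obtain ⟨z, hz, hz'⟩ := (M.elem t.1).irredundant t.2
  have h1 := hsj z (hts z (by simp only [sgap, Element.gap]; linarith))
  have h2 := hz' j hj
  simp only [sgap, Element.gap] at h1
  linarith

theorem GenericPt.eventually_gap_pos {s t : M.Sides} {x : Euc d} (hx : M.GenericPt s x)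
    (ht : x ∈ M.sface t) : ∀ᶠ y in 𝓝 x, ∀ j, j ≠ t.2 → 0 < (M.elem t.1).gap j y := by
  rw [eventually_all]
  intro j
  by_cases hj : j = t.2
  · simp [hj]
  exact (((M.elem t.1).continuous_gap j).tendsto x).eventually_const_lt (hx.gap_pos ht hj)|>.mono
    fun y hy _ => hy

/-- Two element faces through a generic point that lie on the same side coincide. -/
theorem GenericPt.side_eq {s t t' : M.Sides} {x : Euc d} (hx : M.GenericPt s x)
    (ht : x ∈ M.sface t) (ht' : x ∈ M.sface t') (h : M.sgap t = M.sgap t') : t = t' := by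
  have hev := (hx.eventually_gap_pos ht).and (hx.eventually_gap_pos ht')
  -- A small step inward along the common normal reaches the interior of both elements, so they are
  -- the same element by non-overlap; a face of one element through `x` is then unique.
  have hlim : Tendsto (fun r : ℝ => x - r • M.snormal t) (𝓝[>] 0) (𝓝 x) := by
    have : Continuous fun r : ℝ => x - r • M.snormal t := by fun_prop
    have h := this.tendsto 0
    simp only [zero_smul, sub_zero] at h
    exact h.mono_left nhdsWithin_le_nhds
  obtain ⟨r, ⟨h1, h2⟩, hr⟩ := ((hlim.eventually hev).and self_mem_nhdsWithin).exists
  have hr' : (0 : ℝ) < r := hr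
  have hg : M.sgap t (x - r • M.snormal t) = r := by
    have h1 := ht.2
    have h2 := M.norm_snormal t
    simp only [snormal] at h2
    simp only [sgap, Element.gap, snormal, inner_sub_right, inner_smul_right,
      real_inner_self_eq_norm_sq, h2, h1]
    ring
  have hi : x - r • M.snormal t ∈ interior (M.elem t.1).carrier := by
    refine Element.mem_interior_of_gap_pos _ fun j => ?_
    by_cases hj : j = t.2
    · rw [hj]; exact hr'.trans_eq hg.symm
    · exact h1 j hj
  have hi' : x - r • M.snormal t ∈ interior (M.elem t'.1).carrier := by
    refine Element.mem_interior_of_gap_pos _ fun j => ?_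
    by_cases hj : j = t'.2
    · rw [hj]; rw [h] at hg; exact hr'.trans_eq hg.symm
    · exact h2 j hj
  have hel : t.1 = t'.1 := by
    by_contra hne
    exact (Set.disjoint_left.1 (M.nonoverlap _ _ hne)) hi hi'
  obtain ⟨K, i⟩ := t
  obtain ⟨K', i'⟩ := t'
  simp only at hel
  subst hel
  by_contra hne
  have hii : i' ≠ i := fun hii => hne (by rw [hii])
  have h3 := hx.gap_pos ht hii
  have h4 : (M.elem K).gap i' x = 0 := by
    have := ht'.2
    simp only [Element.gap]; simp only at this; linarith
  linarith

variable (M)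

/-- A second mesh face through a generic point would share the hyperplane. Lying on the same side,
it would be the same element face; lying on the opposite side of an interior face, it would be the
minus side, which is already taken. The remaining case, opposite a boundary face, contradicts the
point being on the frontier. -/
theorem GenericPt.notMem_faceSet {F F' : M.Faces} (hne : F' ≠ F) {x : Euc d}
    (hx : M.GenericPt (M.side F) x) : x ∉ M.faceSet F' := by
  intro hx'
  have hinj := M.faces_bijective.injective
  have hx't : x ∈ M.sface (M.side F') := hx'
  have hg0 : M.sgap (M.side F') x = 0 := by simp only [sgap, Element.gap]; linarith [hx't.2]
  have hside : M.side F' ≠ M.side F := by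
    rcases F with F | F <;> rcases F' with F' | F' <;> simp only [side] <;> intro h
    · exact hne (by rw [Sum.inl_injective (hinj (a₁ := Sum.inl F') (a₂ := Sum.inl F) h)])
    · exact absurd (hinj (a₁ := Sum.inr (Sum.inr F')) (a₂ := Sum.inl F) h) (by simp)
    · exact absurd (hinj (a₁ := Sum.inl F') (a₂ := Sum.inr (Sum.inr F)) h) (by simp)
    · exact hne (by
        have := hinj (a₁ := Sum.inr (Sum.inr F')) (a₂ := Sum.inr (Sum.inr F)) h
        simpa using this)
  rcases M.sgap_eq_or_neg (hx.2 _ hg0) with h | h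
  · exact hside (hx.side_eq hx't hx.1 h.1)
  · rcases F with F | F
    · have hxm : x ∈ M.sface (M.minus F) := by
        have := M.conforming F
        change x ∈ (M.elem (M.minus F).1).face (M.minus F).2
        rw [← this]; exact hx.1
      have hgm : M.sgap (M.minus F) x = 0 := by simp only [sgap, Element.gap]; linarith [hxm.2]
      have hm : ∀ z, M.sgap (M.minus F) z = -M.sgap (M.side (Sum.inl F)) z := by
        rcases M.sgap_eq_or_neg (hx.2 _ hgm) with h' | h'
        · exfalso
          have h1 := h'.2
          have h2 : M.snormal (M.minus F) = -M.snormal (M.side (Sum.inl F)) := M.normal_opposite F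
          rw [h2] at h1
          have h3 := M.norm_snormal (M.side (Sum.inl F))
          have h4 : M.snormal (M.side (Sum.inl F)) = 0 := by
            have : (2 : ℝ) • M.snormal (M.side (Sum.inl F)) = 0 := by
              rw [two_smul]; nth_rewrite 1 [← h1]; simp
            simpa using this
          rw [h4] at h3
          simp at h3
        · exact h'
      have heq := hx.side_eq hx't hxm (funext fun z => (h z).trans (hm z).symm)
      rcases F' with F' | F' <;> simp only [side] at heq
      · exact absurd (hinj (a₁ := Sum.inl F') (a₂ := Sum.inr (Sum.inl F)) heq) (by simp)
      · exact absurd (hinj (a₁ := Sum.inr (Sum.inr F')) (a₂ := Sum.inr (Sum.inl F)) heq) (by simp)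
    -- Two half-balls on opposite sides fill a neighbourhood of `x` inside the closure of `Ω`; as
    -- `Ω` is the interior of its closure, `x` would belong to `Ω`.
    · have hfr : x ∈ frontier Ω := M.bdry_subset F hx.1
      refine hfr.2 ?_
      rw [M.isOpen_domain.interior_eq, ← M.domain_regular, mem_interior_iff_mem_nhds]
      filter_upwards [hx.eventually_gap_pos hx't, hx.eventually_gap_pos hx.1] with y h1 h2
      rcases le_total 0 (M.sgap (M.side (Sum.inr F)) y) with h3 | h3
      · refine M.carrier_subset (M.side (Sum.inr F)).1 ((Element.mem_carrier_iff _).2 fun j => ?_)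
        by_cases hj : j = (M.side (Sum.inr F)).2
        · rw [hj]; exact h3
        · exact (h2 j hj).le
      · refine M.carrier_subset (M.side F').1 ((Element.mem_carrier_iff _).2 fun j => ?_)
        by_cases hj : j = (M.side F').2
        · rw [hj]
          have : M.sgap (M.side F') y = -M.sgap (M.side (Sum.inr F)) y := h y
          change 0 ≤ M.sgap (M.side F') y
          linarith
        · exact (h1 j hj).le

/-! ### Green's formula on the mesh and vanishing of normal jumps. -/

theorem integral_glue (w : M.Elem → Euc d → Euc d) (hw : ∀ K, Continuous (w K))
    {G : Euc d → Euc d} (hG : Continuous G) :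
    ∫ x in Ω, inner ℝ (M.glue w x) (G x) = M.vol fun K x => inner ℝ (w K x) (G x) := by
  have h1 : ∀ x, inner ℝ (M.glue w x) (G x) = ∑ K, (interior (M.elem K).carrier).indicator
      (fun x => inner ℝ (w K x) (G x)) x := by
    intro x
    simp only [glue, sum_inner]
    refine Finset.sum_congr rfl fun K _ => ?_
    by_cases hx : x ∈ interior (M.elem K).carrier
    · simp [indicator_of_mem hx]
    · simp [indicator_of_notMem hx]
  simp_rw [h1]
  rw [integral_finsetSum]
  · refine Finset.sum_congr rfl fun K _ => ?_
    rw [setIntegral_indicator isOpen_interior.measurableSet,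
      inter_eq_right.2 (M.interior_carrier_subset K)]
    exact setIntegral_congr_set (M.elem K).interior_ae_eq
  · intro K _
    refine Integrable.integrableOn ?_
    rw [integrable_indicator_iff isOpen_interior.measurableSet]
    exact ((M.elem K).integrableOn_carrier ((hw K).inner hG)).mono_set interior_subset

theorem inner_gradient {φ : Euc d → ℝ} (x v : Euc d) :
    inner ℝ v (gradient φ x) = fderiv ℝ φ x v := by
  rw [gradient, real_inner_comm, InnerProductSpace.toDual_symm_apply]

theorem faceInt_plus_minus (F : M.IFace) (f g : Euc d → ℝ) (hf : Continuous f) (hg : Continuous g) :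
    (∫ x in M.sface (M.plus F), f x ∂(μHE[d - 1] : Measure (Euc d))) +
      (∫ x in M.sface (M.minus F), g x ∂(μHE[d - 1] : Measure (Euc d))) =
    M.faceInt (Sum.inl F) fun x => f x + g x := by
  have h : M.sface (M.minus F) = M.sface (M.plus F) := (M.conforming F).symm
  rw [h]
  exact (integral_add ((M.elem (M.plus F).1).integrableOn_face _ hf)
    ((M.elem (M.plus F).1).integrableOn_face _ hg)).symm

theorem contDiff_jump {w : M.Elem → Euc d → Euc d} {n : WithTop ℕ∞} (hw : ∀ K, ContDiff ℝ n (w K))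
    (F : M.Faces) : ContDiff ℝ n (M.jump w F) := by
  rcases F with F | F
  · exact (hw _).sub (hw _)
  · exact hw _

theorem sum_boundary_integrals (w : M.Elem → Euc d → Euc d) (hw : ∀ K, Continuous (w K))
    {φ : Euc d → ℝ} (hφ : Continuous φ) :
    ∑ K, ∑ i, ∫ x in (M.elem K).face i, φ x * inner ℝ (w K x) ((M.elem K).normal i)
        ∂(μHE[d - 1] : Measure (Euc d)) =
      ∑ F, M.faceInt F fun x => φ x * inner ℝ (M.jump w F x) (M.nF F) := by
  have h := M.sum_sides fun s => ∫ x in M.sface s, φ x * inner ℝ (w s.1 x) (M.snormal s)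
    ∂(μHE[d - 1] : Measure (Euc d))
  refine h.trans ?_
  rw [Fintype.sum_sum_type]
  congr 1
  refine Finset.sum_congr rfl fun F _ => ?_
  have hc : ∀ (K : M.Elem) (v : Euc d), Continuous fun x => φ x * inner ℝ (w K x) v :=
    fun K v => hφ.mul ((hw K).inner continuous_const)
  rw [M.faceInt_plus_minus F _ _ (hc _ _) (hc _ _)]
  congr 1
  ext x
  have hn : M.snormal (M.minus F) = -M.snormal (M.plus F) := M.normal_opposite F
  rw [hn]
  change _ = φ x * inner ℝ (w _ x - w _ x) (M.snormal (M.plus F))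
  rw [inner_sub_left, inner_neg_right]
  ring

/-- The elementwise divergence theorem for `φ w`, compared with Green's formula for the glued field:
the mismatch between the elementwise divergence and `g` is carried by the normal jumps. -/
theorem weak_divergence_identity {w : M.Elem → Euc d → Euc d} (hw : ∀ K, ContDiff ℝ ∞ (w K))
    {g : Euc d → ℝ}
    (hg : ∀ φ : Euc d → ℝ, ContDiff ℝ ∞ φ → HasCompactSupport φ →
        ∫ x in Ω, inner ℝ (M.glue w x) (gradient φ x) = -∫ x in Ω, g x * φ x)
    {φ : Euc d → ℝ} (hφ : ContDiff ℝ ∞ φ) (hc : HasCompactSupport φ) :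
    ∑ F, M.faceInt F (fun x => φ x * inner ℝ (M.jump w F x) (M.nF F)) =
      (∑ K, ∫ x in (M.elem K).carrier, φ x * divg (w K) x) - ∫ x in Ω, g x * φ x := by
  have hgrad : Continuous (gradient φ) :=
    (InnerProductSpace.toDual ℝ (Euc d)).symm.continuous.comp (hφ.continuous_fderiv (by simp))
  have h1 := hg φ hφ hc
  rw [M.integral_glue w (fun K => (hw K).continuous) hgrad] at h1
  rw [sub_eq_add_neg, ← h1, vol, ← Finset.sum_add_distrib,
    ← M.sum_boundary_integrals w (fun K => (hw K).continuous) hφ.continuous]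
  refine Finset.sum_congr rfl fun K _ => ?_
  have hwd : ∀ x, DifferentiableAt ℝ (w K) x := fun x => ((hw K).differentiable (by simp)) x
  have hφd : ∀ x, DifferentiableAt ℝ φ x := fun x => (hφ.differentiable (by simp)) x
  have hc1 : Continuous fun x => φ x * divg (w K) x :=
    hφ.continuous.mul (continuous_divg ((hw K).of_le (by simp)))
  rw [← integral_add ((M.elem K).integrableOn_carrier hc1)
    ((M.elem K).integrableOn_carrier ((hw K).continuous.inner hgrad))]
  have h2 := (M.elem K).integral_divg (w := fun x => φ x • w K x)
    ((hφ.smul (hw K)).of_le (by simp))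
  simp_rw [inner_smul_left] at h2
  simp only [conj_trivial] at h2
  rw [← h2]
  refine integral_congr_ae (Eventually.of_forall fun x => ?_)
  simp only
  rw [divg_smul (hφd x) (hwd x), inner_gradient]

/-- As `k` grows, the layer supporting the factor `β` shrinks to a hyperplane, a null set, so a
fixed integrable function tested against it contributes nothing in the limit. -/
theorem tendsto_integral_layer {n : Euc d} (hn : n ≠ 0) (b : ℝ) {f ψ : Euc d → ℝ} {β : ℝ → ℝ}
    (hβ : Continuous β) (hβc : HasCompactSupport β) (hψ : Continuous ψ) (hψc : HasCompactSupport ψ)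
    {μ : Measure (Euc d)} (hμ : μ ≪ volume) (hf : Integrable f μ) :
    Tendsto (fun k : ℕ => ∫ x, f x * (ψ x * β (k * (inner ℝ n x - b))) ∂μ) atTop (𝓝 0) := by
  obtain ⟨C, hC⟩ := hψc.exists_bound_of_continuous hψ
  obtain ⟨D, hD⟩ := hβc.exists_bound_of_continuous hβ
  have h0 : ∀ᵐ x ∂μ, inner ℝ n x - b ≠ 0 := by
    refine hμ.ae_le ?_
    refine measure_mono_null (fun x hx => ?_) (volume_hyperplane_zero hn b)
    have hx' : ¬(inner ℝ n x - b ≠ 0) := hx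
    simp only [not_not, mem_ofPred_eq] at hx' ⊢
    linarith
  rw [← integral_zero (Euc d) ℝ (μ := μ)]
  refine tendsto_integral_of_dominated_convergence (fun x => ‖f x‖ * (C * D)) ?_
    (hf.norm.mul_const _) ?_ ?_
  · intro k
    refine hf.aestronglyMeasurable.mul (Continuous.aestronglyMeasurable ?_)
    exact hψ.mul (hβ.comp (by fun_prop))
  · intro k
    refine Eventually.of_forall fun x => ?_
    rw [norm_mul, norm_mul]
    have hC0 : 0 ≤ C := (norm_nonneg _).trans (hC x)
    gcongr
    · exact hC x
    · exact hD _
  · filter_upwards [h0] with x hx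
    have h1 : Tendsto (fun k : ℕ => (k : ℝ) * (inner ℝ n x - b)) atTop (cocompact ℝ) :=
      Metric.cobounded_eq_cocompact (α := ℝ) ▸ tendsto_norm_atTop_iff_cobounded.1 (by
        simp only [norm_mul]
        exact (tendsto_norm_atTop_atTop.comp tendsto_natCast_atTop_atTop).atTop_mul_const
          (norm_pos_iff.2 hx))
    have h2 : Tendsto (fun k : ℕ => β (k * (inner ℝ n x - b))) atTop (𝓝 0) :=
      (hβc.is_zero_at_infty).comp h1
    simpa using (h2.const_mul (ψ x)).const_mul (f x)

/-- The normal jump of a field in `H_0(div; Ω)` vanishes on every face. -/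
theorem ae_normal_jump_eq_zero {w : M.Elem → Euc d → Euc d} (hw : ∀ K, ContDiff ℝ ∞ (w K))
    (hdiv : MemHdivZero Ω (M.glue w)) (F : M.Faces) :
    ∀ᵐ x ∂(μHE[d - 1] : Measure (Euc d)).restrict (M.faceSet F),
      inner ℝ (M.jump w F x) (M.nF F) = 0 := by
  obtain ⟨-, g, hgL, hg⟩ := hdiv
  set n := M.nF F with hn
  have hn1 : ‖n‖ = 1 := M.norm_snormal (M.side F)
  have hn0 : n ≠ 0 := by rintro h; rw [h] at hn1; simp at hn1
  set b := (M.elem (M.side F).1).offset (M.side F).2 with hb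
  set J : Euc d → ℝ := fun x => inner ℝ (M.jump w F x) n with hJ
  have hJc : ContDiff ℝ ∞ J := (M.contDiff_jump hw F).inner ℝ contDiff_const
  have hgI : IntegrableOn g Ω := by
    have : IsFiniteMeasure (volume.restrict Ω) := ⟨by simpa using M.volume_domain_lt_top⟩
    exact hgL.integrable (by norm_num)
  have hF : MeasurableSet (M.faceSet F) := (M.isCompact_sface (M.side F)).measurableSet
  have hclosed : ∀ F', IsClosed (M.faceSet F') := fun F' => (M.isCompact_sface (M.side F')).isClosed
  -- It suffices to work near a generic point, where a small ball meets no other mesh face.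
  have hloc : ∀ x, M.GenericPt (M.side F) x → ∃ r > 0,
      (μHE[d - 1] : Measure (Euc d)) {y | y ∈ M.faceSet F ∧ y ∈ Metric.ball x r ∧ J y ≠ 0} = 0 := by
    intro x hx
    have hev : ∀ᶠ y in 𝓝 x, ∀ F', F' ≠ F → y ∉ M.faceSet F' := by
      rw [eventually_all]
      intro F'
      by_cases hne : F' = F
      · simp [hne]
      have hmem := (hclosed F').isOpen_compl.mem_nhds (GenericPt.notMem_faceSet M hne hx)
      filter_upwards [hmem] with y hy _ using hy
    obtain ⟨r, hr, hball⟩ := Metric.eventually_nhds_iff_ball.1 hev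
    let ψ : ContDiffBump x := ⟨r / 4, r / 2, by positivity, by linarith⟩
    let β : ContDiffBump (0 : ℝ) := ⟨1, 2, by norm_num, by norm_num⟩
    refine ⟨r / 4, by positivity, ?_⟩
    -- The jump itself is a polynomial-like smooth function on the whole space and serves as a
    -- factor of the test function, so the face term becomes the integral of the nonnegative `ψ J²`.
    set χ : Euc d → ℝ := fun y => ψ y * J y with hχ
    have hχs : ContDiff ℝ ∞ χ := ψ.contDiff.mul hJc
    have hχc : HasCompactSupport χ := ψ.hasCompactSupport.mul_right
    have hψ0 : ∀ y, y ∉ Metric.ball x r → ψ y = 0 := fun y hy => ψ.zero_of_le_dist (by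
      have : r ≤ dist y x := by simpa using hy
      change r / 2 ≤ dist y x
      linarith)
    -- On the face the factor `β` equals one for every `k`, so the face term does not depend on `k`,
    -- whereas the volume terms tend to zero.
    let φ : ℕ → Euc d → ℝ := fun k y => χ y * β (k * (inner ℝ n y - b))
    have hφs : ∀ k, ContDiff ℝ ∞ (φ k) := fun k => hχs.mul (β.contDiff.comp
      (contDiff_const.mul ((contDiff_const.inner ℝ contDiff_id).sub contDiff_const)))
    have hφc : ∀ k, HasCompactSupport (φ k) := fun k => hχc.mul_right
    have hlhs : ∀ k, ∑ F', M.faceInt F' (fun y => φ k y * inner ℝ (M.jump w F' y) (M.nF F')) =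
        ∫ y in M.faceSet F, ψ y * J y ^ 2 ∂(μHE[d - 1] : Measure (Euc d)) := by
      intro k
      rw [Finset.sum_eq_single F]
      · refine setIntegral_congr_fun hF fun y hy => ?_
        have h0 : inner ℝ n y - b = 0 := sub_eq_zero.2 hy.2
        have hβ1 : β 0 = 1 := β.one_of_mem_closedBall (by simp [β])
        simp only [φ, χ, h0, mul_zero, hβ1, mul_one]
        change ψ y * J y * J y = _
        ring
      · intro F' _ hne
        refine (setIntegral_congr_fun (hclosed F').measurableSet fun y hy => ?_).trans
          (integral_zero _ _)
        have : ψ y = 0 := hψ0 y fun hy' => hball y hy' F' hne hy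
        simp [φ, χ, this]
      · simp
    have hrhs : Tendsto (fun k => (∑ K, ∫ y in (M.elem K).carrier, φ k y * divg (w K) y) -
        ∫ y in Ω, g y * φ k y) atTop (𝓝 0) := by
      have h1 : Tendsto (fun k => ∑ K, ∫ y in (M.elem K).carrier, φ k y * divg (w K) y) atTop
          (𝓝 (∑ K : M.Elem, 0)) := by
        refine tendsto_finsetSum _ fun K _ => ?_
        have := tendsto_integral_layer hn0 b (β := β) (ψ := χ) β.continuous β.hasCompactSupport
          hχs.continuous hχc (Measure.absolutelyContinuous_of_le Measure.restrict_le_self)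
          ((M.elem K).integrableOn_carrier (continuous_divg ((hw K).of_le (by simp))))
        refine this.congr fun k => integral_congr_ae (Eventually.of_forall fun y => ?_)
        simp only [φ]; ring
      have h2 := tendsto_integral_layer hn0 b (β := β) (ψ := χ) β.continuous β.hasCompactSupport
          hχs.continuous hχc (Measure.absolutelyContinuous_of_le Measure.restrict_le_self) hgI
      simpa using h1.sub h2
    have hzero : ∫ y in M.faceSet F, ψ y * J y ^ 2 ∂(μHE[d - 1] : Measure (Euc d)) = 0 := by
      refine tendsto_nhds_unique (tendsto_const_nhds.congr fun k => ?_) hrhs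
      rw [← hlhs k]
      exact M.weak_divergence_identity hw hg (hφs k) (hφc k)
    have hint : IntegrableOn (fun y => ψ y * J y ^ 2) (M.faceSet F)
        (μHE[d - 1] : Measure (Euc d)) :=
      (M.elem (M.side F).1).integrableOn_face _ (ψ.continuous.mul (hJc.continuous.pow 2))
    have hae := (setIntegral_eq_zero_iff_of_nonneg_ae
      (Eventually.of_forall fun y => mul_nonneg ψ.nonneg (sq_nonneg (J y))) hint).1 hzero
    rw [EventuallyEq, ae_restrict_iff' hF, ae_iff] at hae
    refine measure_mono_null (fun y hy => ?_) hae
    simp only [mem_ofPred_eq, Classical.not_imp]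
    refine ⟨hy.1, ?_⟩
    have h1 : ψ y = 1 := ψ.one_of_mem_closedBall (Metric.ball_subset_closedBall hy.2.1)
    rw [h1]
    simpa using hy.2.2
  have hnull : (μHE[d - 1] : Measure (Euc d)) {y | M.GenericPt (M.side F) y ∧ J y ≠ 0} = 0 := by
    refine measure_null_of_locally_null _ fun x hx => ?_
    obtain ⟨r, hr, h0⟩ := hloc x hx.1
    refine ⟨{y | M.GenericPt (M.side F) y ∧ J y ≠ 0} ∩ Metric.ball x r,
      inter_mem self_mem_nhdsWithin (mem_nhdsWithin_of_mem_nhds (Metric.ball_mem_nhds x hr)), ?_⟩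
    refine measure_mono_null (fun y hy => ?_) h0
    exact ⟨hy.1.1.1, hy.2, hy.1.2⟩
  have hgen := M.ae_genericPt (M.side F)
  have hnull' : ∀ᵐ y ∂(μHE[d - 1] : Measure (Euc d)).restrict (M.faceSet F),
      ¬(M.GenericPt (M.side F) y ∧ J y ≠ 0) := by
    refine ae_restrict_of_ae ?_
    rw [ae_iff]
    simpa using hnull
  filter_upwards [hgen, hnull'] with y h1 h2
  by_contra h
  exact h2 ⟨h1, h⟩

end Mesh

/-! ### The convective form -/

namespace Mesh

variable {d : ℕ} {Ω : Set (Euc d)} (M : Mesh d Ω)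

theorem faceInt_const_mul (F : M.Faces) (c : ℝ) (f : Euc d → ℝ) :
    M.faceInt F (fun x => c * f x) = c * M.faceInt F f := integral_const_mul c f

theorem integrableOn_faceSet (F : M.Faces) {f : Euc d → ℝ} (hf : Continuous f) :
    IntegrableOn f (M.faceSet F) (μHE[d - 1] : Measure (Euc d)) :=
  (M.elem (M.side F).1).integrableOn_face _ hf

theorem faceInt_nonneg (F : M.Faces) {f : Euc d → ℝ} (hf : ∀ x, 0 ≤ f x) : 0 ≤ M.faceInt F f :=
  integral_nonneg hf

theorem faceInt_mono (F : M.Faces) {f g : Euc d → ℝ} (hf : Continuous f) (hg : Continuous g)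
    (h : ∀ x, f x ≤ g x) : M.faceInt F f ≤ M.faceInt F g :=
  integral_mono (M.integrableOn_faceSet F hf) (M.integrableOn_faceSet F hg) h

/-- The integrand on the left is half the divergence of `|u|² u`, to which the divergence theorem is
applied on each element. -/
theorem convection_volume_identity {u : M.Elem → Euc d → Euc d} (hu : ∀ K, ContDiff ℝ ∞ (u K)) :
    (M.vol fun K x => inner ℝ (fderiv ℝ (u K) x (u K x)) (u K x))
      + (1 / 2) * (M.vol fun K x => divg (u K) x * inner ℝ (u K x) (u K x)) =
    1 / 2 * ∑ K, ∑ i, ∫ x in (M.elem K).face i,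
      inner ℝ (u K x) (u K x) * inner ℝ (u K x) ((M.elem K).normal i)
        ∂(μHE[d - 1] : Measure (Euc d)) := by
  simp only [vol]
  rw [Finset.mul_sum, Finset.mul_sum, ← Finset.sum_add_distrib]
  refine Finset.sum_congr rfl fun K _ => ?_
  have hud : ∀ x, DifferentiableAt ℝ (u K) x := fun x => ((hu K).differentiable (by simp)) x
  have hfc : ContDiff ℝ ∞ fun x => inner ℝ (u K x) (u K x) := (hu K).inner ℝ (hu K)
  have h2 := (M.elem K).integral_divg (w := fun x => inner ℝ (u K x) (u K x) • u K x)
    ((hfc.smul (hu K)).of_le (by simp))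
  simp_rw [inner_smul_left] at h2
  simp only [conj_trivial] at h2
  rw [← h2]
  have hc1 : Continuous fun x => inner ℝ (fderiv ℝ (u K) x (u K x)) (u K x) :=
    (((hu K).continuous_fderiv (by simp)).clm_apply (hu K).continuous).inner (hu K).continuous
  have hc2 : Continuous fun x => divg (u K) x * inner ℝ (u K x) (u K x) :=
    (continuous_divg ((hu K).of_le (by simp))).mul hfc.continuous
  rw [← integral_const_mul, ← integral_const_mul,
    ← integral_add ((M.elem K).integrableOn_carrier hc1)
      (((M.elem K).integrableOn_carrier hc2).const_mul _)]
  refine integral_congr_ae (Eventually.of_forall fun x => ?_)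
  simp only
  rw [divg_smul (hfc.differentiable (by simp) x) (hud x),
    fderiv_inner_apply ℝ (hud x) (hud x), real_inner_comm (u K x) (fderiv ℝ (u K) x (u K x))]
  ring

theorem cForm_self {ζ : ℝ} (hζ : 0 ≤ ζ) {u : M.Elem → Euc d → Euc d}
    (hu : ∀ K, ContDiff ℝ ∞ (u K)) (hdiv : MemHdivZero Ω (M.glue u)) :
    M.cForm ζ u u u = M.convSeminorm ζ u u ^ 2 := by
  have hns : 0 ≤ ζ * ∑ F : M.IFace, M.faceInt (Sum.inl F) fun x =>
      |inner ℝ (M.avg u (Sum.inl F) x) (M.nF (Sum.inl F))| *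
      inner ℝ (M.jump u (Sum.inl F) x) (M.jump u (Sum.inl F) x) :=
    mul_nonneg hζ (Finset.sum_nonneg fun F _ => M.faceInt_nonneg _ fun x =>
      mul_nonneg (abs_nonneg _) real_inner_self_nonneg)
  rw [convSeminorm, Real.sq_sqrt hns, cForm, M.convection_volume_identity hu]
  have h := M.sum_sides fun s => ∫ x in M.sface s,
    inner ℝ (u s.1 x) (u s.1 x) * inner ℝ (u s.1 x) (M.snormal s) ∂(μHE[d - 1] : Measure (Euc d))
  have hB : ∀ F : M.BFace, ∫ x in M.sface (M.bdry F), inner ℝ (u (M.bdry F).1 x) (u (M.bdry F).1 x) *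
      inner ℝ (u (M.bdry F).1 x) (M.snormal (M.bdry F)) ∂(μHE[d - 1] : Measure (Euc d)) = 0 := by
    intro F
    refine integral_eq_zero_of_ae ?_
    have hae := M.ae_normal_jump_eq_zero hu hdiv (Sum.inr F)
    filter_upwards [hae] with x hx
    have hx' : inner ℝ (u (M.bdry F).1 x) (M.snormal (M.bdry F)) = 0 := hx
    simp [hx']
  have hc : ∀ (K : M.Elem) (v : Euc d),
      Continuous fun x => inner ℝ (u K x) (u K x) * inner ℝ (u K x) v :=
    fun K v => ((hu K).continuous.inner (hu K).continuous).mul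
      ((hu K).continuous.inner continuous_const)
  -- With a common normal component `a`, the two sides contribute `(|u₊|² - |u₋|²) a`, and the
  -- difference of squares is twice the jump times the average. Half of this cancels the central
  -- flux.
  have hI : ∀ F : M.IFace, (∫ x in M.sface (M.plus F),
      inner ℝ (u (M.plus F).1 x) (u (M.plus F).1 x) *
        inner ℝ (u (M.plus F).1 x) (M.snormal (M.plus F)) ∂(μHE[d - 1] : Measure (Euc d))) +
      (∫ x in M.sface (M.minus F), inner ℝ (u (M.minus F).1 x) (u (M.minus F).1 x) *
        inner ℝ (u (M.minus F).1 x) (M.snormal (M.minus F)) ∂(μHE[d - 1] : Measure (Euc d))) =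
      2 * M.faceInt (Sum.inl F) fun x =>
        inner ℝ (M.avg u (Sum.inl F) x) (M.nF (Sum.inl F)) *
          inner ℝ (M.jump u (Sum.inl F) x) (M.avg u (Sum.inl F) x) := by
    intro F
    rw [M.faceInt_plus_minus F _ _ (hc _ _) (hc _ _), ← faceInt_const_mul]
    refine integral_congr_ae ?_
    have hae := M.ae_normal_jump_eq_zero hu hdiv (Sum.inl F)
    filter_upwards [hae] with x hx
    have hn : M.snormal (M.minus F) = -M.snormal (M.plus F) := M.normal_opposite F
    rw [hn]
    change inner ℝ (u (M.plus F).1 x - u (M.minus F).1 x) (M.snormal (M.plus F)) = 0 at hx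
    change _ = 2 * (inner ℝ ((1 / 2 : ℝ) • (u (M.plus F).1 x + u (M.minus F).1 x))
      (M.snormal (M.plus F)) * inner ℝ (u (M.plus F).1 x - u (M.minus F).1 x)
        ((1 / 2 : ℝ) • (u (M.plus F).1 x + u (M.minus F).1 x)))
    rw [inner_sub_left, sub_eq_zero] at hx
    simp only [inner_smul_left, inner_smul_right, inner_add_left, inner_add_right, inner_sub_left,
      inner_neg_right, hx, conj_trivial, real_inner_comm (u (M.minus F).1 x) (u (M.plus F).1 x)]
    ring
  simp only [hB, hI, Finset.sum_const_zero, add_zero] at h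
  rw [← Finset.mul_sum] at h
  have h' : (∑ K, ∑ i, ∫ x in (M.elem K).face i,
      inner ℝ (u K x) (u K x) * inner ℝ (u K x) ((M.elem K).normal i)
        ∂(μHE[d - 1] : Measure (Euc d))) = _ := h
  rw [h']
  ring

end Mesh

/-! ### Coercivity of the viscous form -/

section Matrix

variable {d : ℕ}

theorem gradMat_apply {v : Euc d → Euc d} {x : Euc d} (hv : DifferentiableAt ℝ v x) (i j : Fin d) :
    gradMat v x i j = fderiv ℝ (fun y => v y i) x (EuclideanSpace.single j 1) := by
  have : HasFDerivAt (fun y => v y i) ((EuclideanSpace.proj i : Euc d →L[ℝ] ℝ).comp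
      (fderiv ℝ v x)) x := (EuclideanSpace.proj i : Euc d →L[ℝ] ℝ).hasFDerivAt.comp x hv.hasFDerivAt
  rw [this.fderiv]
  rfl

theorem stress_apply (v : Euc d → Euc d) (x : Euc d) (i j : Fin d) :
    stress v x i j = gradMat v x i j + gradMat v x j i -
      (2 / 3 * (1 : Matrix (Fin d) (Fin d) ℝ) i j) * ∑ l, gradMat v x l l := by
  simp only [stress, divg, Matrix.trace, Matrix.diag, Matrix.sub_apply, Matrix.add_apply,
    Matrix.transpose_apply, Matrix.smul_apply, smul_eq_mul]
  ring

theorem frob_self_nonneg (A : Matrix (Fin d) (Fin d) ℝ) : 0 ≤ frob A A :=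
  Finset.sum_nonneg fun _ _ => Finset.sum_nonneg fun _ _ => mul_self_nonneg _

/-- With `t = ∇ · v`, symmetry of `σ` and `tr σ = 2 (1 - d/3) t` give `σ : ∇v = ½ |σ|² + (2/3) (1 -
d/3) t²`. The surplus is `(2/9) t²` for `d = 2` and zero for `d = 3`. -/
theorem half_frob_stress_le (hd : d = 2 ∨ d = 3) (v : Euc d → Euc d) (x : Euc d) :
    1 / 2 * frob (stress v x) (stress v x) ≤ frob (stress v x) (gradMat v x) := by
  simp only [frob, stress_apply]
  generalize gradMat v x = G
  rcases hd with rfl | rfl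
  · simp only [Fin.sum_univ_two, Matrix.one_apply]
    simp only [Fin.isValue, ↓reduceIte, zero_ne_one, one_ne_zero]
    nlinarith [sq_nonneg (G 0 0 + G 1 1)]
  · simp only [Fin.sum_univ_three, Matrix.one_apply]
    simp only [Fin.isValue, ↓reduceIte, zero_ne_one, one_ne_zero, Fin.reduceEq]
    apply le_of_eq
    ring

/-- Cauchy–Schwarz for the Frobenius product of `A` with the rank-one matrix `a nᵀ`, whose Frobenius
norm is that of `a`. -/
theorem contract_sq_le (a : Euc d) (A : Matrix (Fin d) (Fin d) ℝ) {n : Euc d} (hn : ‖n‖ = 1) :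
    contract a A n ^ 2 ≤ inner ℝ a a * frob A A := by
  have h1 : contract a A n = ∑ p : Fin d × Fin d, (a p.1 * n p.2) * A p.1 p.2 := by
    rw [Fintype.sum_prod_type]
    exact Finset.sum_congr rfl fun i _ => Finset.sum_congr rfl fun j _ => by ring
  have h2 : ∑ p : Fin d × Fin d, (a p.1 * n p.2) ^ 2 = inner ℝ a a := by
    rw [Fintype.sum_prod_type]
    simp_rw [mul_pow, ← Finset.mul_sum, ← Finset.sum_mul]
    rw [← EuclideanSpace.real_norm_sq_eq, ← EuclideanSpace.real_norm_sq_eq, hn,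
      real_inner_self_eq_norm_sq]
    ring
  have h3 : ∑ p : Fin d × Fin d, A p.1 p.2 ^ 2 = frob A A := by
    rw [Fintype.sum_prod_type]
    exact Finset.sum_congr rfl fun i _ => Finset.sum_congr rfl fun j _ => by ring
  rw [h1, ← h2, ← h3]
  exact Finset.sum_mul_sq_le_sq_mul_sq _ _ _

theorem two_contract_le (a : Euc d) (A : Matrix (Fin d) (Fin d) ℝ) {n : Euc d} (hn : ‖n‖ = 1)
    {r : ℝ} (hr : 0 < r) : 2 * contract a A n ≤ r * inner ℝ a a + r⁻¹ * frob A A := by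
  have h := contract_sq_le a A hn
  have ha : 0 ≤ inner ℝ a a := real_inner_self_nonneg
  have hA := frob_self_nonneg A
  have h2 : (2 * contract a A n) ^ 2 ≤ (r * inner ℝ a a + r⁻¹ * frob A A) ^ 2 := by
    have e : r * r⁻¹ = 1 := mul_inv_cancel₀ hr.ne'
    have e2 : (r * inner ℝ a a) * (r⁻¹ * frob A A) = inner ℝ a a * frob A A := by
      calc _ = (r * r⁻¹) * (inner ℝ a a * frob A A) := by ring
        _ = _ := by rw [e, one_mul]
    nlinarith [sq_nonneg (r * inner ℝ a a - r⁻¹ * frob A A)]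
  exact (le_abs_self _).trans (abs_le_of_sq_le_sq h2 (by positivity))

theorem frob_half_add_le (A B : Matrix (Fin d) (Fin d) ℝ) :
    frob ((1 / 2 : ℝ) • (A + B)) ((1 / 2 : ℝ) • (A + B)) ≤ frob A A + frob B B := by
  simp only [frob, ← Finset.sum_add_distrib]
  refine Finset.sum_le_sum fun i _ => Finset.sum_le_sum fun j _ => ?_
  simp only [Matrix.smul_apply, Matrix.add_apply, smul_eq_mul]
  nlinarith [sq_nonneg (A i j - B i j), sq_nonneg (A i j), sq_nonneg (B i j)]

theorem IsPolyVec.contDiff {k : ℕ} {v : Euc d → Euc d} (hv : IsPolyVec k v) : ContDiff ℝ ∞ v :=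
  contDiff_euclidean.2 fun i => (hv i).contDiff

theorem IsPolyVec.stress {k : ℕ} {v : Euc d → Euc d} (hv : IsPolyVec k v) (i j : Fin d) :
    IsPoly k fun x => stress v x i j := by
  have hg : ∀ i j, IsPoly k fun x => gradMat v x i j := by
    intro i j
    have : (fun x => gradMat v x i j) =
        fun x => fderiv ℝ (fun y => v y i) x (EuclideanSpace.single j 1) :=
      funext fun x => gradMat_apply (hv.contDiff.differentiable (by simp) x) i j
    rw [this]
    exact (hv i).fderiv_single j
  simp_rw [stress_apply]
  exact ((hg i j).add (hg j i)).sub ((IsPoly.sum _ fun l _ => hg l l).const_mul _)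

theorem continuous_stress {v : Euc d → Euc d} (hv : ContDiff ℝ 1 v) : Continuous (stress v) := by
  have hg : ∀ i j, Continuous fun x => gradMat v x i j := by
    intro i j
    have : (fun x => gradMat v x i j) =
        fun x => fderiv ℝ (fun y => v y i) x (EuclideanSpace.single j 1) :=
      funext fun x => gradMat_apply (hv.differentiable (by simp) x) i j
    rw [this]
    have hj : ContDiff ℝ 1 fun y => v y i :=
      (EuclideanSpace.proj i : Euc d →L[ℝ] ℝ).contDiff.comp hv
    exact (hj.continuous_fderiv (by simp)).clm_apply continuous_const
  refine continuous_matrix fun i j => ?_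
  simp_rw [stress_apply]
  exact ((hg i j).add (hg j i)).sub
    (continuous_const.mul (continuous_finsetSum _ fun l _ => hg l l))

theorem continuous_gradMat {v : Euc d → Euc d} (hv : ContDiff ℝ 1 v) : Continuous (gradMat v) := by
  refine continuous_matrix fun i j => ?_
  have h := (hv.continuous_fderiv (by simp)).clm_apply
    (continuous_const (y := (EuclideanSpace.single j (1 : ℝ) : Euc d)))
  exact (EuclideanSpace.proj i : Euc d →L[ℝ] ℝ).continuous.comp h

theorem continuous_frob {A B : Euc d → Matrix (Fin d) (Fin d) ℝ} (hA : Continuous A)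
    (hB : Continuous B) : Continuous fun x => frob (A x) (B x) :=
  continuous_finsetSum _ fun i _ => continuous_finsetSum _ fun j _ =>
    (hA.matrix_elem i j).mul (hB.matrix_elem i j)

theorem continuous_contract {a : Euc d → Euc d} {A : Euc d → Matrix (Fin d) (Fin d) ℝ}
    (ha : Continuous a) (hA : Continuous A) (n : Euc d) :
    Continuous fun x => contract (a x) (A x) n :=
  continuous_finsetSum _ fun i _ => continuous_finsetSum _ fun j _ =>
    ((((EuclideanSpace.proj i : Euc d →L[ℝ] ℝ).continuous.comp ha).mul
      (hA.matrix_elem i j)).mul_const _)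

end Matrix

namespace Mesh

variable {d : ℕ} {Ω : Set (Euc d)} (M : Mesh d Ω)

theorem hF_pos (hd : 2 ≤ d) (F : M.Faces) : 0 < M.hF F := (M.elem _).diam_face_pos hd _

/-- `‖σ(w)‖²_{L²(Ω)}`. -/
noncomputable def stressSq (w : M.Elem → Euc d → Euc d) : ℝ :=
  M.vol fun K x => frob (stress (w K) x) (stress (w K) x)

/-- `∑_F h_F⁻¹ ‖[[w]]‖²_{L²(F)}`. -/
noncomputable def jumpSq (w : M.Elem → Euc d → Euc d) : ℝ :=
  ∑ F, (M.hF F)⁻¹ * M.faceInt F fun x => inner ℝ (M.jump w F x) (M.jump w F x)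

theorem symNorm_sq (hd : 2 ≤ d) (w : M.Elem → Euc d → Euc d) :
    M.symNorm 2 w ^ 2 = M.stressSq w + M.jumpSq w := by
  have h1 : (M.vol fun K x => ∑ i, ∑ j, |stress (w K) x i j| ^ (2 : ℝ)) = M.stressSq w := by
    simp only [stressSq, frob, Real.rpow_ofNat, sq_abs]
    simp only [sq]
  have h2 : (∑ F : M.Faces, 1 / (M.hF F) ^ ((2 : ℝ) - 1) *
      M.faceInt F fun x => ∑ i, |M.jump w F x i| ^ (2 : ℝ)) = M.jumpSq w := by
    refine Finset.sum_congr rfl fun F _ => ?_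
    rw [show (2 : ℝ) - 1 = 1 by norm_num, Real.rpow_one, one_div]
    simp only [Real.rpow_ofNat, sq_abs, real_inner_self_eq_norm_sq, EuclideanSpace.real_norm_sq_eq]
  have h3 : 0 ≤ M.stressSq w + M.jumpSq w := by
    refine add_nonneg (Finset.sum_nonneg fun K _ => integral_nonneg fun x => frob_self_nonneg _) ?_
    exact Finset.sum_nonneg fun F _ => mul_nonneg (inv_nonneg.2 (M.hF_pos hd F).le)
      (M.faceInt_nonneg F fun x => real_inner_self_nonneg)
  rw [symNorm, h1, h2, ← Real.sqrt_eq_rpow, Real.sq_sqrt h3]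

theorem continuous_avg_stress {w : M.Elem → Euc d → Euc d} (hw : ∀ K, ContDiff ℝ 1 (w K))
    (F : M.Faces) : Continuous (M.avg (fun K => stress (w K)) F) := by
  rcases F with F | F
  · exact ((continuous_stress (hw _)).add (continuous_stress (hw _))).const_smul (1 / 2 : ℝ)
  · exact continuous_stress (hw _)

/-- The trace inequality, summed over the mesh. -/
theorem exists_stress_trace_constant (d m : ℕ) (hd : 2 ≤ d) {ρ : ℝ} (hρ : 0 < ρ) :
    ∃ C : ℝ, 0 ≤ C ∧ ∀ (Ω : Set (Euc d)) (M : Mesh d Ω), M.ShapeRegular ρ →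
      ∀ w : M.Elem → Euc d → Euc d, (∀ K, IsPolyVec m (w K)) →
        ∑ F, M.hF F * M.faceInt F (fun x => frob (M.avg (fun K => stress (w K)) F x)
          (M.avg (fun K => stress (w K)) F x)) ≤ C * M.stressSq w := by
  obtain ⟨C, hC0, hC⟩ := Element.exists_trace_constant d m hρ
  refine ⟨C, hC0, fun Ω M hM w hw => ?_⟩
  have hwc : ∀ K, ContDiff ℝ 1 (w K) := fun K => (hw K).contDiff.of_le (by simp)
  have hfc : ∀ K, Continuous fun x => frob (stress (w K) x) (stress (w K) x) := fun K =>
    continuous_frob (continuous_stress (hwc K)) (continuous_stress (hwc K))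
  have hpt : ∀ K x, frob (stress (w K) x) (stress (w K) x) =
      ∑ i, ∑ j, stress (w K) x i j ^ 2 := fun K x => by simp only [frob, sq]
  have hK : ∀ K, ∑ i, Metric.diam ((M.elem K).face i) * ∫ x in (M.elem K).face i,
      frob (stress (w K) x) (stress (w K) x) ∂(μHE[d - 1] : Measure (Euc d)) ≤
        C * ∫ x in (M.elem K).carrier, frob (stress (w K) x) (stress (w K) x) := by
    intro K
    -- Without faces the left side is zero; otherwise a face of positive diameter shows that the
    -- element has positive diameter, as the trace inequality requires.
    rcases isEmpty_or_nonempty (M.elem K).Face with he | ⟨⟨i0⟩⟩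
    · rw [Finset.univ_eq_empty, Finset.sum_empty]
      exact mul_nonneg hC0 (integral_nonneg fun x => frob_self_nonneg _)
    have hdiam : 0 < Metric.diam (M.elem K).carrier :=
      ((M.elem K).diam_face_pos hd i0).trans_le ((M.elem K).diam_face_le i0)
    obtain ⟨c, hc⟩ := hM K
    have hcontS : ∀ i j, Continuous fun x => stress (w K) x i j ^ 2 := fun i j =>
      ((hw K).stress i j).continuous.pow 2
    calc ∑ i, Metric.diam ((M.elem K).face i) * ∫ x in (M.elem K).face i,
          frob (stress (w K) x) (stress (w K) x) ∂(μHE[d - 1] : Measure (Euc d))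
        ≤ ∑ i, Metric.diam (M.elem K).carrier * ∫ x in (M.elem K).face i,
          frob (stress (w K) x) (stress (w K) x) ∂(μHE[d - 1] : Measure (Euc d)) :=
          Finset.sum_le_sum fun i _ => mul_le_mul_of_nonneg_right ((M.elem K).diam_face_le i)
            (integral_nonneg fun x => frob_self_nonneg _)
      _ = ∑ a, ∑ b, Metric.diam (M.elem K).carrier * ∑ i, ∫ x in (M.elem K).face i,
            stress (w K) x a b ^ 2 ∂(μHE[d - 1] : Measure (Euc d)) := by
          simp_rw [← Finset.mul_sum]
          congr 1
          simp_rw [hpt]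
          have : ∀ i, ∫ x in (M.elem K).face i, ∑ a, ∑ b, stress (w K) x a b ^ 2
              ∂(μHE[d - 1] : Measure (Euc d)) = ∑ a, ∑ b, ∫ x in (M.elem K).face i,
                stress (w K) x a b ^ 2 ∂(μHE[d - 1] : Measure (Euc d)) := by
            intro i
            rw [integral_finsetSum _ fun a _ => integrable_finsetSum _ fun b _ =>
              (M.elem K).integrableOn_face i (hcontS a b)]
            refine Finset.sum_congr rfl fun a _ => ?_
            rw [integral_finsetSum _ fun b _ => (M.elem K).integrableOn_face i (hcontS a b)]
          simp_rw [this]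
          rw [Finset.sum_comm]
          refine Finset.sum_congr rfl fun a _ => ?_
          rw [Finset.sum_comm]
      _ ≤ ∑ a, ∑ b, C * ∫ x in (M.elem K).carrier, stress (w K) x a b ^ 2 :=
          Finset.sum_le_sum fun a _ => Finset.sum_le_sum fun b _ =>
            hC (M.elem K) c hdiam hc _ ((hw K).stress a b)
      _ = C * ∫ x in (M.elem K).carrier, frob (stress (w K) x) (stress (w K) x) := by
          simp_rw [← Finset.mul_sum, hpt]
          congr 1
          rw [integral_finsetSum _ fun a _ => integrable_finsetSum _ fun b _ =>
            (M.elem K).integrableOn_carrier (hcontS a b)]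
          refine Finset.sum_congr rfl fun a _ => ?_
          rw [integral_finsetSum _ fun b _ => (M.elem K).integrableOn_carrier (hcontS a b)]
  have hsides := M.sum_sides fun s => Metric.diam (M.sface s) * ∫ x in M.sface s,
      frob (stress (w s.1) x) (stress (w s.1) x) ∂(μHE[d - 1] : Measure (Euc d))
  calc ∑ F, M.hF F * M.faceInt F (fun x => frob (M.avg (fun K => stress (w K)) F x)
          (M.avg (fun K => stress (w K)) F x))
      ≤ _ := ?_
    _ = _ := hsides.symm
    _ ≤ ∑ K, C * ∫ x in (M.elem K).carrier, frob (stress (w K) x) (stress (w K) x) :=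
        Finset.sum_le_sum fun K _ => hK K
    _ = C * M.stressSq w := by rw [← Finset.mul_sum]; rfl
  rw [Fintype.sum_sum_type]
  -- Boundary terms agree on both sides. On an interior face both sides have the same point set, and
  -- the square of the average is at most the sum of the squares.
  refine add_le_add (Finset.sum_le_sum fun F _ => ?_) le_rfl
  have hconf : M.sface (M.minus F) = M.sface (M.plus F) := (M.conforming F).symm
  rw [hconf, ← mul_add]
  refine mul_le_mul_of_nonneg_left ?_ Metric.diam_nonneg
  have := M.faceInt_plus_minus F _ _ (hfc (M.plus F).1) (hfc (M.minus F).1)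
  rw [hconf] at this
  rw [this]
  have hca := M.continuous_avg_stress hwc (Sum.inl F)
  exact M.faceInt_mono _ (continuous_frob hca hca) ((hfc _).add (hfc _))
    fun x => frob_half_add_le _ _

/-- On the diagonal the two consistency terms coincide. Young's inequality with weight `s / h_F`
splits them into `s` times the jump term and `s⁻¹` times `h_F |{{σ}}|²`, and the latter is absorbed
by the trace bound. -/
theorem aForm_self_ge (hd : d = 2 ∨ d = 3) {η s C : ℝ} (hs : 0 < s) {w : M.Elem → Euc d → Euc d}
    (hw : ∀ K, ContDiff ℝ 1 (w K))
    (hC : ∑ F, M.hF F * M.faceInt F (fun x => frob (M.avg (fun K => stress (w K)) F x)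
          (M.avg (fun K => stress (w K)) F x)) ≤ C * M.stressSq w) :
    (1 / 2 - C / s) * M.stressSq w + (η - s) * M.jumpSq w ≤ M.aForm η w w := by
  have hd2 : 2 ≤ d := by omega
  have hvol : 1 / 2 * M.stressSq w ≤ M.vol fun K x => frob (stress (w K) x) (gradMat (w K) x) := by
    rw [stressSq, vol, vol, Finset.mul_sum]
    refine Finset.sum_le_sum fun K _ => ?_
    rw [← integral_const_mul]
    exact integral_mono (((M.elem K).integrableOn_carrier (continuous_frob (continuous_stress (hw K))
      (continuous_stress (hw K)))).const_mul _)
      ((M.elem K).integrableOn_carrier (continuous_frob (continuous_stress (hw K))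
        (continuous_gradMat (hw K)))) fun x => half_frob_stress_le hd (w K) x
  have hjc : ∀ F, Continuous (M.jump w F) := fun F => (M.contDiff_jump hw F).continuous
  have hface : ∀ F : M.Faces, 2 * M.faceInt F (fun x =>
      contract (M.jump w F x) (M.avg (fun K => stress (w K)) F x) (M.nF F)) ≤
      s * ((M.hF F)⁻¹ * M.faceInt F fun x => inner ℝ (M.jump w F x) (M.jump w F x)) +
      s⁻¹ * (M.hF F * M.faceInt F (fun x => frob (M.avg (fun K => stress (w K)) F x)
          (M.avg (fun K => stress (w K)) F x))) := by
    intro F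
    have hh := M.hF_pos hd2 F
    have hn : ‖M.nF F‖ = 1 := M.norm_snormal (M.side F)
    have hca := M.continuous_avg_stress hw F
    have hc1 : Continuous fun x => inner ℝ (M.jump w F x) (M.jump w F x) := (hjc F).inner (hjc F)
    have hc2 := continuous_frob hca hca
    have h1 := M.faceInt_mono F
      ((continuous_contract (hjc F) hca (M.nF F)).const_mul 2)
      ((hc1.const_mul (s / M.hF F)).add (hc2.const_mul (s / M.hF F)⁻¹))
      fun x => two_contract_le (M.jump w F x) (M.avg (fun K => stress (w K)) F x) hn
        (div_pos hs hh)
    rw [faceInt_const_mul] at h1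
    refine h1.trans (le_of_eq ?_)
    have h2 : M.faceInt F (fun x => s / M.hF F * inner ℝ (M.jump w F x) (M.jump w F x) +
        (s / M.hF F)⁻¹ * frob (M.avg (fun K => stress (w K)) F x)
          (M.avg (fun K => stress (w K)) F x)) = _ :=
      integral_add ((M.integrableOn_faceSet F hc1).const_mul _)
        ((M.integrableOn_faceSet F hc2).const_mul _)
    refine h2.trans ?_
    rw [integral_const_mul, integral_const_mul, inv_div, div_eq_mul_inv, div_eq_mul_inv]
    simp only [faceInt]
    ring
  have hsum := Finset.sum_le_sum fun F (_ : F ∈ Finset.univ) => hface F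
  rw [Finset.sum_add_distrib, ← Finset.mul_sum, ← Finset.mul_sum, ← Finset.mul_sum] at hsum
  have hη : (∑ F : M.Faces, M.faceInt F fun x =>
      η / M.hF F * inner ℝ (M.jump w F x) (M.jump w F x)) = η * M.jumpSq w := by
    rw [jumpSq, Finset.mul_sum]
    refine Finset.sum_congr rfl fun F _ => ?_
    rw [faceInt_const_mul]; ring
  have hC' := mul_le_mul_of_nonneg_left hC (inv_nonneg.2 hs.le)
  rw [aForm, hη]
  have hj : s * ∑ F, ((M.hF F)⁻¹ * M.faceInt F fun x => inner ℝ (M.jump w F x) (M.jump w F x)) =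
    s * M.jumpSq w := rfl
  have e : C / s * M.stressSq w = s⁻¹ * (C * M.stressSq w) := by ring
  rw [hj] at hsum
  linarith

/-- Coercivity of the viscous form. -/
theorem exists_coercivity_constant (d m : ℕ) (hd : d = 2 ∨ d = 3) {ρ : ℝ} (hρ : 0 < ρ) :
    ∃ η₀ : ℝ, ∀ η : ℝ, η₀ < η → ∃ c : ℝ, 0 < c ∧
      ∀ (Ω : Set (Euc d)) (M : Mesh d Ω), M.ShapeRegular ρ →
      ∀ w : M.Elem → Euc d → Euc d, (∀ K, IsPolyVec m (w K)) →
        c * M.symNorm 2 w ^ 2 ≤ M.aForm η w w := by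
  have hd2 : 2 ≤ d := by omega
  obtain ⟨C, hC0, hC⟩ := exists_stress_trace_constant d m hd2 hρ
  -- Both coefficients of the lower bound are positive exactly for `2 C < s < η`, which leaves room
  -- when `η > 2 C`; the midpoint is taken.
  refine ⟨2 * C, fun η hη => ?_⟩
  set s := (η + 2 * C) / 2 with hs
  have hs1 : 2 * C < s := by rw [hs]; linarith
  have hs2 : s < η := by rw [hs]; linarith
  have hs0 : 0 < s := by linarith
  have h1 : 0 < 1 / 2 - C / s := by
    rw [sub_pos, div_lt_div_iff₀ hs0 two_pos]; linarith
  have h2 : 0 < η - s := by linarith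
  refine ⟨min (1 / 2 - C / s) (η - s), lt_min h1 h2, fun Ω M hM w hw => ?_⟩
  refine le_trans ?_ (M.aForm_self_ge hd hs0 (fun K => (hw K).contDiff.of_le (by simp))
    (hC Ω M hM w hw))
  rw [M.symNorm_sq hd2, mul_add]
  refine add_le_add (mul_le_mul_of_nonneg_right (min_le_left _ _) ?_)
    (mul_le_mul_of_nonneg_right (min_le_right _ _) ?_)
  · exact Finset.sum_nonneg fun K _ => integral_nonneg fun x => frob_self_nonneg _
  · exact Finset.sum_nonneg fun F _ => mul_nonneg (inv_nonneg.2 (M.hF_pos hd2 F).le)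
      (M.faceInt_nonneg F fun x => real_inner_self_nonneg)

end Mesh

/-! ### A Gronwall inequality for absolutely continuous functions -/

section Gronwall

theorem _root_.LipschitzOnWith.comp_absolutelyContinuousOnInterval {X Y : Type*}
    [PseudoMetricSpace X] [PseudoMetricSpace Y] {f : ℝ → X} {g : X → Y} {S : Set X} {a b : ℝ}
    {C : NNReal} (hg : LipschitzOnWith C g S) (hf : AbsolutelyContinuousOnInterval f a b)
    (hS : ∀ t ∈ uIcc a b, f t ∈ S) : AbsolutelyContinuousOnInterval (fun t => g (f t)) a b := by
  rw [absolutelyContinuousOnInterval_iff] at hf ⊢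
  intro ε hε
  obtain ⟨δ, hδ, h⟩ := hf (ε / (C + 1)) (by positivity)
  refine ⟨δ, hδ, fun E hE hlen => ?_⟩
  have h1 := h E hE hlen
  have h2 : ∑ i ∈ Finset.range E.1, dist (g (f (E.2 i).1)) (g (f (E.2 i).2)) ≤
      C * ∑ i ∈ Finset.range E.1, dist (f (E.2 i).1) (f (E.2 i).2) := by
    rw [Finset.mul_sum]
    refine Finset.sum_le_sum fun i hi => ?_
    exact hg.dist_le_mul _ (hS _ (hE.1 i hi).1) _ (hS _ (hE.1 i hi).2)
  have h3 : 0 ≤ ∑ i ∈ Finset.range E.1, dist (f (E.2 i).1) (f (E.2 i).2) :=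
    Finset.sum_nonneg fun _ _ => dist_nonneg
  rw [lt_div_iff₀ (by positivity)] at h1
  nlinarith

theorem absolutelyContinuousOnInterval_const {X : Type*} [PseudoMetricSpace X] (x : X) (a b : ℝ) :
    AbsolutelyContinuousOnInterval (fun _ : ℝ => x) a b :=
  ((LipschitzWith.const x).lipschitzOnWith).absolutelyContinuousOnInterval

theorem absolutelyContinuousOnInterval_sum {ι : Type*} (s : Finset ι) {f : ι → ℝ → ℝ} {a b : ℝ}
    (hf : ∀ i ∈ s, AbsolutelyContinuousOnInterval (f i) a b) :
    AbsolutelyContinuousOnInterval (fun t => ∑ i ∈ s, f i t) a b := by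
  classical
  induction s using Finset.induction_on with
  | empty => simpa using absolutelyContinuousOnInterval_const (0 : ℝ) a b
  | insert i s his ih =>
    simp only [Finset.sum_insert his]
    exact (hf i (Finset.mem_insert_self i s)).fun_add
      (ih fun j hj => hf j (Finset.mem_insert_of_mem hj))

theorem lipschitzOnWith_sqrt {δ : ℝ} (hδ : 0 < δ) :
    LipschitzOnWith (Real.toNNReal (1 / (2 * Real.sqrt δ))) Real.sqrt (Ici δ) := by
  refine LipschitzOnWith.of_dist_le_mul fun x hx y hy => ?_
  have hs : 0 < Real.sqrt δ := Real.sqrt_pos.2 hδ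
  rw [Real.coe_toNNReal _ (by positivity), Real.dist_eq, Real.dist_eq]
  have hx1 := Real.sqrt_le_sqrt (show δ ≤ x from hx)
  have hy1 := Real.sqrt_le_sqrt (show δ ≤ y from hy)
  have hx0 : 0 ≤ x := hδ.le.trans hx
  have hy0 : 0 ≤ y := hδ.le.trans hy
  have e : |x - y| = |Real.sqrt x - Real.sqrt y| * (Real.sqrt x + Real.sqrt y) := by
    rw [← abs_of_nonneg (show 0 ≤ Real.sqrt x + Real.sqrt y by positivity), ← abs_mul]
    congr 1
    nlinarith [Real.mul_self_sqrt hx0, Real.mul_self_sqrt hy0]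
  rw [e, div_mul_eq_mul_div, one_mul, le_div_iff₀ (by positivity)]
  exact mul_le_mul_of_nonneg_left (by linarith) (abs_nonneg _)

variable {a b : ℝ} {y D h : ℝ → ℝ}

/-- Formally `(√y)' = y' / (2 √y) ≤ h`. As the root is not Lipschitz at zero, the argument is run
for `√(y + ε²)`, which is absolutely continuous and starts at most `ε` above `√(y a)`; then `ε` is
arbitrary. -/
theorem sqrt_le_add_integral (hab : a ≤ b) (hy : AbsolutelyContinuousOnInterval y a b)
    (hy0 : ∀ t ∈ Icc a b, 0 ≤ y t) (hh : IntervalIntegrable h volume a b) (hh0 : ∀ t, 0 ≤ h t)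
    (hineq : ∀ᵐ t, t ∈ Ioo a b → deriv y t ≤ 2 * (h t * Real.sqrt (y t))) :
    Real.sqrt (y b) ≤ Real.sqrt (y a) + ∫ t in a..b, h t := by
  refine le_of_forall_pos_le_add fun ε hε => ?_
  have hε2 : 0 < ε ^ 2 := by positivity
  have hac : AbsolutelyContinuousOnInterval (fun t => y t + ε ^ 2) a b :=
    hy.fun_add (absolutelyContinuousOnInterval_const _ a b)
  have hz : AbsolutelyContinuousOnInterval (fun t => Real.sqrt (y t + ε ^ 2)) a b := by
    refine (lipschitzOnWith_sqrt hε2).comp_absolutelyContinuousOnInterval hac fun t ht => ?_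
    rw [uIcc_of_le hab] at ht
    have := hy0 t ht
    simp only [mem_Ici]; linarith
  have h1 := hz.integral_deriv_eq_sub
  have h2 : ∫ t in a..b, deriv (fun t => Real.sqrt (y t + ε ^ 2)) t ≤ ∫ t in a..b, h t := by
    refine intervalIntegral.integral_mono_ae_restrict hab hz.intervalIntegrable_deriv hh ?_
    rw [Filter.EventuallyLE, ae_restrict_iff' measurableSet_Icc]
    have hna : ∀ᵐ t : ℝ, t ≠ a := by simp [ae_iff, measure_singleton]
    have hnb : ∀ᵐ t : ℝ, t ≠ b := by simp [ae_iff, measure_singleton]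
    filter_upwards [hineq, hy.ae_differentiableAt, hna, hnb] with t ht hd ha hb hI
    have hI' : t ∈ Ioo a b := ⟨lt_of_le_of_ne hI.1 (Ne.symm ha), lt_of_le_of_ne hI.2 hb⟩
    have hyt := hy0 t hI
    have hpos : 0 < y t + ε ^ 2 := by linarith
    have hdt := (((hd (by rwa [uIcc_of_le hab])).hasDerivAt.add_const (ε ^ 2)).sqrt hpos.ne').deriv
    rw [hdt, div_le_iff₀ (by positivity)]
    have hle : Real.sqrt (y t) ≤ Real.sqrt (y t + ε ^ 2) := Real.sqrt_le_sqrt (by linarith)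
    nlinarith [ht hI', hh0 t, mul_le_mul_of_nonneg_left hle (hh0 t)]
  rw [h1] at h2
  have h3 : Real.sqrt (y b) ≤ Real.sqrt (y b + ε ^ 2) := Real.sqrt_le_sqrt (by linarith)
  have h4 : Real.sqrt (y a + ε ^ 2) ≤ Real.sqrt (y a) + ε := by
    have ha := hy0 a (left_mem_Icc.2 hab)
    refine Real.sqrt_le_iff.2 ⟨by positivity, ?_⟩
    nlinarith [Real.sq_sqrt ha, mul_nonneg (Real.sqrt_nonneg (y a)) hε.le]
  linarith

/-- Energy inequality `½ y' + D ≤ h √y` in integrated form. -/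
theorem energy_gronwall (hab : a ≤ b) (hy : AbsolutelyContinuousOnInterval y a b)
    (hy0 : ∀ t ∈ Icc a b, 0 ≤ y t) (hh : IntervalIntegrable h volume a b) (hh0 : ∀ t, 0 ≤ h t)
    (hD : IntervalIntegrable D volume a b) (hD0 : ∀ t, 0 ≤ D t)
    (hineq : ∀ᵐ t, t ∈ Ioo a b → deriv y t + 2 * D t ≤ 2 * (h t * Real.sqrt (y t))) :
    1 / 2 * y b + ∫ t in a..b, D t ≤ 1 / 2 * (Real.sqrt (y a) + ∫ t in a..b, h t) ^ 2 := by
  set s := Real.sqrt (y a) with hs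
  set A : ℝ → ℝ := fun t => ∫ r in a..t, h r with hA
  have hsub : ∀ t ∈ Icc a b, uIcc a t ⊆ uIcc a b := fun t ht => by
    rw [uIcc_of_le hab, uIcc_of_le ht.1]; exact Icc_subset_Icc_right ht.2
  -- First pass: dropping the dissipation bounds `√y` at every time.
  have hbound : ∀ t ∈ Icc a b, Real.sqrt (y t) ≤ s + A t := by
    intro t ht
    refine sqrt_le_add_integral ht.1 (hy.mono (hsub t ht))
      (fun r hr => hy0 r ⟨hr.1, hr.2.trans ht.2⟩) (hh.mono_set (hsub t ht)) hh0 ?_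
    filter_upwards [hineq] with r hr hr'
    have := hr ⟨hr'.1, hr'.2.trans_le ht.2⟩
    linarith [hD0 r]
  have hAac : AbsolutelyContinuousOnInterval A a b :=
    hh.absolutelyContinuousOnInterval_intervalIntegral left_mem_uIcc
  have hsA : AbsolutelyContinuousOnInterval (fun t => s + A t) a b :=
    (absolutelyContinuousOnInterval_const s a b).fun_add hAac
  have hsq : AbsolutelyContinuousOnInterval (fun t => (s + A t) * (s + A t)) a b := hsA.fun_mul hsA
  have hA' := hh.ae_hasDerivAt_integral
  -- Second pass: by the bound just found, the right side is at most `2 h (s + A)`, the derivative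
  -- of `(s + A)²`. Its initial value `s²` is `y a`, which cancels upon integration.
  have h1 : ∫ t in a..b, (deriv y t + 2 * D t) ≤
      ∫ t in a..b, deriv (fun t => (s + A t) * (s + A t)) t := by
    refine intervalIntegral.integral_mono_ae_restrict hab
      (hy.intervalIntegrable_deriv.add (hD.const_mul 2)) hsq.intervalIntegrable_deriv ?_
    rw [Filter.EventuallyLE, ae_restrict_iff' measurableSet_Icc]
    have hna : ∀ᵐ t : ℝ, t ≠ a := by simp [ae_iff, measure_singleton]
    have hnb : ∀ᵐ t : ℝ, t ≠ b := by simp [ae_iff, measure_singleton]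
    filter_upwards [hineq, hA', hna, hnb] with t ht hd ha hb hI
    have hI' : t ∈ Ioo a b := ⟨lt_of_le_of_ne hI.1 (Ne.symm ha), lt_of_le_of_ne hI.2 hb⟩
    have hdA : HasDerivAt A (h t) t := hd (by rwa [uIcc_of_le hab]) a left_mem_uIcc
    have hdt := ((hdA.const_add s).mul (hdA.const_add s)).deriv
    have e : deriv (fun t => (s + A t) * (s + A t)) t = h t * (s + A t) + (s + A t) * h t := hdt
    rw [e]
    have := mul_le_mul_of_nonneg_left (hbound t hI) (hh0 t)
    linarith [ht hI']
  rw [intervalIntegral.integral_add hy.intervalIntegrable_deriv (hD.const_mul 2),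
    intervalIntegral.integral_const_mul, hy.integral_deriv_eq_sub, hsq.integral_deriv_eq_sub] at h1
  have hAa : A a = 0 := intervalIntegral.integral_same
  have hss : s * s = y a := Real.mul_self_sqrt (hy0 a (left_mem_Icc.2 hab))
  rw [hAa, add_zero, hss] at h1
  change _ ≤ 1 / 2 * (s + A b) ^ 2
  nlinarith

end Gronwall

/-! ### Square-integrable functions on the mesh -/

namespace Mesh

variable {d : ℕ} {Ω : Set (Euc d)} (M : Mesh d Ω)

theorem domain_ae_eq : (Ω : Set (Euc d)) =ᵐ[volume] ⋃ K, interior (M.elem K).carrier := by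
  have h : ∀ᵐ x, ∀ K, (x ∈ interior (M.elem K).carrier ↔ x ∈ (M.elem K).carrier) := by
    rw [ae_all_iff]
    intro K
    filter_upwards [(M.elem K).interior_ae_eq] with x hx
    exact iff_of_eq hx
  filter_upwards [h] with x hx
  refine propext ⟨fun hxΩ => ?_, fun hxU => ?_⟩
  · have : x ∈ ⋃ K, (M.elem K).carrier := by rw [M.covers]; exact subset_closure hxΩ
    obtain ⟨K, hK⟩ := mem_iUnion.1 this
    exact mem_iUnion.2 ⟨K, (hx K).2 hK⟩
  · obtain ⟨K, hK⟩ := mem_iUnion.1 hxU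
    exact M.interior_carrier_subset K hK

theorem integral_domain {Φ : Euc d → ℝ} (hΦ : IntegrableOn Φ Ω) :
    ∫ x in Ω, Φ x = M.vol fun _ x => Φ x := by
  rw [setIntegral_congr_set M.domain_ae_eq, integral_iUnion_fintype
    (fun K => isOpen_interior.measurableSet) (fun K L h => M.nonoverlap K L h)
    (fun K => hΦ.mono_set (M.interior_carrier_subset K))]
  exact Finset.sum_congr rfl fun K _ => setIntegral_congr_set (M.elem K).interior_ae_eq

theorem ae_glue_eq {V : Type*} [AddCommMonoid V] (w : M.Elem → Euc d → V) (K : M.Elem) :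
    ∀ᵐ x ∂(volume.restrict (M.elem K).carrier), M.glue w x = w K x := by
  have h1 := ae_restrict_mem (μ := volume) (M.elem K).isClosed_carrier.measurableSet
  have h2 := ae_restrict_of_ae (s := (M.elem K).carrier) (M.elem K).interior_ae_eq
  filter_upwards [h1, h2] with x hx hx2
  have hxi : x ∈ interior (M.elem K).carrier := (iff_of_eq hx2).2 hx
  rw [glue, Finset.sum_eq_single K]
  · exact indicator_of_mem hxi _
  · intro L _ hL
    exact indicator_of_notMem (fun h => Set.disjoint_left.1 (M.nonoverlap L K hL) h hxi) _
  · simp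

theorem vol_congr {f g : M.Elem → Euc d → ℝ}
    (h : ∀ K, ∀ᵐ x ∂(volume.restrict (M.elem K).carrier), f K x = g K x) : M.vol f = M.vol g :=
  Finset.sum_congr rfl fun K _ => integral_congr_ae (h K)

theorem ipVec_self_nonneg (w : M.Elem → Euc d → Euc d) : 0 ≤ M.ipVec w w :=
  Finset.sum_nonneg fun _ _ => integral_nonneg fun _ => real_inner_self_nonneg

theorem norm_sq_eq_integral (f : Lp (Euc d) 2 (volume.restrict Ω)) :
    ‖f‖ ^ 2 = ∫ x in Ω, inner ℝ (f x) (f x) := by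
  rw [← real_inner_self_eq_norm_sq, L2.inner_def]

/-- Cauchy–Schwarz in `L²(Ω)`: element boundaries are null sets, so elementwise sums agree with
inner products of the glued field. -/
theorem abs_ipVec_le (f : Lp (Euc d) 2 (volume.restrict Ω)) {u : M.Elem → Euc d → Euc d}
    (hu : MemLp (M.glue u) 2 (volume.restrict Ω)) :
    |M.ipVec (fun _ x => f x) u| ≤ ‖f‖ * M.normVec u := by
  set U := hu.toLp (M.glue u) with hU
  have hUae : ∀ᵐ x ∂(volume.restrict Ω), U x = M.glue u x := hu.coeFn_toLp
  have hUK : ∀ K, ∀ᵐ x ∂(volume.restrict (M.elem K).carrier), U x = u K x := by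
    intro K
    have h1 : ∀ᵐ x ∂(volume.restrict (interior (M.elem K).carrier)), U x = M.glue u x :=
      ae_restrict_of_ae_restrict_of_subset (M.interior_carrier_subset K) hUae
    rw [Measure.restrict_congr_set (M.elem K).interior_ae_eq] at h1
    filter_upwards [h1, M.ae_glue_eq u K] with x hx hx' using hx.trans hx'
  have h1 : M.ipVec (fun _ x => f x) u = inner ℝ f U := by
    rw [L2.inner_def, M.integral_domain (L2.integrable_inner f U)]
    refine M.vol_congr fun K => ?_
    filter_upwards [hUK K] with x hx
    rw [hx]
  have h2 : M.normVec u = ‖U‖ := by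
    rw [normVec, ← Real.sqrt_sq (norm_nonneg U), norm_sq_eq_integral,
      M.integral_domain (L2.integrable_inner U U)]
    congr 1
    refine M.vol_congr fun K => ?_
    filter_upwards [hUK K] with x hx
    rw [hx]
  rw [h1, h2]
  exact abs_real_inner_le_norm f U

theorem norm_gravity (hd : d = 2 ∨ d = 3) (g : ℝ) : ‖gravity d g‖ = |g| := by
  rw [← Real.sqrt_sq (norm_nonneg _), EuclideanSpace.real_norm_sq_eq, ← Real.sqrt_sq_eq_abs]
  congr 1
  rcases hd with rfl | rfl
  · simp [gravity, Fin.sum_univ_two]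
  · simp [gravity, Fin.sum_univ_three]

theorem abs_ipVec_buoyancy_le (hd : d = 2 ∨ d = 3) (β g : ℝ) {T : M.Elem → Euc d → ℝ}
    (hT : MemLp (M.glue T) 2 (volume.restrict Ω)) {u : M.Elem → Euc d → Euc d}
    (hu : MemLp (M.glue u) 2 (volume.restrict Ω)) :
    |M.ipVec (fun K x => (β * T K x) • gravity d g) u| ≤
      |β| * |g| * M.normSc T * M.normVec u := by
  have hL : MemLp (fun x => (β * M.glue T x) • gravity d g) 2 (volume.restrict Ω) := by
    have h1 : MemLp (fun x => M.glue T x • (β • gravity d g)) 2 (volume.restrict Ω) := by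
      have := (ContinuousLinearMap.toSpanSingleton ℝ (β • gravity d g)).comp_memLp' hT
      simpa [Function.comp_def] using this
    refine h1.ae_eq (Eventually.of_forall fun x => ?_)
    simp only [smul_smul, mul_comm]
  set f := hL.toLp _ with hf
  have hfK : ∀ K, ∀ᵐ x ∂(volume.restrict (M.elem K).carrier),
      f x = (β * T K x) • gravity d g := by
    intro K
    have h1 : ∀ᵐ x ∂(volume.restrict (interior (M.elem K).carrier)),
        f x = (β * M.glue T x) • gravity d g :=
      ae_restrict_of_ae_restrict_of_subset (M.interior_carrier_subset K) hL.coeFn_toLp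
    rw [Measure.restrict_congr_set (M.elem K).interior_ae_eq] at h1
    filter_upwards [h1, M.ae_glue_eq T K] with x hx hx'
    rw [hx, hx']
  have h1 : M.ipVec (fun K x => (β * T K x) • gravity d g) u = M.ipVec (fun _ x => f x) u := by
    refine M.vol_congr fun K => ?_
    filter_upwards [hfK K] with x hx
    rw [hx]
  have h2 : ‖f‖ = |β| * |g| * M.normSc T := by
    rw [← Real.sqrt_sq (norm_nonneg f), norm_sq_eq_integral,
      M.integral_domain (L2.integrable_inner f f), normSc, ← abs_mul, ← Real.sqrt_sq_eq_abs,
      ← Real.sqrt_mul (sq_nonneg _)]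
    congr 1
    rw [ipSc, vol, vol, Finset.mul_sum]
    refine Finset.sum_congr rfl fun K _ => ?_
    rw [← integral_const_mul]
    refine integral_congr_ae ?_
    filter_upwards [hfK K] with x hx
    rw [hx, real_inner_self_eq_norm_sq, norm_smul, norm_gravity hd, mul_pow, Real.norm_eq_abs,
      sq_abs, sq_abs]
    ring
  rw [h1, ← h2]
  exact M.abs_ipVec_le f hu

end Mesh

/-! ### Nodal coefficients -/

namespace Mesh

variable {d : ℕ} {Ω : Set (Euc d)} (M : Mesh d Ω)

section Parametric

variable {A : Type*} [TopologicalSpace A] [FirstCountableTopology A] [LocallyCompactSpace A]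

theorem continuous_vol {f : A → M.Elem → Euc d → ℝ}
    (hf : ∀ K, Continuous fun p : A × Euc d => f p.1 K p.2) : Continuous fun a => M.vol (f a) :=
  continuous_finsetSum _ fun K _ =>
    continuous_parametric_integral_of_continuous (f := fun a x => f a K x) (hf K)
      (M.elem K).isCompact_carrier

theorem continuous_faceInt (F : M.Faces) {f : A → Euc d → ℝ}
    (hf : Continuous fun p : A × Euc d => f p.1 p.2) : Continuous fun a => M.faceInt F (f a) := by
  have hc : IsCompact (M.faceSet F) := (M.elem (M.side F).1).isCompact_face (M.side F).2
  have hfin : IsFiniteMeasure ((μHE[d - 1] : Measure (Euc d)).restrict (M.faceSet F)) := by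
    have h := (M.elem (M.side F).1).integrableOn_face (M.side F).2
      (continuous_const (y := (1 : ℝ)))
    exact (integrable_const_iff_isFiniteMeasure one_ne_zero).1 h
  have := continuous_parametric_integral_of_continuous
    (μ := (μHE[d - 1] : Measure (Euc d)).restrict (M.faceSet F)) (f := f) hf hc
  simp only [Measure.restrict_restrict hc.isClosed.measurableSet, inter_self] at this
  exact this

end Parametric

section Recon

variable {ι V : Type*} [Fintype ι] [AddCommGroup V] [Module ℝ V]

/-- The piecewise polynomial field with nodal coefficients `a` in the basis `ℓ`. -/
noncomputable def recon {E : Type*} (ℓ : ι → Euc d → ℝ) (a : E → ι → V) (K : E) (x : Euc d) : V :=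
  ∑ j, ℓ j x • a K j

end Recon

variable {ι : Type*} [Fintype ι] {ℓ : ι → Euc d → ℝ}

theorem continuous_recon {V : Type*} [NormedAddCommGroup V] [NormedSpace ℝ V]
    (hℓ : ∀ j, Continuous (ℓ j)) (K : M.Elem) :
    Continuous fun p : (M.Elem → ι → V) × Euc d => recon ℓ p.1 K p.2 := by
  unfold recon
  fun_prop

theorem hasFDerivAt_recon (hℓ : ∀ j, ContDiff ℝ 1 (ℓ j)) (a : M.Elem → ι → Euc d) (K : M.Elem)
    (x : Euc d) :
    HasFDerivAt (recon ℓ a K) (∑ j, (fderiv ℝ (ℓ j) x).smulRight (a K j)) x :=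
  HasFDerivAt.fun_sum fun j _ =>
    (((hℓ j).differentiable one_ne_zero x).hasFDerivAt).smul_const (a K j)

theorem continuous_gradMat_recon (hℓ : ∀ j, ContDiff ℝ 1 (ℓ j)) (K : M.Elem) :
    Continuous fun p : (M.Elem → ι → Euc d) × Euc d => gradMat (recon ℓ p.1 K) p.2 := by
  have hd : ∀ j, Continuous (fderiv ℝ (ℓ j)) := fun j => (hℓ j).continuous_fderiv one_ne_zero
  refine continuous_matrix fun i k => ?_
  simp only [gradMat, Matrix.of_apply, (M.hasFDerivAt_recon hℓ _ K _).fderiv,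
    sum_apply, ContinuousLinearMap.smulRight_apply, PiLp.smul_apply,
    WithLp.ofLp_sum, Finset.sum_apply]
  fun_prop

theorem continuous_stressSq_recon (hℓ : ∀ j, ContDiff ℝ 1 (ℓ j)) :
    Continuous fun a : M.Elem → ι → Euc d => M.stressSq (recon ℓ a) := by
  refine M.continuous_vol fun K => ?_
  have hg := M.continuous_gradMat_recon hℓ K
  have hs : Continuous fun p : (M.Elem → ι → Euc d) × Euc d => stress (recon ℓ p.1 K) p.2 := by
    unfold stress divg
    exact (hg.add hg.matrix_transpose).sub
      ((continuous_const.mul hg.matrix_trace).smul continuous_const)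
  unfold frob
  exact continuous_finsetSum _ fun i _ => continuous_finsetSum _ fun j _ =>
    (hs.matrix_elem i j).mul (hs.matrix_elem i j)

theorem continuous_jump_recon (hℓ : ∀ j, Continuous (ℓ j)) (F : M.Faces) :
    Continuous fun p : (M.Elem → ι → Euc d) × Euc d => M.jump (recon ℓ p.1) F p.2 := by
  cases F with
  | inl F => exact (M.continuous_recon hℓ _).sub (M.continuous_recon hℓ _)
  | inr F => exact M.continuous_recon hℓ _

theorem continuous_avg_recon (hℓ : ∀ j, Continuous (ℓ j)) (F : M.Faces) :
    Continuous fun p : (M.Elem → ι → Euc d) × Euc d => M.avg (recon ℓ p.1) F p.2 := by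
  cases F with
  | inl F =>
    exact ((M.continuous_recon hℓ _).add (M.continuous_recon hℓ _)).const_smul (1 / 2 : ℝ)
  | inr F => exact M.continuous_recon hℓ _

/-- Composed with the continuous nodal values in time, this makes the dissipation integrand
continuous, hence integrable. -/
theorem continuous_symNorm_sq_recon (hd : 2 ≤ d) (hℓ : ∀ j, ContDiff ℝ 1 (ℓ j)) :
    Continuous fun a : M.Elem → ι → Euc d => M.symNorm 2 (recon ℓ a) ^ 2 := by
  simp only [M.symNorm_sq hd]
  refine (M.continuous_stressSq_recon hℓ).add (continuous_finsetSum _ fun F _ =>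
    continuous_const.mul (M.continuous_faceInt F ?_))
  have hj := M.continuous_jump_recon (fun j => (hℓ j).continuous) F
  exact hj.inner hj

theorem continuous_convSeminorm_sq_recon (ζ : ℝ) (hℓ : ∀ j, Continuous (ℓ j)) :
    Continuous fun a : M.Elem → ι → Euc d =>
      M.convSeminorm ζ (recon ℓ a) (recon ℓ a) ^ 2 := by
  unfold convSeminorm
  refine (Continuous.sqrt (continuous_const.mul (continuous_finsetSum _ fun F _ =>
    M.continuous_faceInt _ ?_))).pow 2
  have hj := M.continuous_jump_recon hℓ (Sum.inl F)
  exact (((M.continuous_avg_recon hℓ _).inner continuous_const).abs).mul (hj.inner hj)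

theorem continuous_normSc_recon (hℓ : ∀ j, Continuous (ℓ j)) :
    Continuous fun a : M.Elem → ι → ℝ => M.normSc (recon ℓ a) :=
  (M.continuous_vol fun K => (M.continuous_recon hℓ K).mul (M.continuous_recon hℓ K)).sqrt

/-- The mass matrix does not depend on time, so differentiating the kinetic energy and proving its
absolute continuity reduce to finitely many nodal curves. -/
theorem ipVec_recon (hℓ : ∀ j, Continuous (ℓ j)) (a b : M.Elem → ι → Euc d) :
    M.ipVec (recon ℓ a) (recon ℓ b) = ∑ K, ∑ j, ∑ l,
      (∫ x in (M.elem K).carrier, ℓ j x * ℓ l x) * inner ℝ (a K j) (b K l) := by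
  refine Finset.sum_congr rfl fun K _ => ?_
  have hi : ∀ j l, IntegrableOn (fun x => ℓ j x * ℓ l x * inner ℝ (a K j) (b K l))
      (M.elem K).carrier := fun j l =>
    (M.elem K).integrableOn_carrier (((hℓ j).mul (hℓ l)).mul continuous_const)
  have e : ∀ x, (inner ℝ (recon ℓ a K x) (recon ℓ b K x) : ℝ) =
      ∑ j, ∑ l, ℓ j x * ℓ l x * inner ℝ (a K j) (b K l) := fun x => by
    simp only [recon, sum_inner, inner_sum, real_inner_smul_left, real_inner_smul_right]
    rw [Finset.sum_comm]
    exact Finset.sum_congr rfl fun j _ => Finset.sum_congr rfl fun l _ => by ring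
  simp only [e]
  rw [integral_finsetSum _ fun j _ => integrable_finsetSum _ fun l _ => hi j l]
  refine Finset.sum_congr rfl fun j _ => ?_
  rw [integral_finsetSum _ fun l _ => hi j l]
  exact Finset.sum_congr rfl fun l _ => integral_mul_const _ _

theorem ipVec_comm (v w : M.Elem → Euc d → Euc d) : M.ipVec v w = M.ipVec w v := by
  simp only [ipVec, real_inner_comm]

/-- Time derivative of the kinetic energy. -/
theorem hasDerivAt_ipVec_recon (hℓ : ∀ j, Continuous (ℓ j)) {a : ℝ → M.Elem → ι → Euc d}
    {a' : M.Elem → ι → Euc d} {t : ℝ}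
    (ha : ∀ K j, HasDerivAt (fun s => a s K j) (a' K j) t) :
    HasDerivAt (fun s => M.ipVec (recon ℓ (a s)) (recon ℓ (a s)))
      (2 * M.ipVec (recon ℓ a') (recon ℓ (a t))) t := by
  have e : 2 * M.ipVec (recon ℓ a') (recon ℓ (a t)) =
      ∑ K, ∑ j, ∑ l, (∫ x in (M.elem K).carrier, ℓ j x * ℓ l x) *
        (inner ℝ (a t K j) (a' K l) + inner ℝ (a' K j) (a t K l)) := by
    rw [two_mul]
    nth_rewrite 1 [M.ipVec_comm]
    simp only [M.ipVec_recon hℓ, mul_add, Finset.sum_add_distrib]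
  rw [e]
  simp only [M.ipVec_recon hℓ]
  exact HasDerivAt.fun_sum fun K _ => HasDerivAt.fun_sum fun j _ => HasDerivAt.fun_sum fun l _ =>
    ((ha K j).inner ℝ (ha K l)).const_mul _

end Mesh

/-! ### Absolutely continuous curves in Euclidean space -/

section Curves

variable {d : ℕ} {a b : ℝ}

theorem AbsolutelyContinuousOnInterval.coord {f : ℝ → Euc d}
    (hf : AbsolutelyContinuousOnInterval f a b) (i : Fin d) :
    AbsolutelyContinuousOnInterval (fun t => f t i) a b :=
  ((EuclideanSpace.proj (𝕜 := ℝ) i).lipschitz.lipschitzOnWith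
    (s := univ)).comp_absolutelyContinuousOnInterval hf fun _ _ => mem_univ _

theorem AbsolutelyContinuousOnInterval.inner_right {f g : ℝ → Euc d}
    (hf : AbsolutelyContinuousOnInterval f a b) (hg : AbsolutelyContinuousOnInterval g a b) :
    AbsolutelyContinuousOnInterval (fun t => (inner ℝ (f t) (g t) : ℝ)) a b := by
  simp only [PiLp.inner_apply]
  refine absolutelyContinuousOnInterval_sum _ fun i _ => ?_
  simp only [RCLike.inner_apply, conj_trivial]
  exact (AbsolutelyContinuousOnInterval.coord hg i).fun_mul
    (AbsolutelyContinuousOnInterval.coord hf i)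

theorem AbsolutelyContinuousOnInterval.ae_differentiableAt_euc {f : ℝ → Euc d}
    (hf : AbsolutelyContinuousOnInterval f a b) :
    ∀ᵐ t, t ∈ uIcc a b → DifferentiableAt ℝ f t := by
  have h : ∀ᵐ t, ∀ i, t ∈ uIcc a b → DifferentiableAt ℝ (fun s => f s i) t :=
    ae_all_iff.2 fun i => (AbsolutelyContinuousOnInterval.coord hf i).ae_differentiableAt
  filter_upwards [h] with t ht hI
  exact differentiableAt_euclidean.2 fun i => ht i hI

end Curves

theorem Mesh.absolutelyContinuousOnInterval_ipVec_recon {d : ℕ} {Ω : Set (Euc d)} (M : Mesh d Ω)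
    {ι : Type*} [Fintype ι] {ℓ : ι → Euc d → ℝ} (hℓ : ∀ j, Continuous (ℓ j))
    {c : ℝ → M.Elem → ι → Euc d} {a b : ℝ}
    (hc : ∀ K j, AbsolutelyContinuousOnInterval (fun t => c t K j) a b) :
    AbsolutelyContinuousOnInterval
      (fun t => M.ipVec (Mesh.recon ℓ (c t)) (Mesh.recon ℓ (c t))) a b := by
  simp only [M.ipVec_recon hℓ]
  exact absolutelyContinuousOnInterval_sum _ fun K _ => absolutelyContinuousOnInterval_sum _
    fun j _ => absolutelyContinuousOnInterval_sum _ fun l _ =>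
      (AbsolutelyContinuousOnInterval.inner_right (hc K j) (hc K l)).const_mul _

/-! ### The energy estimate -/

theorem IsPolyVec.eq_sum_nodal {d k : ℕ} {t : Finset (Euc d)} {ℓ : t → Euc d → ℝ}
    (h : ∀ f ∈ polySpace d k, ∀ x, f x = ∑ j : t, f j * ℓ j x) {w : Euc d → Euc d}
    (hw : IsPolyVec k w) (x : Euc d) : w x = ∑ j : t, ℓ j x • w j := by
  ext i
  rw [h _ (hw i) x]
  simp [mul_comm]

/-- The difference of the two sides is `(x - y)² + (x - z)² + (y - z)² + 2 y² + 2 z²`. -/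
theorem sq_add_three_le (x y z : ℝ) :
    (x + y + z) ^ 2 ≤ 3 * x ^ 2 + 5 * y ^ 2 + 5 * z ^ 2 := by
  nlinarith [sq_nonneg (x - y), sq_nonneg (x - z), sq_nonneg (y - z), sq_nonneg y, sq_nonneg z]

theorem IsSolution.stability {d m : ℕ} (hd : d = 2 ∨ d = 3) {Ω : Set (Euc d)} {M : Mesh d Ω}
    {S : Spaces M m} {prm : Params} (hν : 0 ≤ prm.ν) (hζ : 0 ≤ prm.ζ) {η c t₀ tₙ : ℝ} (hc : 0 < c)
    (hcoer : ∀ w : M.Elem → Euc d → Euc d, (∀ K, IsPolyVec m (w K)) →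
      c * M.symNorm 2 w ^ 2 ≤ M.aForm η w w)
    (ht : t₀ ≤ tₙ) {fu : ℝ → Lp (Euc d) 2 (volume.restrict Ω)}
    {fT : ℝ → Lp ℝ 2 (volume.restrict Ω)} (hfu : IntegrableOn fu (Ioo t₀ tₙ))
    {u : ℝ → M.Elem → Euc d → Euc d} {T p : ℝ → M.Elem → Euc d → ℝ}
    (h : IsSolution M S prm η t₀ tₙ fu fT u T p) :
    IntervalIntegrable (fun s => M.convSeminorm prm.ζ (u s) (u s) ^ 2) volume t₀ tₙ ∧
    IntervalIntegrable (fun s => M.symNorm 2 (u s) ^ 2) volume t₀ tₙ ∧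
    IntervalIntegrable (fun s => M.normSc (T s)) volume t₀ tₙ ∧
    1 / 2 * M.normVec (u tₙ) ^ 2
      + (∫ s in t₀..tₙ, M.convSeminorm prm.ζ (u s) (u s) ^ 2)
      + c * prm.ν * (∫ s in t₀..tₙ, M.symNorm 2 (u s) ^ 2)
    ≤ 1 / 2 * (3 * M.normVec (u t₀) ^ 2
        + 5 * prm.β ^ 2 * prm.g ^ 2 * (∫ s in t₀..tₙ, M.normSc (T s)) ^ 2
        + 5 * (∫ s in t₀..tₙ, ‖fu s‖) ^ 2) := by
  have hd2 : 2 ≤ d := by omega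
  obtain ⟨N, ℓ, hℓ, hN⟩ := exists_interpolation (polySpace d m)
  obtain ⟨N', ℓ', hℓ', hN'⟩ := exists_interpolation (polySpace d S.degR)
  have hℓ1 : ∀ j, ContDiff ℝ 1 (ℓ j) := fun j => IsPoly.contDiff (hℓ j)
  have hℓ0 : ∀ j, Continuous (ℓ j) := fun j => (hℓ1 j).continuous
  have hℓ'0 : ∀ j, Continuous (ℓ' j) := fun j => IsPoly.continuous (hℓ' j)
  set a : ℝ → M.Elem → N → Euc d := fun t K j => u t K j with ha
  set b : ℝ → M.Elem → N' → ℝ := fun t K j => T t K j with hb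
  have hu : ∀ t ∈ Icc t₀ tₙ, u t = Mesh.recon ℓ (a t) := fun t hI => by
    funext K x
    exact (S.polyW _ (h.memW t hI) K).eq_sum_nodal hN x
  have hT : ∀ t ∈ Icc t₀ tₙ, T t = Mesh.recon ℓ' (b t) := fun t hI => by
    funext K x
    rw [hN' _ (S.polyR _ (h.memR t hI) K) x]
    simp [Mesh.recon, hb, mul_comm]
  have haC : ContinuousOn a (Icc t₀ tₙ) := by
    refine continuousOn_pi.2 fun K => continuousOn_pi.2 fun j => ?_
    have := (h.acU K j).continuousOn
    rwa [uIcc_of_le ht] at this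
  have hbC : ContinuousOn b (Icc t₀ tₙ) := by
    refine continuousOn_pi.2 fun K => continuousOn_pi.2 fun j => ?_
    have := (h.acT K j).continuousOn
    rwa [uIcc_of_le ht] at this
  have hI1 : IntervalIntegrable (fun s => M.convSeminorm prm.ζ (u s) (u s) ^ 2) volume t₀ tₙ := by
    refine ContinuousOn.intervalIntegrable ?_
    rw [uIcc_of_le ht]
    refine ((M.continuous_convSeminorm_sq_recon prm.ζ hℓ0).comp_continuousOn haC).congr
      fun s hs => ?_
    simp only [Function.comp_apply, ← hu s hs]
  have hI2 : IntervalIntegrable (fun s => M.symNorm 2 (u s) ^ 2) volume t₀ tₙ := by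
    refine ContinuousOn.intervalIntegrable ?_
    rw [uIcc_of_le ht]
    refine ((M.continuous_symNorm_sq_recon hd2 hℓ1).comp_continuousOn haC).congr fun s hs => ?_
    simp only [Function.comp_apply, ← hu s hs]
  have hI3 : IntervalIntegrable (fun s => M.normSc (T s)) volume t₀ tₙ := by
    refine ContinuousOn.intervalIntegrable ?_
    rw [uIcc_of_le ht]
    refine ((M.continuous_normSc_recon hℓ'0).comp_continuousOn hbC).congr fun s hs => ?_
    simp only [Function.comp_apply, ← hT s hs]
  have hI4 : IntervalIntegrable (fun s => ‖fu s‖) volume t₀ tₙ :=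
    ((intervalIntegrable_iff_integrableOn_Ioo_of_le ht).2 hfu).norm
  refine ⟨hI1, hI2, hI3, ?_⟩
  set y : ℝ → ℝ := fun t => M.ipVec (Mesh.recon ℓ (a t)) (Mesh.recon ℓ (a t)) with hy
  set D : ℝ → ℝ := fun t =>
    M.convSeminorm prm.ζ (u t) (u t) ^ 2 + c * prm.ν * M.symNorm 2 (u t) ^ 2 with hD
  set f : ℝ → ℝ := fun t => |prm.β| * |prm.g| * M.normSc (T t) + ‖fu t‖ with hf
  have hyn : ∀ t ∈ Icc t₀ tₙ, Real.sqrt (y t) = M.normVec (u t) := fun t hI => by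
    rw [hu t hI]; rfl
  have hineq : ∀ᵐ t, t ∈ Ioo t₀ tₙ → deriv y t + 2 * D t ≤ 2 * (f t * Real.sqrt (y t)) := by
    -- Absolute continuity is assumed at each point separately, with a null set of times depending
    -- on the point; finitely many nodes leave a single null set.
    have hdiff : ∀ᵐ t, ∀ K, ∀ j : N, t ∈ uIcc t₀ tₙ →
        DifferentiableAt ℝ (fun s => a s K j) t :=
      ae_all_iff.2 fun K => ae_all_iff.2 fun j =>
        AbsolutelyContinuousOnInterval.ae_differentiableAt_euc (h.acU K j)
    filter_upwards [hdiff, h.mass, h.momentum] with t hdt hmass hmom hI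
    have hIcc : t ∈ Icc t₀ tₙ := Ioo_subset_Icc_self hI
    have hW := h.memW t hIcc
    have hder : ∀ K j, HasDerivAt (fun s => a s K j) (deriv (fun s => a s K j) t) t :=
      fun K j => (hdt K j (by rwa [uIcc_of_le ht])).hasDerivAt
    have hdu : (fun K x => deriv (fun s => u s K x) t) =
        Mesh.recon ℓ fun K j => deriv (fun s => a s K j) t := by
      funext K x
      -- At an interior time the nodal representation holds for all nearby times, so it may be
      -- differentiated at every `x`.
      have e : (fun s => u s K x) =ᶠ[𝓝 t] fun s => Mesh.recon ℓ (a s) K x := by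
        filter_upwards [Icc_mem_nhds hI.1 hI.2] with s hs
        rw [hu s hs]
      rw [e.deriv_eq]
      exact (HasDerivAt.fun_sum fun j _ => (hder K j).const_smul (ℓ j x)).deriv
    have hy' : deriv y t = 2 * M.ipVec (fun K x => deriv (fun s => u s K x) t) (u t) := by
      rw [(M.hasDerivAt_ipVec_recon hℓ0 hder).deriv, hdu, ← hu t hIcc]
    -- The velocity is its own test function; the pressure term vanishes by the mass equation tested
    -- with the pressure.
    have hm := hmom hI (u t) hW
    rw [hmass hI (p t) (h.memQ t hIcc),
      M.cForm_self hζ (fun K => (S.polyW _ hW K).contDiff) (S.subW _ hW)] at hm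
    have h1 := (abs_le.1 (M.abs_ipVec_buoyancy_le hd prm.β prm.g
      (S.subR _ (h.memR t hIcc)).1 (S.subW _ hW).1)).1
    have h2 := (abs_le.1 (M.abs_ipVec_le (fu t) (S.subW _ hW).1)).2
    have h3 := mul_le_mul_of_nonneg_left (hcoer (u t) fun K => S.polyW _ hW K) hν
    rw [hy', hyn t hIcc]
    simp only [hD, hf]
    linarith
  have hDint : IntervalIntegrable D volume t₀ tₙ := hI1.add (hI2.const_mul _)
  have hfint : IntervalIntegrable f volume t₀ tₙ := (hI3.const_mul _).add hI4
  have key := energy_gronwall ht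
    (M.absolutelyContinuousOnInterval_ipVec_recon hℓ0 fun K j => h.acU K j)
    (fun t _ => M.ipVec_self_nonneg _) hfint
    (fun t => add_nonneg (mul_nonneg (by positivity) (Real.sqrt_nonneg _)) (norm_nonneg _)) hDint
    (fun t => add_nonneg (sq_nonneg _) (mul_nonneg (mul_nonneg hc.le hν) (sq_nonneg _))) hineq
  have hyN : y tₙ = M.normVec (u tₙ) ^ 2 := by
    rw [← hyn _ (right_mem_Icc.2 ht), Real.sq_sqrt (M.ipVec_self_nonneg _)]
  change 1 / 2 * y tₙ + _ ≤ 1 / 2 * (Real.sqrt (y t₀) + _) ^ 2 at key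
  rw [hyN, hyn _ (left_mem_Icc.2 ht), intervalIntegral.integral_add hI1 (hI2.const_mul _),
    intervalIntegral.integral_const_mul, intervalIntegral.integral_add (hI3.const_mul _) hI4,
    intervalIntegral.integral_const_mul, ← add_assoc, ← add_assoc] at key
  refine key.trans ?_
  have h5 := sq_add_three_le (M.normVec (u t₀))
    (|prm.β| * |prm.g| * ∫ s in t₀..tₙ, M.normSc (T s)) (∫ s in t₀..tₙ, ‖fu s‖)
  rw [mul_pow, mul_pow, sq_abs, sq_abs] at h5
  linarith

end VersatileMixed

/-! ### The stability theorem, with the coercivity constant as `C_III`. -/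

theorem mainTheorem3 (d : ℕ) (hd : d = 2 ∨ d = 3) (m : ℕ) (ρ : ℝ) (hρ : 0 < ρ) :
    ∃ η₀ : ℝ, ∀ η : ℝ, η₀ < η → ∃ C_III : ℝ, 0 < C_III ∧
      ∀ (Ω : Set (VersatileMixed.Euc d)) (M : VersatileMixed.Mesh d Ω),
        M.ShapeRegular ρ →
      ∀ (S : VersatileMixed.Spaces M m) (prm : VersatileMixed.Params),
        0 ≤ prm.ν → 0 < prm.Cv → 0 ≤ prm.ζ →
      ∀ (t₀ tₙ : ℝ), t₀ ≤ tₙ →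
      ∀ (fu : ℝ → Lp (VersatileMixed.Euc d) 2 (volume.restrict Ω))
        (fT : ℝ → Lp ℝ 2 (volume.restrict Ω)),
        IntegrableOn fu (Ioo t₀ tₙ) →
      ∀ (u : ℝ → M.Elem → VersatileMixed.Euc d → VersatileMixed.Euc d)
        (T p : ℝ → M.Elem → VersatileMixed.Euc d → ℝ),
        VersatileMixed.IsSolution M S prm η t₀ tₙ fu fT u T p →
      IntervalIntegrable (fun s => M.convSeminorm prm.ζ (u s) (u s) ^ 2) volume t₀ tₙ ∧
      IntervalIntegrable (fun s => M.symNorm 2 (u s) ^ 2) volume t₀ tₙ ∧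
      IntervalIntegrable (fun s => M.normSc (T s)) volume t₀ tₙ ∧
      1 / 2 * M.normVec (u tₙ) ^ 2
        + (∫ s in t₀..tₙ, M.convSeminorm prm.ζ (u s) (u s) ^ 2)
        + C_III * prm.ν * (∫ s in t₀..tₙ, M.symNorm 2 (u s) ^ 2)
      ≤ 1 / 2 * (3 * M.normVec (u t₀) ^ 2
          + 5 * prm.β ^ 2 * prm.g ^ 2 * (∫ s in t₀..tₙ, M.normSc (T s)) ^ 2
          + 5 * (∫ s in t₀..tₙ, ‖fu s‖) ^ 2) := by
  obtain ⟨η₀, h⟩ := VersatileMixed.Mesh.exists_coercivity_constant d m hd hρ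
  refine ⟨η₀, fun η hη => ?_⟩
  obtain ⟨c, hc, hcoer⟩ := h η hη
  refine ⟨c, hc, fun Ω M hM S prm hν _ hζ t₀ tₙ ht fu fT hfu u T p hsol => ?_⟩
  exact hsol.stability hd hν hζ hc (hcoer Ω M hM) ht hfu
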